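/- **Setting.** Let $\xi$ be a probability distribution on a state space $\mathbb X$, $\lambda$ a base measure on an action space $\mathbb A$, $\pi(x,\cdot)$ a (known) probability density with respect to $\lambda$ for every $x\in\mathbb X$, and $g:\mathbb X\times\mathbb A\to\mathbb R$ a (known) weight function. Let $n\ge 2$ be even and let $(X_i,A_i,Y_i)_{i=1}^n$ be i.i.d. with $X_i\sim\xi$, $A_i\mid X_i\sim\pi(X_i,\cdot)$, $\mathbb E[Y_i\mid X_i,A_i]=\mu^*(X_i,A_i)$ and finite conditional variance $\sigma^2(x,a)=\mathrm{Var}(Y\mid X=x,A=a)$. Write $\langle h_1,h_2\rangle=\int_{\mathbb A}h_1h_2\,d\lambda$, and set $$\tau^*=\int_{\mathbb A}\mathbb E_\xi[g(X,a)\mu^*(X,a)]\,d\lambda(a),\qquad \|h\|_\omega^2=\int_{\mathbb A}\mathbb E_\xi\Big[\frac{g^2(X,a)}{\pi(X,a)}h^2(X,a)\Big]d\lambda(a),$$ $$v_*^2=\mathrm{Var}\big(\langle g(X,\cdot),\mu^*(X,\cdot)\rangle\big)+\|\sigma\|_\omega^2 .$$ Let $\mathbb L^2_\omega$ be the Hilbert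 space of the norm $\|\cdot\|_\omega$, $\mathbb B_\omega(r)$ its closed ball of radius $r$ about $0$, and $\mathrm{diam}_\omega$ the diameter in this norm. **Estimator.** Given a class $\mathcal F$ of functions on $\mathbb X\times\mathbb A$, for $j\in\{1,2\}$ let $$\widehat\mu^{(j)}\in\arg\min_{\mu\in\mathcal F}\ \frac{1}{n/2}\sum_i\frac{g^2(X_i,A_i)}{\pi^2(X_i,A_i)}\{\mu(X_i,A_i)-Y_i\}^2,$$ the sum running over the first half of the sample for $j=1$ and over the second half for $j=2$. Put $\widehat f^{(j)}(x,a)=\frac{g(x,a)\widehat\mu^{(j)}(x,a)}{\pi(x,a)}-\langle g(x,\cdot),\widehat\mu^{(j)}(x,\cdot)\rangle$ and $$\widehat\tau_n=\frac1n\sum_{i=1}^{n/2}\Big\{\frac{g(X_i,A_i)}{\pi(X_i,A_i)}Y_i-\widehat f^{(2)}(X_i,A_i)\Big\}+\frac1n\sum_{i=n/2+1}^{n}\Big\{\frac{g(X_i,A_i)}{\pi(X_i,A_i)}Y_i-\widehat f^{(1)}(X_i,A_i)\Big\}.$$ **Critical radii.** For a class $\mathcal H$ and i.i.d. Rademacher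 signs $\varepsilon_i$ independent of the data, let $$\mathcal S_m^2(\mathcal H)=\mathbb E\Big[\sup_{f\in\mathcal H}\Big\{\frac1m\sum_{i=1}^m\frac{\varepsilon_i g^2(X_i,A_i)}{\pi^2(X_i,A_i)}\big(Y_i-\mu^*(X_i,A_i)\big)f(X_i,A_i)\Big\}^2\Big],$$ $$\mathcal R_m(\mathcal H)=\mathbb E\Big[\sup_{f\in\mathcal H}\frac1m\sum_{i=1}^m\frac{\varepsilon_i g(X_i,A_i)}{\pi(X_i,A_i)}f(X_i,A_i)\Big].$$ For $\mu\in\mathcal F$ let $s_m(\mu)$ and $r_m(\mu)$ be the smallest non-negative solutions (the infimum of the positive solutions, $+\infty$ if there are none) of $$\tfrac1s\,\mathcal S_m\big((\mathcal F-\mu)\cap\mathbb B_\omega(s)\big)\le s,\qquad \tfrac1r\,\mathcal R_m\big((\mathcal F-\mu)\cap\mathbb B_\omega(r)\big)\le\tfrac{\alpha_1\alpha_2}{32}.$$ **Theorem.** For all $\alpha_1,\alpha_2>0$ there are constants $c,c'>0$, depending only on $(\alpha_1,\alpha_2)$, such that the following holds. Suppose that $\mathcal F$ is a convex and compact subset of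 $\mathbb L^2_\omega$ and that $$\mathbb P\Big[\Big|\tfrac{g(X,A)}{\pi(X,A)}h(X,A)\Big|\ge\alpha_1\|h\|_\omega\Big]\ge\alpha_2\qquad\text{for all }h\in\{f_1-f_2: f_1,f_2\in\mathcal F\}.$$ Then $$\mathbb E\big[(\widehat\tau_n-\tau^*)^2\big]\le\frac1n\Big\{v_*^2+c\inf_{\mu\in\mathcal F}\Big(\|\mu-\mu^*\|_\omega^2+s_{n/2}^2(\mu)+r_{n/2}^2(\mu)+e^{-c'n}\,\mathrm{diam}_\omega^2(\mathcal F\cup\{\mu^*\})\Big)\Big\}.$$ -/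

import Mathlib

open MeasureTheory ProbabilityTheory
open scoped ENNReal NNReal

universe u v w

noncomputable section

/-- An observation `((x, a), y)`: a state-action pair together with an outcome. -/
abbrev Obs (X A : Type*) := (X × A) × ℝ

/-- The observational model: a state distribution `ξ`, a base measure `λ` on actions, a propensity
score `π` (for every state a probability density with respect to `λ`), a weight function `g`, and
the conditional law of the outcome given the state-action pair, with finite second moments. -/
structure ObsModel (X A : Type*) [MeasurableSpace X] [MeasurableSpace A] where
  stateLaw : Measure X
  isProb_stateLaw : IsProbabilityMeasure stateLaw
  base : Measure A
  sfinite_base : SFinite base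
  propensity : X × A → ℝ
  measurable_propensity : Measurable propensity
  propensity_nonneg : ∀ p, 0 ≤ propensity p
  lintegral_propensity : ∀ x, ∫⁻ a, ENNReal.ofReal (propensity (x, a)) ∂base = 1
  weight : X × A → ℝ
  measurable_weight : Measurable weight
  outcome : Kernel (X × A) ℝ
  isMarkov_outcome : IsMarkovKernel outcome
  memLp_outcome : ∀ p, MemLp (fun y : ℝ => y) 2 (outcome p)

attribute [instance] ObsModel.isProb_stateLaw ObsModel.sfinite_base ObsModel.isMarkov_outcome

/-- Outer expectation of a nonnegative function (the infimum of the expectations of its measurable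
majorants): the usual reading of the expectation of a supremum over an uncountable class. -/
def outerExp {α : Type*} [MeasurableSpace α] (μ : Measure α) (f : α → ℝ≥0∞) : ℝ≥0∞ :=
  ⨅ (G : α → ℝ≥0∞) (_ : Measurable G) (_ : f ≤ G), ∫⁻ x, G x ∂μ

/-- For a measurable function the outer expectation is the expectation. -/
theorem outerExp_eq_lintegral {α : Type*} [MeasurableSpace α] (μ : Measure α) (f : α → ℝ≥0∞)
    (hf : Measurable f) : outerExp μ f = ∫⁻ x, f x ∂μ :=
  le_antisymm (iInf_le_of_le f (iInf_le_of_le hf (iInf_le_of_le le_rfl le_rfl)))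
    (le_iInf fun _ => le_iInf fun _ => le_iInf fun h => lintegral_mono h)

/-- The law of a Rademacher sign. -/
def rademacherLaw : Measure ℝ := (2⁻¹ : ℝ≥0∞) • (Measure.dirac 1 + Measure.dirac (-1))

namespace ObsModel

variable {X A : Type*} [MeasurableSpace X] [MeasurableSpace A] (M : ObsModel X A)

/-- The law of `(X, A)`: `X ∼ ξ`, and `A` given `X` has density `π(X, ·)` with respect to `λ`. -/
def pairLaw : Measure (X × A) :=
  (M.stateLaw.prod M.base).withDensity fun p => ENNReal.ofReal (M.propensity p)

/-- The law of one observation. -/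
def obsLaw : Measure (Obs X A) := M.pairLaw ⊗ₘ M.outcome

/-- The law of `m` i.i.d. observations. -/
def sampleLaw (m : ℕ) : Measure (Fin m → Obs X A) := Measure.pi fun _ => M.obsLaw

/-- The treatment effect `μ*(x, a) = E[Y | x, a]`. -/
def muStar (p : X × A) : ℝ := ∫ y, y ∂(M.outcome p)

/-- The conditional variance `σ²(x, a)` of the outcome. -/
def condVar (p : X × A) : ℝ := ∫ y, (y - M.muStar p) ^ 2 ∂(M.outcome p)

/-- The importance ratio `g / π`. -/
def ratio (p : X × A) : ℝ := M.weight p / M.propensity p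

/-- The estimand `τ* = ∫ E_ξ[g(X, a) μ*(X, a)] dλ(a)`. -/
def tauStar : ℝ := ∫ a, ∫ x, M.weight (x, a) * M.muStar (x, a) ∂M.stateLaw ∂M.base

/-- The inner product `⟨g(x, ·), h(x, ·)⟩` with respect to `λ`. -/
def actInner (h : X × A → ℝ) (x : X) : ℝ := ∫ a, M.weight (x, a) * h (x, a) ∂M.base

/-- The measure with density `g² / π` with respect to `ξ × λ`. The quotient is taken in `[0, ∞]`:
it is infinite where `π = 0 ≠ g`, and zero where `g = 0`. -/
def omegaMeasure : Measure (X × A) :=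
  (M.stateLaw.prod M.base).withDensity fun p =>
    ENNReal.ofReal (M.weight p ^ 2) / ENNReal.ofReal (M.propensity p)

/-- The weighted norm `‖h‖_ω = (∫ E_ξ[(g² / π) h²] dλ)^(1/2)`, with values in `[0, ∞]`. -/
def wnorm (h : X × A → ℝ) : ℝ≥0∞ := eLpNorm h 2 M.omegaMeasure

/-- The efficient variance `v_*² = Var(⟨g(X, ·), μ*(X, ·)⟩) + ‖σ‖_ω²`, with values in `[0, ∞]`. -/
def effVar : ℝ≥0∞ :=
  evariance (M.actInner M.muStar) M.stateLaw + ∫⁻ p, ENNReal.ofReal (M.condVar p) ∂M.omegaMeasure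

/-- The diameter of a class of functions in the weighted norm. -/
def wdiam (G : Set (X × A → ℝ)) : ℝ≥0∞ := ⨆ f ∈ G, ⨆ h ∈ G, M.wnorm (f - h)

/-- A class of measurable functions that is a compact subset of `L²_ω = L²(g² / π d(ξ × λ))`. -/
structure IsCompactClass (F : Set (X × A → ℝ)) : Prop where
  measurable : ∀ f ∈ F, Measurable f
  memLp : ∀ f ∈ F, MemLp f 2 M.omegaMeasure
  isCompact : IsCompact {u : Lp ℝ 2 M.omegaMeasure | ∃ f ∈ F, u =ᵐ[M.omegaMeasure] f}

/-- The small-ball condition with parameters `(α₁, α₂)` on the difference class of `F`. -/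
def SmallBall (F : Set (X × A → ℝ)) (α₁ α₂ : ℝ) : Prop :=
  ∀ f₁ ∈ F, ∀ f₂ ∈ F, ENNReal.ofReal α₂ ≤
    M.pairLaw {p | ENNReal.ofReal α₁ * M.wnorm (f₁ - f₂)
      ≤ ENNReal.ofReal |M.ratio p * (f₁ p - f₂ p)|}

/-- The weighted least-squares objective on a sample of size `m`. -/
def empLoss {m : ℕ} (z : Fin m → Obs X A) (f : X × A → ℝ) : ℝ :=
  (1 / (m : ℝ)) * ∑ i, M.ratio (z i).1 ^ 2 * (f (z i).1 - (z i).2) ^ 2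

/-- `muhat` is a weighted least-squares estimate over `F` from `m` observations: a measurable
function of the data which almost surely minimizes the objective over `F`. -/
structure IsLeastSquares (F : Set (X × A → ℝ)) (m : ℕ)
    (muhat : (Fin m → Obs X A) → X × A → ℝ) : Prop where
  measurable : Measurable fun q : (Fin m → Obs X A) × (X × A) => muhat q.1 q.2
  isMin : ∀ᵐ z ∂M.sampleLaw m, muhat z ∈ F ∧ IsMinOn (M.empLoss z) F (muhat z)

/-- The auxiliary function `g h / π - ⟨g, h⟩` attached to an estimate `h` of `μ*`. -/
def auxFun (h : X × A → ℝ) (p : X × A) : ℝ :=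
  M.weight p * h p / M.propensity p - M.actInner h p.1

/-- The cross-fitted two-stage estimator from `n = m + m` observations: on each half of the sample
it uses the auxiliary function computed from the other half. -/
def twoStage {m : ℕ} (muhat₁ muhat₂ : (Fin m → Obs X A) → X × A → ℝ)
    (z : Fin (m + m) → Obs X A) : ℝ :=
  let z₁ : Fin m → Obs X A := fun i => z (Fin.castAdd m i)
  let z₂ : Fin m → Obs X A := fun i => z (Fin.natAdd m i)
  (1 / ((m + m : ℕ) : ℝ)) *
      ∑ i, (M.ratio (z₁ i).1 * (z₁ i).2 - M.auxFun (muhat₂ z₂) (z₁ i).1) +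
    (1 / ((m + m : ℕ) : ℝ)) *
      ∑ i, (M.ratio (z₂ i).1 * (z₂ i).2 - M.auxFun (muhat₁ z₁) (z₂ i).1)

/-- The joint law of `m` observations and `m` independent Rademacher signs. -/
def signedSampleLaw (m : ℕ) : Measure ((Fin m → Obs X A) × (Fin m → ℝ)) :=
  (M.sampleLaw m).prod (Measure.pi fun _ => rademacherLaw)

/-- The squared Rademacher complexity `S²_m(H)` of the effective noise. -/
def noiseComplexitySq (m : ℕ) (H : Set (X × A → ℝ)) : ℝ≥0∞ :=
  outerExp (M.signedSampleLaw m) fun q => ⨆ f ∈ H, ENNReal.ofReal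
    (((1 / (m : ℝ)) * ∑ i, q.2 i * M.ratio (q.1 i).1 ^ 2 *
      ((q.1 i).2 - M.muStar (q.1 i).1) * f (q.1 i).1) ^ 2)

/-- `S_m(H)`. -/
def noiseComplexity (m : ℕ) (H : Set (X × A → ℝ)) : ℝ≥0∞ :=
  M.noiseComplexitySq m H ^ (1 / 2 : ℝ)

/-- The Rademacher complexity `R_m(H)` of a class `H` that contains the zero function. For such a
class the supremum is nonnegative, so it is not changed by taking positive parts. -/
def rademacherComplexity (m : ℕ) (H : Set (X × A → ℝ)) : ℝ≥0∞ :=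
  outerExp (M.signedSampleLaw m) fun q => ⨆ f ∈ H, ENNReal.ofReal
    ((1 / (m : ℝ)) * ∑ i, q.2 i * M.ratio (q.1 i).1 * f (q.1 i).1)

/-- The localized class `(F - μ) ∩ B_ω(r)`. -/
def localClass (F : Set (X × A → ℝ)) (μ : X × A → ℝ) (r : ℝ≥0) : Set (X × A → ℝ) :=
  {h | (∃ f ∈ F, h = f - μ) ∧ M.wnorm h ≤ r}

/-- The critical radius `s_m(μ)`: the infimum of the `s > 0` with
`S_m((F - μ) ∩ B_ω(s)) / s ≤ s` (infinite if there is none). -/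
def radiusS (F : Set (X × A → ℝ)) (m : ℕ) (μ : X × A → ℝ) : ℝ≥0∞ :=
  ⨅ (s : ℝ≥0) (_ : 0 < s) (_ : M.noiseComplexity m (M.localClass F μ s) / s ≤ s), (s : ℝ≥0∞)

/-- The critical radius `r_m(μ)`: the infimum of the `r > 0` with
`R_m((F - μ) ∩ B_ω(r)) / r ≤ α₁ α₂ / 32` (infinite if there is none). -/
def radiusR (F : Set (X × A → ℝ)) (α₁ α₂ : ℝ) (m : ℕ) (μ : X × A → ℝ) : ℝ≥0∞ :=
  ⨅ (r : ℝ≥0) (_ : 0 < r)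
    (_ : M.rademacherComplexity m (M.localClass F μ r) / r ≤ ENNReal.ofReal (α₁ * α₂ / 32)),
    (r : ℝ≥0∞)

/-- The instance-dependent estimation error `δ²_n(μ; F)` at sample size `n = m + m`, with the
constant `c'` in the exponential term. -/
def estError (F : Set (X × A → ℝ)) (α₁ α₂ c' : ℝ) (m : ℕ) (μ : X × A → ℝ) : ℝ≥0∞ :=
  M.radiusS F m μ ^ 2 + M.radiusR F α₁ α₂ m μ ^ 2 +
    ENNReal.ofReal (Real.exp (-c' * ((m + m : ℕ) : ℝ))) * M.wdiam (insert M.muStar F) ^ 2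

end ObsModel

end

/-! The error of the estimator is an average of centred scores. For any auxiliary `h`, the score of
one observation splits as `oracleScore + scoreError h` (`score_eq`). The oracle score has mean zero
and second moment at most `effVar`. The score error is what remains of `(g/π)(μ* - h)` after its
conditional mean given the state is removed: its second moment is at most `‖h - μ*‖_ω²`, and it is
orthogonal to the oracle score. Under cross-fitting `h` comes from the other half of the sample, so
given that half the summands are i.i.d. and centred, and the mean-squared error is at most `1/n`
times `effVar` plus the two first-stage risks (`lintegral_twoStage_sq_le`).

There remains the risk of weighted least squares. The basic inequality bounds the empirical norm of
`f - μ` by a noise term plus the approximation error. By convexity `f - μ` can be scaled down to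
norm `r`. There the small-ball condition bounds the mean of a Lipschitz truncated square from below,
symmetrization and contraction bound its mean deviation by the Rademacher complexity, and bounded
differences give an exponential tail. Hence, off an event of exponentially small probability, the
empirical norm dominates a multiple of the true one (`sq_wnorm_le_empSq`). The noise term is scaled
to radius `s` in the same way and controlled in mean square by `S²`. On the exceptional event the
diameter is the bound.

A supremum over an uncountable class need not be measurable. Each empirical-process estimate is
therefore proved for one measurable selection of a class member by the sample. Concentration is
applied to the essential supremum over all selections, which inherits bounded differences because
selections are stable under pointwise maxima and under freezing a coordinate. -/

noncomputable section

/-! ### Bounded differences and essential suprema. -/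

section BoundedDifferences

variable {Z : Type*} [MeasurableSpace Z] {ν : Measure Z} [IsProbabilityMeasure ν]

theorem integrable_of_abs_le {α : Type*} [MeasurableSpace α] {μ : Measure α} [IsFiniteMeasure μ]
    {f : α → ℝ} (hf : Measurable f) {K : ℝ} (hK : ∀ x, |f x| ≤ K) : Integrable f μ :=
  Integrable.of_bound hf.aestronglyMeasurable K (ae_of_all _ hK)

theorem abs_integral_le_of_abs_le {f : Z → ℝ} {K : ℝ} (hK : ∀ x, |f x| ≤ K) :
    |∫ x, f x ∂ν| ≤ K := by
  simpa using norm_integral_le_of_norm_le_const (μ := ν) (f := f)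
    (ae_of_all _ fun x => (Real.norm_eq_abs _).trans_le (hK x))

/-- Hoeffding's lemma for a function of essential oscillation at most `c`. -/
theorem integral_exp_le_of_osc {f : Z → ℝ} (hf : Measurable f) {K c l : ℝ}
    (hK : ∀ x, |f x| ≤ K) (hc : ∀ᵐ x ∂ν, ∀ᵐ y ∂ν, f y ≤ f x + c) :
    ∫ x, Real.exp (l * f x) ∂ν ≤ Real.exp (l * ∫ x, f x ∂ν + l ^ 2 * c ^ 2 / 8) := by
  have hbdd : Filter.IsBoundedUnder (· ≤ ·) (ae ν) f :=
    ⟨K, Filter.eventually_map.2 (ae_of_all _ fun x => (abs_le.1 (hK x)).2)⟩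
  -- The oscillation bound puts almost all values in an interval of length `c` that ends at the
  -- essential supremum, which is the form Hoeffding's lemma needs.
  have hmem : ∀ᵐ x ∂ν, f x ∈ Set.Icc (essSup f ν - c) (essSup f ν) := by
    filter_upwards [hc, ae_le_essSup hbdd] with x hx hx'
    refine ⟨?_, hx'⟩
    have : essSup f ν ≤ f x + c := by
      refine Filter.limsup_le_of_le ?_ hx
      exact Filter.IsBoundedUnder.isCoboundedUnder_le
        ⟨-K, Filter.eventually_map.2 (ae_of_all _ fun x => (abs_le.1 (hK x)).1)⟩
    linarith
  have h := (hasSubgaussianMGF_of_mem_Icc hf.aemeasurable hmem).mgf_le l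
  have h2 : mgf (fun x => f x - ∫ x, f x ∂ν) ν l
      = Real.exp (-(l * ∫ x, f x ∂ν)) * ∫ x, Real.exp (l * f x) ∂ν := by
    rw [mgf, ← integral_const_mul]
    congr 1 with x
    rw [← Real.exp_add]; ring_nf
  rw [h2] at h
  have h3 : l * (∫ x, f x ∂ν) + l ^ 2 * c ^ 2 / 8 =
      l * (∫ x, f x ∂ν) + (((‖essSup f ν - (essSup f ν - c)‖₊ / 2) ^ 2 : ℝ≥0) : ℝ) * l ^ 2 / 2 := by
    push_cast
    rw [Real.norm_eq_abs, div_pow, sq_abs]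
    ring
  rw [h3, Real.exp_add]
  calc _ = Real.exp (l * ∫ x, f x ∂ν) * (Real.exp (-(l * ∫ x, f x ∂ν)) *
        ∫ x, Real.exp (l * f x) ∂ν) := by
        rw [← mul_assoc, ← Real.exp_add]; simp
    _ ≤ _ := by gcongr

/-- McDiarmid's moment generating function bound, under bounded differences almost everywhere. -/
theorem integral_exp_le_of_boundedDifferences (n : ℕ) {V : (Fin n → Z) → ℝ} (hV : Measurable V)
    {K c l : ℝ} (hK : ∀ z, |V z| ≤ K)
    (hc : ∀ i, ∀ᵐ z ∂(Measure.pi fun _ : Fin n => ν), ∀ᵐ y ∂ν, V (Function.update z i y) ≤ V z + c) :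
    ∫ z, Real.exp (l * V z) ∂(Measure.pi fun _ : Fin n => ν) ≤
      Real.exp (l * ∫ z, V z ∂(Measure.pi fun _ : Fin n => ν) + n * (l ^ 2 * c ^ 2 / 8)) := by
  induction n with
  | zero =>
    have hV0 : ∀ z, V z = V default := fun z => congrArg V (Subsingleton.elim _ _)
    simp [hV0]
  | succ n ih =>
    set P := Measure.pi fun _ : Fin n => ν
    have hmp := (measurePreserving_piFinSuccAbove (fun _ : Fin (n + 1) => ν) 0).symm
    have he : ∀ q : Z × (Fin n → Z),
        (MeasurableEquiv.piFinSuccAbove (fun _ : Fin (n + 1) => Z) 0).symm q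
          = Fin.cons q.1 q.2 := fun q => by
      simp [MeasurableEquiv.piFinSuccAbove, Fin.insertNthEquiv]
    have hcons : MeasurePreserving (fun q : Z × (Fin n → Z) => (Fin.cons q.1 q.2 : Fin (n + 1) → Z))
        (ν.prod P) (Measure.pi fun _ : Fin (n + 1) => ν) := by
      have := hmp
      rwa [show ⇑(MeasurableEquiv.piFinSuccAbove (fun _ : Fin (n + 1) => Z) 0).symm
        = fun q => Fin.cons q.1 q.2 from funext he] at this
    have hW : Measurable fun q : Z × (Fin n → Z) => V (Fin.cons q.1 q.2) := hV.comp hcons.measurable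
    have hint : ∀ F : (Fin (n + 1) → Z) → ℝ, Measurable F → (∃ C, ∀ z, |F z| ≤ C) →
        ∫ z, F z ∂(Measure.pi fun _ : Fin (n + 1) => ν) = ∫ z, ∫ x, F (Fin.cons x z) ∂ν ∂P := by
      rintro F hF ⟨C, hC⟩
      rw [← hcons.map_eq, integral_map hcons.measurable.aemeasurable hF.aestronglyMeasurable,
        integral_prod_symm]
      exact integrable_of_abs_le (hF.comp hcons.measurable) fun q => hC _
    have htr : ∀ i, ∀ᵐ z ∂P, ∀ᵐ x ∂ν, ∀ᵐ y ∂ν,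
        V (Function.update (Fin.cons x z) i y) ≤ V (Fin.cons x z) + c := fun i => by
      have h1 := hcons.quasiMeasurePreserving.ae (hc i)
      have h2 : ∀ᵐ q ∂P.prod ν, ∀ᵐ y ∂ν,
        V (Function.update (Fin.cons q.2 q.1) i y) ≤ V (Fin.cons q.2 q.1) + c :=
        Measure.measurePreserving_swap.quasiMeasurePreserving.ae h1
      exact Measure.ae_ae_of_ae_prod h2
    -- Averaging out the first coordinate keeps the difference bound in the others. Hoeffding's
    -- lemma in the first coordinate costs one factor `exp (l² c² / 8)`.
    set Vb : (Fin n → Z) → ℝ := fun z => ∫ x, V (Fin.cons x z) ∂ν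
    have hVb : Measurable Vb :=
      (hW.stronglyMeasurable.integral_prod_left' (μ := ν)).measurable
    have hVbK : ∀ z, |Vb z| ≤ K := fun z => abs_integral_le_of_abs_le fun x => hK _
    have hsec : ∀ z, Measurable fun x => V (Fin.cons x z) := fun z =>
      hW.comp (measurable_id.prodMk measurable_const)
    have hexpb : ∀ t : ℝ, |t| ≤ K → |Real.exp (l * t)| ≤ Real.exp (|l| * K) := fun t ht => by
      rw [abs_of_pos (Real.exp_pos _), Real.exp_le_exp]
      calc l * t ≤ |l * t| := le_abs_self _
        _ = |l| * |t| := abs_mul _ _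
        _ ≤ _ := by gcongr
    have hinner : ∀ᵐ z ∂P, ∫ x, Real.exp (l * V (Fin.cons x z)) ∂ν ≤
        Real.exp (l * Vb z) * Real.exp (l ^ 2 * c ^ 2 / 8) := by
      filter_upwards [htr 0] with z hz
      rw [← Real.exp_add]
      refine integral_exp_le_of_osc (hsec z) (fun x => hK _) ?_
      simpa only [Fin.update_cons_zero] using hz
    have hih := ih hVb hVbK fun i => by
      have h1 := htr i.succ
      simp only [← Fin.cons_update] at h1
      filter_upwards [h1] with z hz
      -- The bound is known for almost every `x` and then almost every `y`. Integrating over `x` at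
      -- fixed `y` needs the opposite order, and the exchange requires a measurable set.
      have hms : MeasurableSet {q : Z × Z |
          V (Fin.cons q.1 (Function.update z i q.2)) ≤ V (Fin.cons q.1 z) + c} := by
        refine measurableSet_le (hW.comp (measurable_fst.prodMk ?_))
          (((hsec z).comp measurable_fst).add_const c)
        exact (measurable_update z).comp measurable_snd
      have hz' := (Measure.ae_ae_comm hms).1 hz
      filter_upwards [hz'] with y hy
      have hi : ∀ z, Integrable (fun x => V (Fin.cons x z)) ν := fun z =>
        integrable_of_abs_le (hsec z) fun x => hK _
      calc Vb (Function.update z i y) ≤ ∫ x, (V (Fin.cons x z) + c) ∂ν :=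
            integral_mono_ae (hi _) ((hi _).add (integrable_const _)) hy
        _ = Vb z + c := by rw [integral_add (hi _) (integrable_const _)]; simp [Vb]
    rw [hint _ (hV.const_mul l).exp ⟨_, fun z => hexpb _ (hK z)⟩, hint _ hV ⟨K, hK⟩]
    calc _ ≤ ∫ z, Real.exp (l * Vb z) * Real.exp (l ^ 2 * c ^ 2 / 8) ∂P := by
          refine integral_mono_ae ?_ ?_ hinner
          · refine integrable_of_abs_le (K := Real.exp (|l| * K)) ?_ fun z =>
              abs_integral_le_of_abs_le fun x => hexpb _ (hK _)
            exact ((hW.const_mul l).exp.stronglyMeasurable.integral_prod_left' (μ := ν)).measurable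
          · exact (integrable_of_abs_le (hVb.const_mul l).exp fun z => hexpb _ (hVbK z)).mul_const _
      _ ≤ _ := by
          rw [integral_mul_const]
          refine (mul_le_mul_of_nonneg_right hih (Real.exp_pos _).le).trans_eq ?_
          rw [← Real.exp_add]; push_cast; congr 1; ring

/-- A bounded family of measurable functions that is closed under maxima has an essential supremum
that is bounded, and whose integral is at most the supremum of the integrals. -/
theorem exists_essential_sup {α : Type*} [MeasurableSpace α] {μ : Measure α}
    [IsProbabilityMeasure μ] {S : Set (α → ℝ)} (hne : S.Nonempty)
    (hS : ∀ V ∈ S, Measurable V) {K B : ℝ} (hK : ∀ V ∈ S, ∀ z, |V z| ≤ K)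
    (hmax : ∀ V ∈ S, ∀ W ∈ S, (fun z => max (V z) (W z)) ∈ S) (hB : ∀ V ∈ S, ∫ z, V z ∂μ ≤ B) :
    ∃ (W : α → ℝ) (u : ℕ → α → ℝ), Measurable W ∧ (∀ z, |W z| ≤ K) ∧ ∫ z, W z ∂μ ≤ B ∧
      (∀ k, u k ∈ S) ∧ (∀ z, Filter.Tendsto (fun k => u k z) Filter.atTop (nhds (W z))) ∧
      ∀ V ∈ S, V ≤ᵐ[μ] W := by
  set I : Set ℝ := (fun V : α → ℝ => ∫ z, V z ∂μ) '' S
  have hIne : I.Nonempty := hne.image _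
  have hIb : BddAbove I := ⟨B, by rintro _ ⟨V, hV, rfl⟩; exact hB V hV⟩
  obtain ⟨a, -, ha, haI⟩ := exists_seq_tendsto_sSup hIne hIb
  choose v hvS hva using haI
  -- Running maxima of a sequence whose integrals approach the supremum: increasing, still in `S`,
  -- and with limit `W` of maximal integral.
  let u : ℕ → α → ℝ := fun k => Nat.rec (v 0) (fun k f z => max (f z) (v (k + 1) z)) k
  have hus : ∀ k, u (k + 1) = fun z => max (u k z) (v (k + 1) z) := fun k => rfl
  have huS : ∀ k, u k ∈ S := fun k => by
    induction k with
    | zero => exact hvS 0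
    | succ k ih => rw [hus]; exact hmax _ ih _ (hvS _)
  have hmono : ∀ z, Monotone fun k => u k z := fun z =>
    monotone_nat_of_le_succ fun k => by rw [hus]; exact le_max_left _ _
  have hvu : ∀ k z, v k z ≤ u k z := fun k z => by
    cases k with
    | zero => exact le_rfl
    | succ k => rw [hus]; exact le_max_right _ _
  have hbd : ∀ z, BddAbove (Set.range fun k => u k z) := fun z =>
    ⟨K, by rintro _ ⟨k, rfl⟩; exact (abs_le.1 (hK _ (huS k) z)).2⟩
  set W : α → ℝ := fun z => ⨆ k, u k z
  have hlim : ∀ z, Filter.Tendsto (fun k => u k z) Filter.atTop (nhds (W z)) := fun z =>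
    tendsto_atTop_ciSup (hmono z) (hbd z)
  have hWm : Measurable W := measurable_of_tendsto_metrizable (fun k => hS _ (huS k))
    (tendsto_pi_nhds.2 hlim)
  have hWK : ∀ z, |W z| ≤ K := fun z =>
    le_of_tendsto' (hlim z).abs fun k => hK _ (huS k) z
  have hWi : Integrable W μ := integrable_of_abs_le hWm hWK
  -- Taking the maximum with `V` cannot raise the integral of `W`, which is already maximal. This
  -- forces `V ≤ W` almost everywhere.
  have hle : ∀ V ∈ S, ∫ z, max (W z) (V z) ∂μ ≤ sSup I := fun V hV => by
    refine le_of_tendsto' (x := Filter.atTop)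
      (f := fun k => ∫ z, max (u k z) (V z) ∂μ) ?_ fun k =>
      le_csSup hIb ⟨_, hmax _ (huS k) _ hV, rfl⟩
    refine tendsto_integral_of_dominated_convergence (fun _ => K)
      (fun k => ((hS _ (huS k)).max (hS _ hV)).aestronglyMeasurable) (integrable_const _)
      (fun k => ae_of_all _ fun z => hK _ (hmax _ (huS k) _ hV) z)
      (ae_of_all _ fun z => (hlim z).max tendsto_const_nhds)
  have hge : sSup I ≤ ∫ z, W z ∂μ := by
    refine le_of_tendsto' ha fun k => ?_
    rw [← hva k]
    exact integral_mono (integrable_of_abs_le (hS _ (hvS k)) (hK _ (hvS k))) hWi fun z =>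
      (hvu k z).trans (le_ciSup (hbd z) k)
  have hdom : ∀ V ∈ S, V ≤ᵐ[μ] W := fun V hV => by
    have hmi : Integrable (fun z => max (W z) (V z)) μ :=
      hWi.sup (integrable_of_abs_le (hS _ hV) (hK _ hV))
    have h0 : ∫ z, (max (W z) (V z) - W z) ∂μ = 0 := by
      refine le_antisymm ?_ (integral_nonneg fun z => sub_nonneg.2 (le_max_left _ _))
      rw [integral_sub hmi hWi]
      linarith [hle V hV]
    have h1 := (integral_eq_zero_iff_of_nonneg (fun z => sub_nonneg.2 (le_max_left _ _))
      (hmi.sub hWi)).1 h0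
    filter_upwards [h1] with z hz
    have h2 : max (W z) (V z) - W z = 0 := hz
    exact (le_max_right _ _).trans (sub_eq_zero.1 h2).le
  refine ⟨W, u, hWm, hWK, ?_, huS, hlim, hdom⟩
  have h0 := hle _ (huS 0)
  refine (le_trans ?_ h0).trans (csSup_le hIne ?_)
  · exact integral_mono hWi (hWi.sup (integrable_of_abs_le (hS _ (huS 0)) (hK _ (huS 0))))
      fun z => le_max_left _ _
  · rintro _ ⟨V, hV, rfl⟩; exact hB V hV

/-- A deviation bound that holds uniformly over a family of functions of `n` independent variables
which is closed under maxima and, up to `1 / n`, under freezing a coordinate. -/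
theorem measure_ge_le_of_family {n : ℕ} (hn : 0 < n) {S : Set ((Fin n → Z) → ℝ)}
    (hS : ∀ V ∈ S, Measurable V) {K B t : ℝ} (ht : 0 < t) (hK : ∀ V ∈ S, ∀ z, |V z| ≤ K)
    (hmax : ∀ V ∈ S, ∀ W ∈ S, (fun z => max (V z) (W z)) ∈ S)
    (hB : ∀ V ∈ S, ∫ z, V z ∂(Measure.pi fun _ : Fin n => ν) ≤ B)
    (hshift : ∀ V ∈ S, ∀ i y, ∃ V' ∈ S, ∀ z, V (Function.update z i y) ≤ V' z + 1 / n)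
    {V : (Fin n → Z) → ℝ} (hV : V ∈ S) :
    (Measure.pi fun _ : Fin n => ν) {z | B + t ≤ V z} ≤
      ENNReal.ofReal (Real.exp (-(2 * n * t ^ 2))) := by
  obtain ⟨W, u, hWm, hWK, hWB, huS, hlim, hdom⟩ := exists_essential_sup ⟨V, hV⟩ hS hK hmax hB
  set P := Measure.pi fun _ : Fin n => ν
  have hn' : (0 : ℝ) < n := Nat.cast_pos.2 hn
  have hdiff : ∀ i, ∀ᵐ z ∂P, ∀ᵐ y ∂ν, W (Function.update z i y) ≤ W z + 1 / n := fun i => by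
    -- Each frozen `u k` is dominated by a member of `S`, hence by `W`. The null set depends on `y`,
    -- so the difference bound holds only almost everywhere.
    have h1 : ∀ y, ∀ᵐ z ∂P, W (Function.update z i y) ≤ W z + 1 / n := fun y => by
      choose V' hV'S hV' using fun k => hshift _ (huS k) i y
      filter_upwards [ae_all_iff.2 fun k => hdom _ (hV'S k)] with z hz
      exact le_of_tendsto' (hlim _) fun k => (hV' k z).trans (by linarith [hz k])
    refine (Measure.ae_ae_comm ?_).1 (ae_of_all ν h1)
    refine measurableSet_le (hWm.comp ?_) ((hWm.comp measurable_snd).add_const _)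
    exact measurable_pi_lambda _ fun j => by
      by_cases hj : j = i
      · subst hj; simpa using measurable_fst
      · simp only [Function.update_of_ne hj]; exact (measurable_pi_apply j).comp measurable_snd
  -- This minimizes the exponent `-l t + l² / (8 n)`, whose minimum is `-2 n t²`.
  set l : ℝ := 4 * n * t
  have hl : 0 ≤ l := by positivity
  have hmgf := integral_exp_le_of_boundedDifferences n hWm (l := l) hWK hdiff
  have hexpi : Integrable (fun z => Real.exp (l * W z)) P :=
    integrable_of_abs_le (hWm.const_mul l).exp (K := Real.exp (l * K)) fun z => by
      rw [abs_of_pos (Real.exp_pos _), Real.exp_le_exp]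
      exact mul_le_mul_of_nonneg_left (abs_le.1 (hWK z)).2 hl
  have hch := measure_ge_le_exp_mul_mgf (X := W) (μ := P) (B + t) hl hexpi
  have hfin : P.real {z | B + t ≤ W z} ≤ Real.exp (-(2 * n * t ^ 2)) := by
    refine hch.trans ((mul_le_mul_of_nonneg_left hmgf (Real.exp_pos _).le).trans ?_)
    rw [← Real.exp_add, Real.exp_le_exp]
    have h1 : l * ∫ z, W z ∂P ≤ l * B := mul_le_mul_of_nonneg_left hWB hl
    have h2 : (n : ℝ) * (l ^ 2 * (1 / n) ^ 2 / 8) = 2 * n * t ^ 2 := by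
      simp only [l]; field_simp; ring
    have h3 : l * t = 4 * n * t ^ 2 := by simp only [l]; ring
    rw [h2]; nlinarith
  calc P {z | B + t ≤ V z} ≤ P {z | B + t ≤ W z} := by
        refine measure_mono_ae ?_
        filter_upwards [hdom V hV] with z hz h
        exact le_trans h hz
    _ ≤ _ := by
        rw [← ofReal_measureReal]
        exact ENNReal.ofReal_le_ofReal hfin

end BoundedDifferences

/-! ### Contraction and symmetrization for selections. -/

section Symmetrization

/-- The sign attached to a boolean. -/
def boolSign (b : Bool) : ℝ := if b then 1 else -1

/-- The Ledoux-Talagrand contraction principle, for selections from an index set. -/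
theorem sum_contraction_le {ι : Type*} {φ : ℝ → ℝ} (hφ : ∀ a b, |φ a - φ b| ≤ |a - b|) (n : ℕ)
    (u : ι → Fin n → ℝ) (t : ι → ℝ) (G : (Fin n → Bool) → ℝ)
    (hG : ∀ e f, t f + ∑ i, boolSign (e i) * u f i ≤ G e) (s : (Fin n → Bool) → ι) :
    ∑ e, (t (s e) + ∑ i, boolSign (e i) * φ (u (s e) i)) ≤ ∑ e, G e := by
  induction n generalizing t with
  | zero => exact Finset.sum_le_sum fun e _ => by simpa using hG e (s e)
  | succ n ih =>
    have hsplit : ∀ F : (Fin (n + 1) → Bool) → ℝ,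
        ∑ e, F e = ∑ e, F (Fin.cons true e) + ∑ e, F (Fin.cons false e) := fun F => by
      rw [← (Fin.consEquiv fun _ : Fin (n + 1) => Bool).sum_comp, Fintype.sum_prod_type,
        Fintype.sum_bool]
      rfl
    rw [hsplit, hsplit]
    set a : (Fin n → Bool) → ι := fun e => s (Fin.cons true e)
    set b : (Fin n → Bool) → ι := fun e => s (Fin.cons false e)
    -- Patterns are paired by their first sign. Since `φ (u a) - φ (u b) ≤ |u a - u b|`, the index
    -- with the larger first coordinate is given the sign `+` and the other the sign `-`; the first
    -- coordinate is then absorbed into `t`.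
    have h1 := ih (fun f i => u f i.succ) (fun f => t f + u f 0) (fun e => G (Fin.cons true e))
      (fun e f => by
        have := hG (Fin.cons true e) f
        simp only [Fin.sum_univ_succ, Fin.cons_zero, Fin.cons_succ] at this
        simp only [boolSign, if_true, one_mul] at this ⊢
        linarith) fun e => if u (b e) 0 ≤ u (a e) 0 then a e else b e
    have h2 := ih (fun f i => u f i.succ) (fun f => t f - u f 0) (fun e => G (Fin.cons false e))
      (fun e f => by
        have := hG (Fin.cons false e) f
        simp only [Fin.sum_univ_succ, Fin.cons_zero, Fin.cons_succ] at this
        simp only [boolSign, one_mul, Bool.false_eq_true, if_false, neg_mul] at this ⊢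
        linarith) fun e => if u (b e) 0 ≤ u (a e) 0 then b e else a e
    refine le_trans ?_ (add_le_add h1 h2)
    rw [← Finset.sum_add_distrib, ← Finset.sum_add_distrib]
    refine Finset.sum_le_sum fun e _ => ?_
    simp only [Fin.sum_univ_succ, Fin.cons_zero, Fin.cons_succ]
    change t (a e) + (boolSign true * φ (u (a e) 0) + _) +
      (t (b e) + (boolSign false * φ (u (b e) 0) + _)) ≤ _
    have hl := hφ (u (a e) 0) (u (b e) 0)
    have ht : boolSign true = 1 := rfl
    have hf : boolSign false = -1 := rfl
    rw [ht, hf]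
    split_ifs with h
    · rw [abs_of_nonneg (sub_nonneg.2 h)] at hl
      linarith [le_abs_self (φ (u (a e) 0) - φ (u (b e) 0))]
    · rw [abs_of_neg (sub_neg.2 (not_le.1 h))] at hl
      linarith [le_abs_self (φ (u (a e) 0) - φ (u (b e) 0))]

instance : IsProbabilityMeasure rademacherLaw :=
  ⟨by
    simp only [rademacherLaw, Measure.smul_apply, Measure.add_apply, measure_univ, smul_eq_mul]
    rw [one_add_one_eq_two, ENNReal.inv_mul_cancel two_ne_zero ENNReal.ofNat_ne_top]⟩

/-- Reduces integrals over signs to finite averages over patterns, the form in which contraction is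
proved. -/
theorem pi_rademacherLaw (n : ℕ) : Measure.pi (fun _ : Fin n => rademacherLaw) =
    ((2 : ℝ≥0∞) ^ n)⁻¹ • ∑ e : Fin n → Bool, Measure.dirac fun i => boolSign (e i) := by
  refine Measure.pi_eq fun s hs => ?_
  have hr : ∀ i, rademacherLaw (s i) = 2⁻¹ * ∑ b : Bool, Measure.dirac (boolSign b) (s i) :=
    fun i => by simp [rademacherLaw, boolSign, mul_add]
  simp_rw [hr]
  rw [Finset.prod_mul_distrib, Finset.prod_univ_sum, Fintype.piFinset_univ, Finset.prod_const,
    Finset.card_univ, Fintype.card_fin, Measure.smul_apply, Measure.finsetSum_apply, smul_eq_mul,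
    ENNReal.inv_pow]
  congr 1
  refine Finset.sum_congr rfl fun e _ => ?_
  rw [Measure.dirac_apply' _ (MeasurableSet.univ_pi hs)]
  simp_rw [Measure.dirac_apply' _ (hs _)]
  by_cases h : ∀ i, boolSign (e i) ∈ s i
  · rw [Set.indicator_of_mem (by simpa using h)]
    simp [Set.indicator_of_mem (h _)]
  · obtain ⟨i, hi⟩ := not_forall.1 h
    rw [Set.indicator_of_notMem (by simpa using ⟨i, hi⟩),
      Finset.prod_eq_zero (Finset.mem_univ i) (Set.indicator_of_notMem hi _)]

variable {Z : Type*} [MeasurableSpace Z] {ν : Measure Z} [IsProbabilityMeasure ν] {n : ℕ}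

/-- The average of an expectation over all sign patterns. -/
def signAverage (μ : Measure (Fin n → Z)) (G : (Fin n → Z) → (Fin n → Bool) → ℝ≥0∞) : ℝ≥0∞ :=
  ((2 : ℝ≥0∞) ^ n)⁻¹ * ∑ e, ∫⁻ z, G z e ∂μ

theorem lintegral_prod_rademacher (μ : Measure (Fin n → Z)) [SFinite μ]
    {G : (Fin n → Z) × (Fin n → ℝ) → ℝ≥0∞} (hG : Measurable G) :
    ∫⁻ q, G q ∂(μ.prod (Measure.pi fun _ => rademacherLaw)) =
      signAverage μ fun z e => G (z, fun i => boolSign (e i)) := by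
  rw [lintegral_prod_symm _ hG.aemeasurable, pi_rademacherLaw, lintegral_smul_measure,
    lintegral_finsetSum_measure, signAverage, smul_eq_mul]
  congr 1
  refine Finset.sum_congr rfl fun e _ => ?_
  rw [lintegral_dirac' _ hG.lintegral_prod_left']

/-- Exchange the coordinates of two samples at the places where the pattern is `false`. -/
def coordSwap {Z : Type*} {n : ℕ} (e : Fin n → Bool) (q : (Fin n → Z) × (Fin n → Z)) : (Fin n → Z) × (Fin n → Z) :=
  (fun i => if e i then q.1 i else q.2 i, fun i => if e i then q.2 i else q.1 i)

theorem measurePreserving_coordSwap (e : Fin n → Bool) :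
    MeasurePreserving (coordSwap (Z := Z) e)
      ((Measure.pi fun _ => ν).prod (Measure.pi fun _ => ν))
      ((Measure.pi fun _ => ν).prod (Measure.pi fun _ => ν)) := by
  have h1 := measurePreserving_arrowProdEquivProdArrow Z Z (Fin n) (fun _ => ν) fun _ => ν
  have h2 : MeasurePreserving (fun (a : Fin n → Z × Z) i => (if e i then id else Prod.swap) (a i))
      (Measure.pi fun _ => ν.prod ν) (Measure.pi fun _ => ν.prod ν) :=
    measurePreserving_pi _ _ fun i => by
      by_cases h : e i
      · simpa [h] using MeasurePreserving.id _
      · simpa [h] using Measure.measurePreserving_swap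
  have h3 := h1.comp (h2.comp h1.symm)
  convert h3 using 1
  funext q
  refine Prod.ext (funext fun i => ?_) (funext fun i => ?_) <;>
  · by_cases h : e i <;>
    simp [coordSwap, MeasurableEquiv.arrowProdEquivProdArrow, Equiv.arrowProdEquivProdArrow, h]

theorem lintegral_eq_signAverage_coordSwap {Φ : (Fin n → Z) × (Fin n → Z) → ℝ≥0∞}
    (hΦ : Measurable Φ) :
    ∫⁻ q, Φ q ∂((Measure.pi fun _ => ν).prod (Measure.pi fun _ => ν)) =
      ((2 : ℝ≥0∞) ^ n)⁻¹ * ∑ e : Fin n → Bool,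
        ∫⁻ q, Φ (coordSwap e q) ∂((Measure.pi fun _ => ν).prod (Measure.pi fun _ => ν)) := by
  simp_rw [fun e => (measurePreserving_coordSwap (ν := ν) (n := n) e).lintegral_comp hΦ]
  rw [Finset.sum_const, Finset.card_univ, Fintype.card_fun, Fintype.card_bool, Fintype.card_fin,
    nsmul_eq_mul, ← mul_assoc]
  push_cast
  rw [ENNReal.inv_mul_cancel (by simp) (by simp), one_mul]

theorem eLpNorm_two_sq {α : Type*} [MeasurableSpace α] (μ : Measure α) (f : α → ℝ) :
    eLpNorm f 2 μ ^ 2 = ∫⁻ x, ENNReal.ofReal (f x ^ 2) ∂μ := by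
  have h := eLpNorm_nnreal_pow_eq_lintegral (μ := μ) (f := f) (p := 2) two_ne_zero
  simp only [ENNReal.coe_ofNat, NNReal.coe_ofNat, ENNReal.rpow_ofNat] at h
  rw [h]
  refine lintegral_congr fun x => ?_
  rw [← ofReal_norm, ← ENNReal.ofReal_pow (norm_nonneg _), Real.norm_eq_abs, sq_abs]

theorem ofReal_sq_integral_le {α : Type*} [MeasurableSpace α] {μ : Measure α}
    [IsProbabilityMeasure μ] {f : α → ℝ} (hf : AEStronglyMeasurable f μ) :
    ENNReal.ofReal ((∫ x, f x ∂μ) ^ 2) ≤ ∫⁻ x, ENNReal.ofReal (f x ^ 2) ∂μ := by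
  rw [← eLpNorm_two_sq, ← sq_abs, ENNReal.ofReal_pow (abs_nonneg _)]
  gcongr
  rw [← Real.norm_eq_abs, ofReal_norm]
  refine (enorm_integral_le_lintegral_enorm _).trans ?_
  rw [← eLpNorm_one_eq_lintegral_enorm]
  exact eLpNorm_le_eLpNorm_of_exponent_le (by norm_num) hf

/-- Exchanging the two samples at a coordinate flips the sign of its difference: this is how random
signs enter. -/
theorem sum_coordSwap_sub {Z : Type*} {n : ℕ} (e : Fin n → Bool) (q : (Fin n → Z) × (Fin n → Z)) (f : Z → ℝ) :
    ∑ i, (f ((coordSwap e q).1 i) - f ((coordSwap e q).2 i)) =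
      ∑ i, boolSign (e i) * f (q.1 i) - ∑ i, boolSign (e i) * f (q.2 i) := by
  rw [← Finset.sum_sub_distrib]
  refine Finset.sum_congr rfl fun i _ => ?_
  by_cases h : e i <;> (simp [coordSwap, boolSign, h]; try ring)

/-- Symmetrization in mean square for a centred function selected by the sample. -/
theorem lintegral_sq_sum_selection_le {k : (Fin n → Z) → Z → ℝ}
    (hk : Measurable fun q : (Fin n → Z) × Z => k q.1 q.2) (hki : ∀ z, Integrable (k z) ν)
    (hk0 : ∀ z, ∫ y, k z y ∂ν = 0) {G : (Fin n → Z) → (Fin n → Bool) → ℝ≥0∞}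
    (hGm : ∀ e, Measurable fun z => G z e)
    (hG : ∀ z z₀ e, ENNReal.ofReal ((∑ i, boolSign (e i) * k z₀ (z i)) ^ 2) ≤ G z e) :
    ∫⁻ z, ENNReal.ofReal ((∑ i, k z (z i)) ^ 2) ∂(Measure.pi fun _ => ν) ≤
      4 * signAverage (Measure.pi fun _ => ν) G := by
  set P := Measure.pi fun _ : Fin n => ν
  set Φ : (Fin n → Z) × (Fin n → Z) → ℝ≥0∞ := fun q =>
    ENNReal.ofReal ((∑ i, (k q.1 (q.1 i) - k q.1 (q.2 i))) ^ 2)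
  have hΦ : Measurable Φ := by
    refine ((Finset.measurable_sum _ fun i _ => Measurable.sub ?_ ?_).pow_const 2).ennreal_ofReal
    · exact hk.comp (measurable_fst.prodMk ((measurable_pi_apply i).comp measurable_fst))
    · exact hk.comp (measurable_fst.prodMk ((measurable_pi_apply i).comp measurable_snd))
  have hev : ∀ i : Fin n, MeasurePreserving (Function.eval i) P ν :=
    measurePreserving_eval fun _ : Fin n => ν
  -- Ghost sample: `k z` is centred, so subtracting its values at an independent `z'` changes
  -- nothing on average over `z'`, and Jensen applies.
  have h1 : ∀ z, ENNReal.ofReal ((∑ i, k z (z i)) ^ 2) ≤ ∫⁻ z', Φ (z, z') ∂P := fun z => by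
    have hi : ∀ i, Integrable (fun z' : Fin n → Z => k z (z i) - k z (z' i)) P := fun i =>
      (integrable_const _).sub ((hev i).integrable_comp_of_integrable (hki z))
    have h2 : ∫ z', ∑ i, (k z (z i) - k z (z' i)) ∂P = ∑ i, k z (z i) := by
      rw [integral_finsetSum _ fun i _ => hi i]
      refine Finset.sum_congr rfl fun i _ => ?_
      have h4 : Integrable (fun z' : Fin n → Z => k z (z' i)) P :=
        (hev i).integrable_comp_of_integrable (hki z)
      rw [integral_sub (integrable_const _) h4]
      have h3 : ∫ z', k z (z' i) ∂P = ∫ y, k z y ∂ν :=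
        integral_comp_eval (μ := fun _ : Fin n => ν) (hki z).aestronglyMeasurable
      rw [h3, hk0]; simp
    rw [← h2]
    exact ofReal_sq_integral_le (integrable_finsetSum _ fun i _ => hi i).aestronglyMeasurable
  calc _ ≤ ∫⁻ z, ∫⁻ z', Φ (z, z') ∂P ∂P := lintegral_mono h1
    _ = ∫⁻ q, Φ q ∂(P.prod P) := (lintegral_prod _ hΦ.aemeasurable).symm
    _ = _ := lintegral_eq_signAverage_coordSwap hΦ
    _ ≤ ((2 : ℝ≥0∞) ^ n)⁻¹ * ∑ e : Fin n → Bool, 4 * ∫⁻ z, G z e ∂P := by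
        gcongr with e
        calc ∫⁻ q, Φ (coordSwap e q) ∂(P.prod P)
            ≤ ∫⁻ q, (2 * G q.1 e + 2 * G q.2 e) ∂(P.prod P) := by
              refine lintegral_mono fun q => ?_
              simp only [Φ]
              -- The selecting sample is itself swapped, but it only names a member of the class.
              -- The bound by `G` holds for every selecting sample `z₀`, so it is simply frozen.
              rw [sum_coordSwap_sub e q (k (coordSwap e q).1)]
              set a := ∑ i, boolSign (e i) * k (coordSwap e q).1 (q.1 i)
              set b := ∑ i, boolSign (e i) * k (coordSwap e q).1 (q.2 i)
              calc ENNReal.ofReal ((a - b) ^ 2) ≤ ENNReal.ofReal (2 * a ^ 2 + 2 * b ^ 2) :=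
                    ENNReal.ofReal_le_ofReal (by nlinarith [sq_nonneg (a + b)])
                _ = 2 * ENNReal.ofReal (a ^ 2) + 2 * ENNReal.ofReal (b ^ 2) := by
                    rw [ENNReal.ofReal_add (by positivity) (by positivity),
                      ENNReal.ofReal_mul zero_le_two, ENNReal.ofReal_mul zero_le_two,
                      ENNReal.ofReal_ofNat]
                _ ≤ _ := by gcongr <;> exact hG _ _ _
          _ = 4 * ∫⁻ z, G z e ∂P := by
              have h1 : Measurable fun q : (Fin n → Z) × (Fin n → Z) => G q.1 e :=
                (hGm e).comp measurable_fst
              have h2 : Measurable fun q : (Fin n → Z) × (Fin n → Z) => G q.2 e :=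
                (hGm e).comp measurable_snd
              have h3 : ∫⁻ q, G q.1 e ∂(P.prod P) = ∫⁻ z, G z e ∂P :=
                measurePreserving_fst.lintegral_comp (hGm e)
              have h4 : ∫⁻ q, G q.2 e ∂(P.prod P) = ∫⁻ z, G z e ∂P :=
                measurePreserving_snd.lintegral_comp (hGm e)
              rw [lintegral_add_left (h1.const_mul 2), lintegral_const_mul 2 h1,
                lintegral_const_mul 2 h2, h3, h4, ← add_mul]
              norm_num
    _ = 4 * signAverage P G := by
        rw [signAverage, ← Finset.mul_sum]; ring

/-- Symmetrization and contraction in mean for a function selected by the sample. -/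
theorem integral_sum_selection_le {u : (Fin n → Z) → Z → ℝ}
    (hu : Measurable fun q : (Fin n → Z) × Z => u q.1 q.2) {φ : ℝ → ℝ} (hφm : Measurable φ)
    {K : ℝ} (hφK : ∀ a, |φ a| ≤ K) (hφ : ∀ a b, |φ a - φ b| ≤ |a - b|)
    {G : (Fin n → Z) → (Fin n → Bool) → ℝ≥0∞} (hGm : ∀ e, Measurable fun z => G z e)
    (hG : ∀ z z₀ e, ENNReal.ofReal (∑ i, boolSign (e i) * u z₀ (z i)) ≤ G z e)
    (hfin : signAverage (Measure.pi fun _ => ν) G ≠ ∞) :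
    ∫ z, ∑ i, ((∫ y, φ (u z y) ∂ν) - φ (u z (z i))) ∂(Measure.pi fun _ => ν) ≤
      2 * (signAverage (Measure.pi fun _ => ν) G).toReal := by
  set P := Measure.pi fun _ : Fin n => ν
  set Φ : (Fin n → Z) × (Fin n → Z) → ℝ := fun q => ∑ i, (φ (u q.1 (q.2 i)) - φ (u q.1 (q.1 i)))
  have hm1 : ∀ i, Measurable fun q : (Fin n → Z) × (Fin n → Z) => φ (u q.1 (q.2 i)) := fun i =>
    hφm.comp (hu.comp (measurable_fst.prodMk ((measurable_pi_apply i).comp measurable_snd)))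
  have hm2 : ∀ i, Measurable fun q : (Fin n → Z) × (Fin n → Z) => φ (u q.1 (q.1 i)) := fun i =>
    hφm.comp (hu.comp (measurable_fst.prodMk ((measurable_pi_apply i).comp measurable_fst)))
  have hΦ : Measurable Φ := Finset.measurable_sum _ fun i _ => (hm1 i).sub (hm2 i)
  have hΦi : Integrable Φ (P.prod P) := integrable_finsetSum _ fun i _ =>
    (integrable_of_abs_le (hm1 i) fun _ => hφK _).sub (integrable_of_abs_le (hm2 i) fun _ => hφK _)
  have hev : ∀ i : Fin n, MeasurePreserving (Function.eval i) P ν :=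
    measurePreserving_eval fun _ : Fin n => ν
  have hus : ∀ z, Measurable fun y => φ (u z y) := fun z =>
    hφm.comp (hu.comp (measurable_const.prodMk measurable_id))
  have hlhs : ∫ z, ∑ i, ((∫ y, φ (u z y) ∂ν) - φ (u z (z i))) ∂P = ∫ q, Φ q ∂(P.prod P) := by
    rw [integral_prod _ hΦi]
    refine integral_congr_ae (ae_of_all _ fun z => ?_)
    have hi : ∀ i : Fin n, Integrable (fun z' : Fin n → Z => φ (u z (z' i))) P := fun i =>
      integrable_of_abs_le ((hus z).comp (measurable_pi_apply i)) fun _ => hφK _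
    change _ = ∫ z', ∑ i, (φ (u z (z' i)) - φ (u z (z i))) ∂P
    have hi' : ∀ i : Fin n, Integrable (fun z' : Fin n → Z => φ (u z (z' i)) - φ (u z (z i))) P :=
      fun i => (hi i).sub (integrable_const _)
    rw [integral_finsetSum _ fun i _ => hi' i]
    refine Finset.sum_congr rfl fun i _ => ?_
    rw [integral_sub (hi i) (integrable_const _), ← (hev i).map_eq,
      integral_map (hev i).measurable.aemeasurable (hus z).aestronglyMeasurable]
    simp
  have h2n : (0 : ℝ) < 2 ^ n := by positivity
  have hsw : ∀ e : Fin n → Bool, Integrable (fun q => Φ (coordSwap e q)) (P.prod P) := fun e =>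
    (measurePreserving_coordSwap e).integrable_comp_of_integrable hΦi
  -- The contraction inequality holds only after summation over all patterns, so the sum over `e` is
  -- brought inside the integral before anything is bounded.
  have hsym : 2 ^ n * ∫ q, Φ q ∂(P.prod P) =
      ∫ q, ∑ e : Fin n → Bool, Φ (coordSwap e q) ∂(P.prod P) := by
    rw [integral_finsetSum _ fun e _ => hsw e]
    have h3 : ∀ e : Fin n → Bool,
        ∫ q, Φ (coordSwap e q) ∂(P.prod P) = ∫ q, Φ q ∂(P.prod P) := fun e => by
      have h := measurePreserving_coordSwap (ν := ν) e
      conv_rhs => rw [← h.map_eq]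
      exact (integral_map h.measurable.aemeasurable hΦ.aestronglyMeasurable).symm
    simp [h3]
  have hfin' : ∀ e, ∫⁻ z, G z e ∂P ≠ ∞ := fun e he => hfin <| by
    rw [signAverage, (ENNReal.sum_eq_top).2 ⟨e, Finset.mem_univ _, he⟩,
      ENNReal.mul_top (by simp)]
  have hGi : ∀ e, Integrable (fun z => (G z e).toReal) P := fun e =>
    integrable_toReal_of_lintegral_ne_top (hGm e).aemeasurable (hfin' e)
  have hlt : ∀ᵐ z ∂P, ∀ e, G z e < ∞ := ae_all_iff.2 fun e => ae_lt_top (hGm e) (hfin' e)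
  have hcon : ∀ z, (∀ e, G z e < ∞) → ∀ {ψ : ℝ → ℝ}, (∀ a b, |ψ a - ψ b| ≤ |a - b|) →
      ∀ s : (Fin n → Bool) → (Fin n → Z),
      ∑ e, ∑ i, boolSign (e i) * ψ (u (s e) (z i)) ≤ ∑ e, (G z e).toReal := fun z hz ψ hψ s => by
    have h := sum_contraction_le hψ n (fun z₀ i => u z₀ (z i)) (fun _ => 0)
      (fun e => (G z e).toReal) (fun e z₀ => by
        rw [zero_add]
        exact (ENNReal.ofReal_le_iff_le_toReal (hz e).ne).1 (hG z z₀ e)) s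
    simpa using h
  have hpt : ∀ᵐ q ∂(P.prod P), ∑ e : Fin n → Bool, Φ (coordSwap e q) ≤
      ∑ e, (G q.2 e).toReal + ∑ e, (G q.1 e).toReal := by
    filter_upwards [measurePreserving_fst.quasiMeasurePreserving.ae hlt,
      measurePreserving_snd.quasiMeasurePreserving.ae hlt] with q h1 h2
    -- The samples themselves serve as the index set. The second sample enters with `φ`, the first
    -- with `-φ`, which is equally Lipschitz.
    refine le_trans (le_of_eq ?_) (add_le_add (hcon q.2 h2 hφ fun e => (coordSwap e q).1)
      (hcon q.1 h1 (ψ := fun a => -φ a) (fun a b => by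
        rw [← abs_neg]; convert hφ a b using 2; ring) fun e => (coordSwap e q).1))
    rw [← Finset.sum_add_distrib]
    refine Finset.sum_congr rfl fun e _ => ?_
    have h := sum_coordSwap_sub e q fun y => φ (u (coordSwap e q).1 y)
    have h' : Φ (coordSwap e q) = -∑ i, (φ (u (coordSwap e q).1 ((coordSwap e q).1 i)) -
        φ (u (coordSwap e q).1 ((coordSwap e q).2 i))) := by
      rw [← Finset.sum_neg_distrib]
      exact Finset.sum_congr rfl fun i _ => (neg_sub _ _).symm
    rw [h', h]
    simp only [mul_neg, Finset.sum_neg_distrib]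
    ring
  have hI2 : Integrable (fun q : (Fin n → Z) × (Fin n → Z) => ∑ e, (G q.2 e).toReal) (P.prod P) :=
    integrable_finsetSum _ fun e _ => measurePreserving_snd.integrable_comp_of_integrable (hGi e)
  have hI1 : Integrable (fun q : (Fin n → Z) × (Fin n → Z) => ∑ e, (G q.1 e).toReal) (P.prod P) :=
    integrable_finsetSum _ fun e _ => measurePreserving_fst.integrable_comp_of_integrable (hGi e)
  have hsum : ∫ z, ∑ e, (G z e).toReal ∂P = 2 ^ n * (signAverage P G).toReal := by
    rw [integral_finsetSum _ fun e _ => hGi e, signAverage, ENNReal.toReal_mul,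
      ENNReal.toReal_sum fun e _ => hfin' e, ENNReal.toReal_inv, ENNReal.toReal_pow,
      ENNReal.toReal_ofNat, ← mul_assoc, mul_inv_cancel₀ h2n.ne', one_mul]
    exact Finset.sum_congr rfl fun e _ => integral_toReal (hGm e).aemeasurable
      (ae_lt_top (hGm e) (hfin' e))
  rw [hlhs]
  refine le_of_mul_le_mul_left ?_ h2n
  rw [hsym]
  calc _ ≤ ∫ q, (∑ e, (G q.2 e).toReal + ∑ e, (G q.1 e).toReal) ∂(P.prod P) :=
        integral_mono_ae (integrable_finsetSum _ fun e _ => hsw e) (hI2.add hI1) hpt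
    _ = 2 ^ n * (2 * (signAverage P G).toReal) := by
        rw [integral_add hI2 hI1, integral_fun_snd (fun z => ∑ e, (G z e).toReal),
          integral_fun_fst (fun z => ∑ e, (G z e).toReal), hsum]
        simp
        ring

end Symmetrization

/-! ### Integration under the observational model. -/

theorem memLp_two_of_lintegral_ne_top {α : Type*} [MeasurableSpace α] {μ : Measure α} {f : α → ℝ}
    (hf : Measurable f) (h : ∫⁻ x, ENNReal.ofReal (f x ^ 2) ∂μ ≠ ∞) : MemLp f 2 μ := by
  refine ⟨hf.aestronglyMeasurable, lt_top_iff_ne_top.2 fun h' => h ?_⟩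
  rw [← eLpNorm_two_sq, h']; rfl

theorem lintegral_ofReal_sq {α : Type*} [MeasurableSpace α] {μ : Measure α} {f : α → ℝ}
    (hf : MemLp f 2 μ) :
    ∫⁻ x, ENNReal.ofReal (f x ^ 2) ∂μ = ENNReal.ofReal (∫ x, f x ^ 2 ∂μ) :=
  (ofReal_integral_eq_lintegral_ofReal hf.integrable_sq (ae_of_all _ fun _ => sq_nonneg _)).symm

namespace ObsModel

variable {X A : Type*} [MeasurableSpace X] [MeasurableSpace A] (M : ObsModel X A)

theorem measurable_density : Measurable fun p => ENNReal.ofReal (M.propensity p) :=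
  M.measurable_propensity.ennreal_ofReal

theorem measurable_density_section (x : X) :
    Measurable fun a => ENNReal.ofReal (M.propensity (x, a)) :=
  M.measurable_density.comp measurable_prodMk_left

theorem measurable_ratio : Measurable M.ratio := M.measurable_weight.div M.measurable_propensity

theorem wnorm_sq (h : X × A → ℝ) :
    M.wnorm h ^ 2 = ∫⁻ p, ENNReal.ofReal (h p ^ 2) ∂M.omegaMeasure := eLpNorm_two_sq _ _

/-- The conditional law of the action given the state. -/
def actionLaw (x : X) : Measure A :=
  M.base.withDensity fun a => ENNReal.ofReal (M.propensity (x, a))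

instance (x : X) : IsProbabilityMeasure (M.actionLaw x) :=
  ⟨by rw [actionLaw, withDensity_apply _ MeasurableSet.univ, Measure.restrict_univ,
    M.lintegral_propensity]⟩

theorem lintegral_pairLaw {k : X × A → ℝ≥0∞} (hk : Measurable k) :
    ∫⁻ p, k p ∂M.pairLaw = ∫⁻ x, ∫⁻ a, k (x, a) ∂(M.actionLaw x) ∂M.stateLaw := by
  rw [pairLaw, lintegral_withDensity_eq_lintegral_mul _ M.measurable_density hk,
    lintegral_prod _ (M.measurable_density.mul hk).aemeasurable]
  refine lintegral_congr fun x => ?_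
  have h1 : Measurable fun a => k (x, a) := hk.comp measurable_prodMk_left
  rw [actionLaw, lintegral_withDensity_eq_lintegral_mul _ (M.measurable_density_section x) h1]
  rfl

theorem measurePreserving_state : MeasurePreserving Prod.fst M.pairLaw M.stateLaw := by
  refine ⟨measurable_fst, Measure.ext fun s hs => ?_⟩
  rw [Measure.map_apply measurable_fst hs, ← lintegral_indicator_one (measurable_fst hs),
    M.lintegral_pairLaw (measurable_one.indicator (measurable_fst hs)),
    ← lintegral_indicator_one hs]
  refine lintegral_congr fun x => ?_
  have : ∀ a : A, (Prod.fst ⁻¹' s).indicator (1 : X × A → ℝ≥0∞) (x, a) = s.indicator 1 x :=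
    fun a => by by_cases h : x ∈ s <;> simp [h]
  simp [this]

instance : IsProbabilityMeasure M.pairLaw :=
  ⟨by
    have := M.measurePreserving_state.measure_preimage MeasurableSet.univ.nullMeasurableSet
    simpa using this⟩

instance : IsProbabilityMeasure M.obsLaw := by unfold obsLaw; infer_instance

instance (m : ℕ) : IsProbabilityMeasure (M.sampleLaw m) := by unfold sampleLaw; infer_instance

instance : SFinite M.omegaMeasure := by unfold omegaMeasure; infer_instance

theorem measurePreserving_pair : MeasurePreserving Prod.fst M.obsLaw M.pairLaw :=
  ⟨measurable_fst, Measure.fst_compProd M.pairLaw M.outcome⟩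

theorem measurable_omegaDensity : Measurable fun p =>
    ENNReal.ofReal (M.weight p ^ 2) / ENNReal.ofReal (M.propensity p) :=
  (M.measurable_weight.pow_const 2).ennreal_ofReal.div M.measurable_density

/-- Where `π > 0` the densities agree, as `π (g/π)² = g²/π`. It is only an inequality because
`pairLaw` ignores `{π = 0}`, where `omegaMeasure` has infinite density if `g ≠ 0`. -/
theorem lintegral_ratio_sq_mul_le {k : X × A → ℝ≥0∞} (hk : Measurable k) :
    ∫⁻ p, ENNReal.ofReal (M.ratio p ^ 2) * k p ∂M.pairLaw ≤ ∫⁻ p, k p ∂M.omegaMeasure := by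
  have h1 : Measurable fun p => ENNReal.ofReal (M.ratio p ^ 2) * k p :=
    (M.measurable_ratio.pow_const 2).ennreal_ofReal.mul hk
  rw [pairLaw, lintegral_withDensity_eq_lintegral_mul _ M.measurable_density h1, omegaMeasure,
    lintegral_withDensity_eq_lintegral_mul _ M.measurable_omegaDensity hk]
  refine lintegral_mono fun p => ?_
  simp only [Pi.mul_apply, ← mul_assoc]
  gcongr
  rcases (M.propensity_nonneg p).eq_or_lt with h | h
  · simp [← h]
  · rw [← ENNReal.ofReal_mul h.le, ← ENNReal.ofReal_div_of_pos h]
    refine ENNReal.ofReal_le_ofReal (le_of_eq ?_)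
    rw [ratio]; field_simp

theorem lintegral_ratio_mul_sq_le {h : X × A → ℝ} (hh : Measurable h) :
    ∫⁻ p, ENNReal.ofReal ((M.ratio p * h p) ^ 2) ∂M.pairLaw ≤ M.wnorm h ^ 2 := by
  rw [wnorm_sq]
  refine le_trans (le_of_eq (lintegral_congr fun p => ?_))
    (M.lintegral_ratio_sq_mul_le (hh.pow_const 2).ennreal_ofReal)
  rw [mul_pow, ENNReal.ofReal_mul (sq_nonneg _)]

theorem memLp_ratio_mul {h : X × A → ℝ} (hh : Measurable h) (hn : M.wnorm h ≠ ∞) :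
    MemLp (fun p => M.ratio p * h p) 2 M.pairLaw :=
  memLp_two_of_lintegral_ne_top (M.measurable_ratio.mul hh)
    (ne_top_of_le_ne_top (ENNReal.pow_ne_top hn) (M.lintegral_ratio_mul_sq_le hh))

/-- A finite weighted norm forces `h = 0` almost everywhere on `{π = 0 ≠ g}`, so the convention `g /
0 = 0` loses nothing. -/
theorem weight_mul_eq {h : X × A → ℝ} (hh : Measurable h) (hn : M.wnorm h ≠ ∞) :
    ∀ᵐ p ∂(M.stateLaw.prod M.base),
      M.weight p * h p = M.propensity p * (M.ratio p * h p) := by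
  have h1 : ∫⁻ p, ENNReal.ofReal (h p ^ 2) ∂M.omegaMeasure ≠ ∞ := by
    rw [← wnorm_sq]; exact ENNReal.pow_ne_top hn
  have h2 : Measurable fun p => ENNReal.ofReal (h p ^ 2) := (hh.pow_const 2).ennreal_ofReal
  rw [omegaMeasure, lintegral_withDensity_eq_lintegral_mul _ M.measurable_omegaDensity h2] at h1
  filter_upwards [ae_lt_top (M.measurable_omegaDensity.mul h2) h1] with p hp
  rcases (M.propensity_nonneg p).eq_or_lt with h0 | h0
  · rw [← h0, zero_mul]
    by_contra hne
    obtain ⟨hw, hh0⟩ := mul_ne_zero_iff.1 hne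
    simp only [Pi.mul_apply, ← h0, ENNReal.ofReal_zero] at hp
    rw [ENNReal.div_zero (by simpa using hw), ENNReal.top_mul (by simpa using hh0)] at hp
    exact lt_irrefl _ hp
  · rw [ratio]; field_simp

theorem integrable_pairLaw_iff {k : X × A → ℝ} :
    Integrable k M.pairLaw ↔
      Integrable (fun p => M.propensity p * k p) (M.stateLaw.prod M.base) := by
  rw [pairLaw, integrable_withDensity_iff M.measurable_density (ae_of_all _ fun _ => by simp)]
  simp only [ENNReal.toReal_ofReal (M.propensity_nonneg _), mul_comm]

theorem integral_pairLaw (k : X × A → ℝ) :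
    ∫ p, k p ∂M.pairLaw = ∫ p, M.propensity p * k p ∂(M.stateLaw.prod M.base) := by
  rw [pairLaw, integral_withDensity_eq_integral_toReal_smul M.measurable_density
    (ae_of_all _ fun _ => by simp)]
  simp only [ENNReal.toReal_ofReal (M.propensity_nonneg _), smul_eq_mul]

theorem integral_actionLaw (x : X) (k : A → ℝ) :
    ∫ a, k a ∂(M.actionLaw x) = ∫ a, M.propensity (x, a) * k a ∂M.base := by
  rw [actionLaw, integral_withDensity_eq_integral_toReal_smul (M.measurable_density_section x)
    (ae_of_all _ fun _ => by simp)]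
  simp only [ENNReal.toReal_ofReal (M.propensity_nonneg _), smul_eq_mul]

theorem measurable_actInner {h : X × A → ℝ} (hh : Measurable h) : Measurable (M.actInner h) :=
  (StronglyMeasurable.integral_prod_right'
    (M.measurable_weight.mul hh).stronglyMeasurable).measurable

/-- `⟨g, h⟩` is the conditional expectation of `g h / π` given the state. -/
theorem integral_ratio_mul_state {h : X × A → ℝ} (hh : Measurable h) (hn : M.wnorm h ≠ ∞)
    {b : X → ℝ} (hi : Integrable (fun p => M.ratio p * h p * b p.1) M.pairLaw) :
    ∫ p, M.ratio p * h p * b p.1 ∂M.pairLaw = ∫ x, M.actInner h x * b x ∂M.stateLaw := by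
  have h1 : (fun p => M.propensity p * (M.ratio p * h p * b p.1))
      =ᵐ[M.stateLaw.prod M.base] fun p => M.weight p * h p * b p.1 := by
    filter_upwards [M.weight_mul_eq hh hn] with p hp
    rw [hp]; ring
  rw [integral_pairLaw, integral_congr_ae h1,
    integral_prod _ ((M.integrable_pairLaw_iff.1 hi).congr h1)]
  refine integral_congr_ae (ae_of_all _ fun x => ?_)
  exact integral_mul_const (b x) fun a => M.weight (x, a) * h (x, a)

/-- Jensen for the conditional law of the action, since `⟨g, h⟩` is the conditional mean of `g h /
π`. -/
theorem lintegral_actInner_sq_le {h : X × A → ℝ} (hh : Measurable h) (hn : M.wnorm h ≠ ∞) :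
    ∫⁻ x, ENNReal.ofReal (M.actInner h x ^ 2) ∂M.stateLaw ≤ M.wnorm h ^ 2 := by
  have hm : Measurable fun p => M.ratio p * h p := M.measurable_ratio.mul hh
  refine le_trans ?_ (M.lintegral_ratio_mul_sq_le hh)
  rw [M.lintegral_pairLaw (hm.pow_const 2).ennreal_ofReal]
  refine lintegral_mono_ae ?_
  filter_upwards [Measure.ae_ae_of_ae_prod (M.weight_mul_eq hh hn)] with x hx
  have : M.actInner h x = ∫ a, M.ratio (x, a) * h (x, a) ∂(M.actionLaw x) := by
    rw [integral_actionLaw, actInner]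
    exact integral_congr_ae hx
  rw [this]
  exact ofReal_sq_integral_le (hm.comp measurable_prodMk_left).aestronglyMeasurable

theorem memLp_actInner {h : X × A → ℝ} (hh : Measurable h) (hn : M.wnorm h ≠ ∞) :
    MemLp (M.actInner h) 2 M.stateLaw :=
  memLp_two_of_lintegral_ne_top (M.measurable_actInner hh)
    (ne_top_of_le_ne_top (ENNReal.pow_ne_top hn) (M.lintegral_actInner_sq_le hh hn))

theorem measurable_muStar : Measurable M.muStar :=
  (StronglyMeasurable.integral_kernel (κ := M.outcome)
    measurable_id.stronglyMeasurable).measurable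

theorem integrable_outcome (p : X × A) : Integrable (fun y : ℝ => y) (M.outcome p) :=
  (M.memLp_outcome p).integrable one_le_two

theorem measurable_condVar : Measurable M.condVar :=
  (StronglyMeasurable.integral_kernel_prod_right' (κ := M.outcome)
    (((measurable_snd.sub (M.measurable_muStar.comp measurable_fst)).pow_const
      2).stronglyMeasurable)).measurable

/-- The weighted noise `(g / π) (Y - μ*)`. -/
def noise (o : Obs X A) : ℝ := M.ratio o.1 * (o.2 - M.muStar o.1)

theorem measurable_noise : Measurable M.noise :=
  (M.measurable_ratio.comp measurable_fst).mul
    (measurable_snd.sub (M.measurable_muStar.comp measurable_fst))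

theorem lintegral_noise_sq_le :
    ∫⁻ o, ENNReal.ofReal (M.noise o ^ 2) ∂M.obsLaw ≤
      ∫⁻ p, ENNReal.ofReal (M.condVar p) ∂M.omegaMeasure := by
  refine le_trans (le_of_eq ?_) (M.lintegral_ratio_sq_mul_le M.measurable_condVar.ennreal_ofReal)
  rw [obsLaw, Measure.lintegral_compProd (M.measurable_noise.pow_const 2).ennreal_ofReal]
  refine lintegral_congr fun p => ?_
  have hL : MemLp (fun y : ℝ => y - M.muStar p) 2 (M.outcome p) :=
    (M.memLp_outcome p).sub (memLp_const _)
  rw [condVar, ← lintegral_ofReal_sq hL, ← lintegral_const_mul' _ _ ENNReal.ofReal_ne_top]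
  refine lintegral_congr fun y => ?_
  rw [noise, mul_pow, ENNReal.ofReal_mul (sq_nonneg _)]

/-- Given the pair, `Y - μ*` has mean zero and `k` is a constant. -/
theorem integral_noise_mul {k : X × A → ℝ}
    (hi : Integrable (fun o => M.noise o * k o.1) M.obsLaw) :
    ∫ o, M.noise o * k o.1 ∂M.obsLaw = 0 := by
  rw [obsLaw] at hi ⊢
  rw [Measure.integral_compProd hi]
  refine integral_eq_zero_of_ae (ae_of_all _ fun p => ?_)
  have : ∀ y, M.noise (p, y) * k p = M.ratio p * k p * (y - M.muStar p) := fun y => by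
    rw [noise]; ring
  simp only [this]
  rw [integral_const_mul, integral_sub (M.integrable_outcome p) (integrable_const _)]
  simp [muStar]

/-- The estimand integrates over states first, so this is Fubini. Integrability of `g μ*` follows
from the finite weighted norm of `μ*`. -/
theorem tauStar_eq {M : ObsModel X A} (hμ : M.wnorm M.muStar ≠ ∞) :
    M.tauStar = ∫ x, M.actInner M.muStar x ∂M.stateLaw := by
  have h := M.memLp_ratio_mul M.measurable_muStar hμ
  have h1 : Integrable (fun p => M.weight p * M.muStar p) (M.stateLaw.prod M.base) :=
    (M.integrable_pairLaw_iff.1 (h.integrable one_le_two)).congr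
      ((M.weight_mul_eq M.measurable_muStar hμ).mono fun p hp => hp.symm)
  rw [tauStar, ← integral_prod_symm _ h1, integral_prod _ h1]
  rfl

/-- The centred oracle score: the weighted noise plus the centred conditional mean. -/
def oracleScore (o : Obs X A) : ℝ := M.noise o + (M.actInner M.muStar o.1.1 - M.tauStar)

/-- The increment of the score caused by replacing the treatment effect by `h`. -/
def scoreError (h : X × A → ℝ) (p : X × A) : ℝ :=
  M.ratio p * (M.muStar p - h p) - (M.actInner M.muStar p.1 - M.actInner h p.1)

/-- The first summand does not involve `h`; the second does not involve the outcome and vanishes at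
`h = μ*`. -/
theorem score_eq (h : X × A → ℝ) (o : Obs X A) :
    M.ratio o.1 * o.2 - M.auxFun h o.1 - M.tauStar = M.oracleScore o + M.scoreError h o.1 := by
  simp only [auxFun, oracleScore, scoreError, noise, ratio]; ring

theorem measurable_oracleScore : Measurable M.oracleScore :=
  M.measurable_noise.add
    (((M.measurable_actInner M.measurable_muStar).comp measurable_fst.fst).sub_const _)

theorem measurable_scoreError {h : X × A → ℝ} (hh : Measurable h) : Measurable (M.scoreError h) :=
  (M.measurable_ratio.mul (M.measurable_muStar.sub hh)).sub
    (((M.measurable_actInner M.measurable_muStar).comp measurable_fst).sub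
      ((M.measurable_actInner hh).comp measurable_fst))

theorem wnorm_sub_ne_top {f h : X × A → ℝ} (hf : Measurable f) (hfn : M.wnorm f ≠ ∞)
    (hh : Measurable h) (hhn : M.wnorm h ≠ ∞) : M.wnorm (f - h) ≠ ∞ :=
  ne_top_of_le_ne_top (ENNReal.add_ne_top.2 ⟨hfn, hhn⟩)
    (eLpNorm_sub_le hf.aestronglyMeasurable hh.aestronglyMeasurable one_le_two)

theorem wnorm_sub_comm (f h : X × A → ℝ) : M.wnorm (f - h) = M.wnorm (h - f) := by
  rw [wnorm, ← eLpNorm_neg, neg_sub]; rfl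

theorem effVar_ne_top_iff : M.effVar ≠ ∞ ↔
    evariance (M.actInner M.muStar) M.stateLaw ≠ ∞ ∧
      ∫⁻ p, ENNReal.ofReal (M.condVar p) ∂M.omegaMeasure ≠ ∞ := by
  rw [effVar, ENNReal.add_ne_top]

theorem memLp_noise (hv : M.effVar ≠ ∞) : MemLp M.noise 2 M.obsLaw :=
  memLp_two_of_lintegral_ne_top M.measurable_noise
    (ne_top_of_le_ne_top (M.effVar_ne_top_iff.1 hv).2 M.lintegral_noise_sq_le)

/-! ### Orthogonality and second moments of the scores. -/

section Score

variable {M}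

theorem memLp_centredMean (hμ : M.wnorm M.muStar ≠ ∞) :
    MemLp (fun x => M.actInner M.muStar x - M.tauStar) 2 M.stateLaw :=
  (M.memLp_actInner M.measurable_muStar hμ).sub (memLp_const _)

theorem memLp_scoreError (hμ : M.wnorm M.muStar ≠ ∞) {h : X × A → ℝ} (hh : Measurable h)
    (hn : M.wnorm h ≠ ∞) : MemLp (M.scoreError h) 2 M.pairLaw := by
  refine MemLp.sub (M.memLp_ratio_mul (h := M.muStar - h) (M.measurable_muStar.sub hh)
    (M.wnorm_sub_ne_top M.measurable_muStar hμ hh hn)) (MemLp.sub ?_ ?_)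
  · exact (M.memLp_actInner M.measurable_muStar hμ).comp_measurePreserving M.measurePreserving_state
  · exact (M.memLp_actInner hh hn).comp_measurePreserving M.measurePreserving_state

theorem memLp_oracleScore (hμ : M.wnorm M.muStar ≠ ∞) (hv : M.effVar ≠ ∞) :
    MemLp M.oracleScore 2 M.obsLaw :=
  (M.memLp_noise hv).add (((memLp_centredMean hμ).comp_measurePreserving
    M.measurePreserving_state).comp_measurePreserving M.measurePreserving_pair)

/-- The increment of the score is centred given the state. -/
theorem integral_scoreError_mul_state (hμ : M.wnorm M.muStar ≠ ∞) {h : X × A → ℝ}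
    (hh : Measurable h) (hn : M.wnorm h ≠ ∞) {b : X → ℝ} (hb : MemLp b 2 M.stateLaw) :
    ∫ p, M.scoreError h p * b p.1 ∂M.pairLaw = 0 := by
  have hb' : MemLp (fun p : X × A => b p.1) 2 M.pairLaw :=
    hb.comp_measurePreserving M.measurePreserving_state
  have key : ∀ f : X × A → ℝ, Measurable f → M.wnorm f ≠ ∞ →
      Integrable (fun p => M.ratio p * f p * b p.1 - M.actInner f p.1 * b p.1) M.pairLaw ∧
      ∫ p, (M.ratio p * f p * b p.1 - M.actInner f p.1 * b p.1) ∂M.pairLaw = 0 := by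
    intro f hf hfn
    have i1 : Integrable (fun p => M.ratio p * f p * b p.1) M.pairLaw :=
      (M.memLp_ratio_mul hf hfn).integrable_mul hb'
    have i2 : Integrable (fun p : X × A => M.actInner f p.1 * b p.1) M.pairLaw :=
      ((M.memLp_actInner hf hfn).comp_measurePreserving
        M.measurePreserving_state).integrable_mul hb'
    refine ⟨i1.sub i2, ?_⟩
    rw [integral_sub i1 i2, M.integral_ratio_mul_state hf hfn i1, sub_eq_zero]
    have h3 : AEStronglyMeasurable (fun x => M.actInner f x * b x) M.stateLaw :=
      (M.measurable_actInner hf).aestronglyMeasurable.mul hb.aestronglyMeasurable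
    conv_lhs => rw [← M.measurePreserving_state.map_eq]
    rw [← M.measurePreserving_state.map_eq] at h3
    rw [integral_map measurable_fst.aemeasurable h3]
  obtain ⟨i1, e1⟩ := key _ M.measurable_muStar hμ
  obtain ⟨i2, e2⟩ := key _ hh hn
  have : ∀ p, M.scoreError h p * b p.1 =
      (M.ratio p * M.muStar p * b p.1 - M.actInner M.muStar p.1 * b p.1) -
      (M.ratio p * h p * b p.1 - M.actInner h p.1 * b p.1) := fun p => by
    rw [scoreError]; ring
  simp only [this]
  rw [integral_sub i1 i2, e1, e2, sub_zero]

theorem integral_scoreError (hμ : M.wnorm M.muStar ≠ ∞) {h : X × A → ℝ} (hh : Measurable h)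
    (hn : M.wnorm h ≠ ∞) : ∫ p, M.scoreError h p ∂M.pairLaw = 0 := by
  simpa using integral_scoreError_mul_state hμ hh hn (memLp_const (1 : ℝ))

theorem integral_obsLaw_fst {k : X × A → ℝ} (hk : AEStronglyMeasurable k M.pairLaw) :
    ∫ o, k o.1 ∂M.obsLaw = ∫ p, k p ∂M.pairLaw := by
  rw [← M.measurePreserving_pair.map_eq] at hk ⊢
  rw [integral_map measurable_fst.aemeasurable hk]

theorem integral_oracleScore (hμ : M.wnorm M.muStar ≠ ∞) (hv : M.effVar ≠ ∞) :
    ∫ o, M.oracleScore o ∂M.obsLaw = 0 := by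
  have i1 := (M.memLp_noise hv).integrable one_le_two
  have hL := (memLp_centredMean hμ).comp_measurePreserving M.measurePreserving_state
  have i2 : Integrable (fun o : Obs X A => M.actInner M.muStar o.1.1 - M.tauStar) M.obsLaw :=
    (hL.comp_measurePreserving M.measurePreserving_pair).integrable one_le_two
  have h1 : ∫ o, M.noise o ∂M.obsLaw = 0 := by
    simpa using M.integral_noise_mul (k := fun _ => 1) (by simpa using i1)
  have h2 : ∫ o : Obs X A, (M.actInner M.muStar o.1.1 - M.tauStar) ∂M.obsLaw = 0 := by
    have e1 := integral_obsLaw_fst hL.aestronglyMeasurable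
    have hm := (memLp_centredMean hμ).aestronglyMeasurable
    simp only [Function.comp_apply] at e1
    rw [e1]
    have e2 : ∫ x, (M.actInner M.muStar x - M.tauStar) ∂M.stateLaw = 0 := by
      rw [integral_sub ((M.memLp_actInner M.measurable_muStar hμ).integrable one_le_two)
        (integrable_const _), ← tauStar_eq hμ]
      simp
    rw [← M.measurePreserving_state.map_eq] at e2 hm
    rwa [integral_map measurable_fst.aemeasurable hm] at e2
  simp only [oracleScore]
  rw [integral_add i1 i2, h1, h2, add_zero]

/-- The noise is uncorrelated with functions of the state, so the second moment is the sum of the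
two parts, matched with the two terms of `effVar`. -/
theorem lintegral_oracleScore_sq_le (hμ : M.wnorm M.muStar ≠ ∞) (hv : M.effVar ≠ ∞) :
    ∫⁻ o, ENNReal.ofReal (M.oracleScore o ^ 2) ∂M.obsLaw ≤ M.effVar := by
  have hN := M.memLp_noise hv
  have hD : MemLp (fun p : X × A => M.actInner M.muStar p.1 - M.tauStar) 2 M.pairLaw :=
    (memLp_centredMean hμ).comp_measurePreserving M.measurePreserving_state
  have hD' : MemLp (fun o : Obs X A => M.actInner M.muStar o.1.1 - M.tauStar) 2 M.obsLaw :=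
    hD.comp_measurePreserving M.measurePreserving_pair
  have hi : Integrable (fun o : Obs X A => M.noise o * (M.actInner M.muStar o.1.1 - M.tauStar))
    M.obsLaw := hN.integrable_mul hD'
  have h0 := M.integral_noise_mul (k := fun p => M.actInner M.muStar p.1 - M.tauStar) hi
  have hU : ∫ o, M.oracleScore o ^ 2 ∂M.obsLaw = ∫ o, M.noise o ^ 2 ∂M.obsLaw +
      ∫ o : Obs X A, (M.actInner M.muStar o.1.1 - M.tauStar) ^ 2 ∂M.obsLaw := by
    have e : ∀ o, M.oracleScore o ^ 2 = M.noise o ^ 2 +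
        (M.actInner M.muStar o.1.1 - M.tauStar) ^ 2 +
        2 * (M.noise o * (M.actInner M.muStar o.1.1 - M.tauStar)) := fun o => by
      rw [oracleScore]; ring
    simp only [e]
    rw [integral_add _ (hi.const_mul 2), integral_const_mul, h0, mul_zero, add_zero,
      integral_add hN.integrable_sq hD'.integrable_sq]
    exact hN.integrable_sq.add hD'.integrable_sq
  rw [lintegral_ofReal_sq (memLp_oracleScore hμ hv), hU, ENNReal.ofReal_add
    (integral_nonneg fun _ => sq_nonneg _) (integral_nonneg fun _ => sq_nonneg _),
    ← lintegral_ofReal_sq hN, ← lintegral_ofReal_sq hD', effVar, add_comm]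
  refine add_le_add (le_of_eq ?_) M.lintegral_noise_sq_le
  have hm : Measurable fun x => ENNReal.ofReal ((M.actInner M.muStar x - M.tauStar) ^ 2) :=
    (((M.measurable_actInner M.measurable_muStar).sub_const _).pow_const 2).ennreal_ofReal
  rw [evariance_eq_lintegral_ofReal, ← tauStar_eq hμ]
  rw [← M.measurePreserving_state.lintegral_comp hm]
  exact M.measurePreserving_pair.lintegral_comp (hm.comp measurable_fst)

/-- The noise is orthogonal to functions of the pair, and the other part of the oracle score is a
function of the state, given which the score error is centred. -/
theorem integral_oracleScore_mul_scoreError (hμ : M.wnorm M.muStar ≠ ∞) (hv : M.effVar ≠ ∞)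
    {h : X × A → ℝ} (hh : Measurable h) (hn : M.wnorm h ≠ ∞) :
    ∫ o, M.oracleScore o * M.scoreError h o.1 ∂M.obsLaw = 0 := by
  have hN := M.memLp_noise hv
  have hV := memLp_scoreError hμ hh hn
  have hV' : MemLp (fun o : Obs X A => M.scoreError h o.1) 2 M.obsLaw :=
    hV.comp_measurePreserving M.measurePreserving_pair
  have hD : MemLp (fun p : X × A => M.actInner M.muStar p.1 - M.tauStar) 2 M.pairLaw :=
    (memLp_centredMean hμ).comp_measurePreserving M.measurePreserving_state
  have hD' : MemLp (fun o : Obs X A => M.actInner M.muStar o.1.1 - M.tauStar) 2 M.obsLaw :=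
    hD.comp_measurePreserving M.measurePreserving_pair
  have i1 : Integrable (fun o => M.noise o * M.scoreError h o.1) M.obsLaw := hN.integrable_mul hV'
  have i2 : Integrable (fun o : Obs X A => M.scoreError h o.1 *
    (M.actInner M.muStar o.1.1 - M.tauStar)) M.obsLaw := hV'.integrable_mul hD'
  have i3 : Integrable (fun p : X × A => M.scoreError h p *
    (M.actInner M.muStar p.1 - M.tauStar)) M.pairLaw := hV.integrable_mul hD
  have e : ∀ o, M.oracleScore o * M.scoreError h o.1 = M.noise o * M.scoreError h o.1 +
      M.scoreError h o.1 * (M.actInner M.muStar o.1.1 - M.tauStar) := fun o => by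
    rw [oracleScore]; ring
  simp only [e]
  rw [integral_add i1 i2, M.integral_noise_mul i1, zero_add,
    integral_obsLaw_fst (k := fun p => M.scoreError h p * (M.actInner M.muStar p.1 - M.tauStar))
      i3.aestronglyMeasurable]
  exact integral_scoreError_mul_state hμ hh hn (memLp_centredMean hμ)

/-- Pythagoras: the score error is `(g/π)(μ* - h)` minus its projection on functions of the state.
-/
theorem lintegral_scoreError_sq_le (hμ : M.wnorm M.muStar ≠ ∞) {h : X × A → ℝ}
    (hh : Measurable h) (hn : M.wnorm h ≠ ∞) :
    ∫⁻ p, ENNReal.ofReal (M.scoreError h p ^ 2) ∂M.pairLaw ≤ M.wnorm (h - M.muStar) ^ 2 := by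
  have hV := memLp_scoreError hμ hh hn
  have hd := M.memLp_ratio_mul (h := M.muStar - h) (M.measurable_muStar.sub hh)
    (M.wnorm_sub_ne_top M.measurable_muStar hμ hh hn)
  have hbX : MemLp (fun x => M.actInner M.muStar x - M.actInner h x) 2 M.stateLaw :=
    (M.memLp_actInner M.measurable_muStar hμ).sub (M.memLp_actInner hh hn)
  have hb : MemLp (fun p : X × A => M.actInner M.muStar p.1 - M.actInner h p.1) 2 M.pairLaw :=
    hbX.comp_measurePreserving M.measurePreserving_state
  have i1 : Integrable (fun p : X × A => M.scoreError h p *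
    (M.actInner M.muStar p.1 - M.actInner h p.1)) M.pairLaw := hV.integrable_mul hb
  have h0 : ∫ p, M.scoreError h p * (M.actInner M.muStar p.1 - M.actInner h p.1) ∂M.pairLaw = 0 :=
    integral_scoreError_mul_state hμ hh hn hbX
  rw [wnorm_sub_comm]
  refine le_trans ?_ (M.lintegral_ratio_mul_sq_le (h := M.muStar - h) (M.measurable_muStar.sub hh))
  rw [lintegral_ofReal_sq hV, lintegral_ofReal_sq hd]
  refine ENNReal.ofReal_le_ofReal ?_
  have e : ∀ p, (M.ratio p * (M.muStar - h) p) ^ 2 = M.scoreError h p ^ 2 +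
      2 * (M.scoreError h p * (M.actInner M.muStar p.1 - M.actInner h p.1)) +
      (M.actInner M.muStar p.1 - M.actInner h p.1) ^ 2 := fun p => by
    rw [scoreError, Pi.sub_apply]; ring
  simp only [e]
  have i2 : Integrable (fun p => M.scoreError h p ^ 2 +
      2 * (M.scoreError h p * (M.actInner M.muStar p.1 - M.actInner h p.1))) M.pairLaw :=
    hV.integrable_sq.add (i1.const_mul 2)
  rw [integral_add i2 hb.integrable_sq,
    integral_add hV.integrable_sq (i1.const_mul 2), integral_const_mul, h0]
  have : 0 ≤ ∫ p : X × A, (M.actInner M.muStar p.1 - M.actInner h p.1) ^ 2 ∂M.pairLaw :=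
    integral_nonneg fun _ => sq_nonneg _
  linarith

end Score

end ObsModel

/-! ### Empirical processes along measurable selections. -/

/-- The truncated square, a smooth surrogate of an indicator. -/
def truncSq (a : ℝ) : ℝ := min 1 ((a / 2) ^ 2)

theorem truncSq_nonneg (a : ℝ) : 0 ≤ truncSq a := le_min zero_le_one (sq_nonneg _)

theorem truncSq_le_one (a : ℝ) : truncSq a ≤ 1 := min_le_left _ _

theorem abs_truncSq_le (a : ℝ) : |truncSq a| ≤ 1 := by
  rw [abs_of_nonneg (truncSq_nonneg a)]; exact truncSq_le_one a

theorem measurable_truncSq : Measurable truncSq :=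
  measurable_const.min ((measurable_id.div_const 2).pow_const 2)

/-- `truncSq a` is the square of `min 1 |a/2|`: squaring is 2-Lipschitz on `[0, 1]`, and halving the
argument compensates. -/
theorem abs_truncSq_sub_le (a b : ℝ) : |truncSq a - truncSq b| ≤ |a - b| := by
  have h : ∀ x, truncSq x = (min 1 |x / 2|) ^ 2 := fun x => by
    rw [truncSq]
    rcases le_total 1 |x / 2| with h | h
    · rw [min_eq_left h, min_eq_left (by rw [← sq_abs]; nlinarith)]; norm_num
    · rw [min_eq_right h, sq_abs, min_eq_right (by rw [← sq_abs]; nlinarith [abs_nonneg (x / 2)])]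
  rw [h, h, sq_sub_sq, abs_mul]
  have h1 : |min 1 |a / 2| + min 1 (|b / 2|)| ≤ 2 := by
    rw [abs_of_nonneg (by positivity)]
    linarith [min_le_left 1 |a / 2|, min_le_left 1 |b / 2|]
  have h2 : |min 1 |a / 2| - min 1 (|b / 2|)| ≤ |a - b| / 2 := by
    have e1 := abs_min_sub_min_le_max 1 |a / 2| 1 |b / 2|
    have e2 := abs_abs_sub_abs_le (a / 2) (b / 2)
    rw [sub_self, abs_zero, max_eq_right (abs_nonneg _)] at e1
    have e3 : |a / 2 - b / 2| = |a - b| / 2 := by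
      rw [← sub_div, abs_div, abs_two]
    linarith
  nlinarith [abs_nonneg (min 1 |a / 2| - min 1 (|b / 2|)),
    abs_nonneg (min 1 |a / 2| + min 1 (|b / 2|))]

theorem le_outerExp {α : Type*} [MeasurableSpace α] {μ : Measure α} {f : α → ℝ≥0∞} {c : ℝ≥0∞}
    (h : ∀ G, Measurable G → f ≤ G → c ≤ ∫⁻ x, G x ∂μ) : c ≤ outerExp μ f :=
  le_iInf fun G => le_iInf fun hG => le_iInf fun hf => h G hG hf

namespace ObsModel

variable {X A : Type*} [MeasurableSpace X] [MeasurableSpace A] (M : ObsModel X A)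

/-- A jointly measurable choice, by the sample, of a member of the class `H`. -/
structure IsSelection {m : ℕ} (H : Set (X × A → ℝ)) (f : (Fin m → Obs X A) → X × A → ℝ) :
    Prop where
  measurable : Measurable fun q : (Fin m → Obs X A) × (X × A) => f q.1 q.2
  mem : ∀ z, f z ∈ H

theorem IsSelection.measurable_apply {m : ℕ} {H : Set (X × A → ℝ)}
    {f : (Fin m → Obs X A) → X × A → ℝ} (hf : IsSelection H f) (z : Fin m → Obs X A) :
    Measurable (f z) := hf.measurable.comp measurable_prodMk_left

theorem measurable_wnorm {α : Type*} [MeasurableSpace α] {f : α → X × A → ℝ}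
    (hf : Measurable fun q : α × (X × A) => f q.1 q.2) : Measurable fun z => M.wnorm (f z) := by
  have h1 : Measurable fun z => M.wnorm (f z) ^ 2 := by
    simp only [wnorm_sq]
    exact (hf.pow_const 2).ennreal_ofReal.lintegral_prod_right'
  have h2 : ∀ z, M.wnorm (f z) = (M.wnorm (f z) ^ 2) ^ (1 / 2 : ℝ) := fun z => by
    rw [← ENNReal.rpow_natCast, ← ENNReal.rpow_mul]; norm_num
  rw [funext h2]
  exact h1.pow_const _

/-- Symmetrization of the weighted noise, for a selection from a class. -/
theorem lintegral_noise_selection_le {m : ℕ} (hv : M.effVar ≠ ∞) {H : Set (X × A → ℝ)}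
    (hH : ∀ h ∈ H, M.wnorm h ≠ ∞) {f : (Fin m → Obs X A) → X × A → ℝ} (hf : IsSelection H f) :
    ∫⁻ z, ENNReal.ofReal (((1 / (m : ℝ)) * ∑ i, M.ratio (z i).1 ^ 2 *
      ((z i).2 - M.muStar (z i).1) * f z (z i).1) ^ 2) ∂M.sampleLaw m ≤
      4 * M.noiseComplexitySq m H := by
  -- The factor 4 is moved across so that the outer expectation can be bounded one measurable
  -- majorant at a time.
  rw [mul_comm, ← ENNReal.div_le_iff_le_mul (by simp) (by simp)]
  refine le_outerExp fun G hG hfG => ?_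
  rw [ENNReal.div_le_iff_le_mul (by simp) (by simp), mul_comm]
  rw [signedSampleLaw, lintegral_prod_rademacher _ hG]
  set k : (Fin m → Obs X A) → Obs X A → ℝ := fun z o =>
    M.noise o * ((1 / (m : ℝ)) * (M.ratio o.1 * f z o.1))
  have hki : ∀ z, Integrable (k z) M.obsLaw := fun z =>
    (M.memLp_noise hv).integrable_mul (((M.memLp_ratio_mul (hf.measurable_apply z)
      (hH _ (hf.mem z))).const_mul (1 / (m : ℝ))).comp_measurePreserving M.measurePreserving_pair)
  have hk : Measurable fun q : (Fin m → Obs X A) × Obs X A => k q.1 q.2 :=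
    (M.measurable_noise.comp measurable_snd).mul
      (((M.measurable_ratio.comp measurable_snd.fst).mul
        (hf.measurable.comp (measurable_fst.prodMk measurable_snd.fst))).const_mul _)
  have hk0 : ∀ z, ∫ o, k z o ∂M.obsLaw = 0 := fun z =>
    M.integral_noise_mul (k := fun p => (1 / (m : ℝ)) * (M.ratio p * f z p)) (hki z)
  have hGm : ∀ e : Fin m → Bool, Measurable fun z => G (z, fun i => boolSign (e i)) := fun e =>
    hG.comp measurable_prodMk_right
  refine le_trans (le_of_eq (lintegral_congr fun z => ?_)) (lintegral_sq_sum_selection_le hk hki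
    hk0 hGm fun z z₀ e => ?_)
  · rw [Finset.mul_sum]
    congr 3 with i
    simp only [k, noise]; ring
  · refine le_trans (le_of_eq ?_) ((le_iSup₂ (f := fun (h : X × A → ℝ) (_ : h ∈ H) =>
      ENNReal.ofReal (((1 / (m : ℝ)) * ∑ i, boolSign (e i) * M.ratio (z i).1 ^ 2 *
      ((z i).2 - M.muStar (z i).1) * h (z i).1) ^ 2)) (f z₀) (hf.mem z₀)).trans
      (hfG (z, fun i => boolSign (e i))))
    rw [Finset.mul_sum]
    congr 3 with i
    simp only [k, noise]; ring

/-- The deviation of the truncated second moment of a selection from its expectation. -/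
def truncDev {m : ℕ} (a : ℝ) (f : (Fin m → Obs X A) → X × A → ℝ) (z : Fin m → Obs X A) : ℝ :=
  ∫ o, truncSq (a * (M.ratio o.1 * f z o.1)) ∂M.obsLaw -
    (1 / (m : ℝ)) * ∑ i, truncSq (a * (M.ratio (z i).1 * f z (z i).1))

section TruncDev

variable {m : ℕ} {H : Set (X × A → ℝ)} {f : (Fin m → Obs X A) → X × A → ℝ}

theorem measurable_ratio_selection (hf : IsSelection H f) (a : ℝ) :
    Measurable fun q : (Fin m → Obs X A) × Obs X A => a * (M.ratio q.2.1 * f q.1 q.2.1) :=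
  ((M.measurable_ratio.comp measurable_snd.fst).mul
    (hf.measurable.comp (measurable_fst.prodMk measurable_snd.fst))).const_mul a

theorem measurable_truncDev (hf : IsSelection H f) (a : ℝ) : Measurable (M.truncDev a f) := by
  have h : Measurable fun q : (Fin m → Obs X A) × Obs X A =>
      truncSq (a * (M.ratio q.2.1 * f q.1 q.2.1)) :=
    measurable_truncSq.comp (M.measurable_ratio_selection hf a)
  have h1 : Measurable fun z : Fin m → Obs X A =>
      ∫ o, truncSq (a * (M.ratio o.1 * f z o.1)) ∂M.obsLaw :=
    h.stronglyMeasurable.integral_prod_right'.measurable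
  have h2 : ∀ i, Measurable fun z : Fin m → Obs X A =>
      truncSq (a * (M.ratio (z i).1 * f z (z i).1)) := fun i => by
    have h2 : Measurable fun z : Fin m → Obs X A => (z, z i) :=
      measurable_id.prodMk (measurable_pi_apply i)
    have h5 := h.comp h2
    simpa only [Function.comp_def] using h5
  have h3 : Measurable fun z : Fin m → Obs X A =>
      (1 / (m : ℝ)) * ∑ i, truncSq (a * (M.ratio (z i).1 * f z (z i).1)) :=
    (Finset.measurable_sum _ fun i _ => h2 i).const_mul _
  exact h1.sub h3

theorem truncDev_congr {g : (Fin m → Obs X A) → X × A → ℝ} {z : Fin m → Obs X A} (h : f z = g z)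
    (a : ℝ) : M.truncDev a f z = M.truncDev a g z := by
  rw [truncDev, truncDev, h]

theorem abs_truncDev_le (hm : 0 < m) (a : ℝ) (z : Fin m → Obs X A) : |M.truncDev a f z| ≤ 1 := by
  have hm' : (0 : ℝ) < m := Nat.cast_pos.2 hm
  have h1 : 0 ≤ ∫ o, truncSq (a * (M.ratio o.1 * f z o.1)) ∂M.obsLaw :=
    integral_nonneg fun _ => truncSq_nonneg _
  have h2 : ∫ o, truncSq (a * (M.ratio o.1 * f z o.1)) ∂M.obsLaw ≤ 1 :=
    (le_abs_self _).trans (abs_integral_le_of_abs_le fun _ => abs_truncSq_le _)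
  have h3 : 0 ≤ (1 / (m : ℝ)) * ∑ i, truncSq (a * (M.ratio (z i).1 * f z (z i).1)) :=
    mul_nonneg (by positivity) (Finset.sum_nonneg fun _ _ => truncSq_nonneg _)
  have h4 : (1 / (m : ℝ)) * ∑ i, truncSq (a * (M.ratio (z i).1 * f z (z i).1)) ≤ 1 := by
    rw [one_div, inv_mul_le_iff₀ hm', mul_one]
    refine (Finset.sum_le_sum fun i _ => truncSq_le_one _).trans ?_
    simp
  rw [truncDev, abs_le]
  constructor <;> linarith

/-- Symmetrization costs the factor 2, contraction removes `truncSq`, and the scale `a` comes out of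
the resulting linear process. -/
theorem integral_truncDev_le (hm : 0 < m) (hf : IsSelection H f) {a B : ℝ} (ha : 0 < a)
    (hB0 : 0 ≤ B) (hB : M.rademacherComplexity m H ≤ ENNReal.ofReal B) :
    ∫ z, M.truncDev a f z ∂M.sampleLaw m ≤ 2 * a * B := by
  have hm' : (0 : ℝ) < m := Nat.cast_pos.2 hm
  suffices h : ENNReal.ofReal ((∫ z, M.truncDev a f z ∂M.sampleLaw m) / (2 * a)) ≤
      M.rademacherComplexity m H by
    have := (ENNReal.ofReal_le_ofReal_iff hB0).1 (h.trans hB)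
    rwa [div_le_iff₀ (by positivity), mul_comm] at this
  refine le_outerExp fun G hG hfG => ?_
  rcases eq_or_ne (∫⁻ q, G q ∂M.signedSampleLaw m) ∞ with htop | hfin
  · rw [htop]; exact le_top
  rw [← ENNReal.ofReal_toReal hfin]
  refine ENNReal.ofReal_le_ofReal ?_
  have hc : (0 : ℝ) ≤ a * m := by positivity
  set G' : (Fin m → Obs X A) → (Fin m → Bool) → ℝ≥0∞ := fun z e =>
    ENNReal.ofReal (a * m) * G (z, fun i => boolSign (e i))
  have hG' : ∀ e, Measurable fun z => G' z e := fun e =>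
    (hG.comp measurable_prodMk_right).const_mul _
  have havg : signAverage (M.sampleLaw m) G' =
      ENNReal.ofReal (a * m) * ∫⁻ q, G q ∂M.signedSampleLaw m := by
    rw [signedSampleLaw, lintegral_prod_rademacher _ hG, signAverage, signAverage]
    simp only [G']
    simp_rw [lintegral_const_mul' _ _ (ENNReal.ofReal_ne_top (r := a * m))]
    rw [← Finset.mul_sum]
    ring
  have h := integral_sum_selection_le (ν := M.obsLaw)
    (u := fun z o => a * (M.ratio o.1 * f z o.1)) (M.measurable_ratio_selection hf a)
    measurable_truncSq abs_truncSq_le abs_truncSq_sub_le hG' (fun z z₀ e => by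
      refine le_trans ?_ (mul_le_mul_right (le_trans (le_iSup₂ (f := fun (h : X × A → ℝ)
        (_ : h ∈ H) => ENNReal.ofReal ((1 / (m : ℝ)) * ∑ i, boolSign (e i) * M.ratio (z i).1 *
        h (z i).1)) (f z₀) (hf.mem z₀)) (hfG (z, fun i => boolSign (e i)))) _)
      rw [← ENNReal.ofReal_mul hc]
      refine ENNReal.ofReal_le_ofReal (le_of_eq ?_)
      rw [← mul_assoc, mul_one_div, mul_div_assoc, div_self hm'.ne', mul_one, Finset.mul_sum]
      exact Finset.sum_congr rfl fun i _ => by ring)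
    (by change signAverage (M.sampleLaw m) G' ≠ ∞
        rw [havg]; exact ENNReal.mul_ne_top ENNReal.ofReal_ne_top hfin)
  change ∫ z, _ ∂M.sampleLaw m ≤ 2 * (signAverage (M.sampleLaw m) G').toReal at h
  rw [havg, ENNReal.toReal_mul, ENNReal.toReal_ofReal hc] at h
  have h2 : ∀ z, M.truncDev a f z = (1 / (m : ℝ)) * ∑ i,
      ((∫ o, truncSq (a * (M.ratio o.1 * f z o.1)) ∂M.obsLaw) -
        truncSq (a * (M.ratio (z i).1 * f z (z i).1))) := fun z => by
    rw [truncDev, Finset.sum_sub_distrib, mul_sub]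
    simp [hm'.ne']
  simp only [h2]
  rw [integral_const_mul, div_le_iff₀ (by positivity), one_div, inv_mul_le_iff₀ hm']
  refine h.trans (le_of_eq ?_)
  ring

/-- Uniform concentration of truncated second moments, for selections from a class. -/
theorem measure_truncDev_ge_le (hm : 0 < m) (hf : IsSelection H f) {a B t : ℝ} (ha : 0 < a)
    (hB0 : 0 ≤ B) (hB : M.rademacherComplexity m H ≤ ENNReal.ofReal B) (ht : 0 < t) :
    M.sampleLaw m {z | 2 * a * B + t ≤ M.truncDev a f z} ≤
      ENNReal.ofReal (Real.exp (-(2 * m * t ^ 2))) := by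
  have hm' : (0 : ℝ) < m := Nat.cast_pos.2 hm
  refine measure_ge_le_of_family (ν := M.obsLaw) hm
    (S := {V | ∃ f : (Fin m → Obs X A) → X × A → ℝ, IsSelection H f ∧ V = M.truncDev a f})
    ?_ (K := 1) ht ?_ ?_ ?_ ?_ ⟨f, hf, rfl⟩
  · rintro _ ⟨f, hf, rfl⟩; exact M.measurable_truncDev hf a
  · rintro _ ⟨f, hf, rfl⟩; exact M.abs_truncDev_le hm a
  · classical
    rintro _ ⟨f, hf, rfl⟩ _ ⟨g, hg, rfl⟩
    -- The maximum of two deviations is the deviation of the selection that takes the worse of the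
    -- two functions at each sample.
    refine ⟨fun z => if M.truncDev a g z ≤ M.truncDev a f z then f z else g z, ⟨?_, fun z => ?_⟩,
      funext fun z => ?_⟩
    · have hs : MeasurableSet {q : (Fin m → Obs X A) × (X × A) |
          M.truncDev a g q.1 ≤ M.truncDev a f q.1} :=
        measurableSet_le ((M.measurable_truncDev hg a).comp measurable_fst)
          ((M.measurable_truncDev hf a).comp measurable_fst)
      have he : (fun q : (Fin m → Obs X A) × (X × A) =>
          (if M.truncDev a g q.1 ≤ M.truncDev a f q.1 then f q.1 else g q.1) q.2) =
          fun q => if M.truncDev a g q.1 ≤ M.truncDev a f q.1 then f q.1 q.2 else g q.1 q.2 := by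
        funext q; split_ifs <;> rfl
      rw [he]
      exact Measurable.ite hs hf.measurable hg.measurable
    · split_ifs
      exacts [hf.mem z, hg.mem z]
    · by_cases h : M.truncDev a g z ≤ M.truncDev a f z
      · rw [max_eq_left h]
        exact M.truncDev_congr (if_pos h).symm a
      · rw [max_eq_right (not_le.1 h).le]
        exact M.truncDev_congr (if_neg h).symm a
  · rintro _ ⟨f, hf, rfl⟩; exact M.integral_truncDev_le hm hf ha hB0 hB
  · rintro _ ⟨f, hf, rfl⟩ i y
    -- Selecting from the altered sample is again a selection. With the function held fixed, only
    -- the `i`-th summand changes, by at most `1 / m`.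
    refine ⟨_, ⟨fun z => f (Function.update z i y), ⟨?_, fun z => hf.mem _⟩, rfl⟩, fun z => ?_⟩
    · exact hf.measurable.comp (Measurable.prodMk
        (measurable_update'.comp (measurable_fst.prodMk measurable_const)) measurable_snd)
    · set h := f (Function.update z i y)
      have key : ∑ j, truncSq (a * (M.ratio (z j).1 * h (z j).1)) ≤
          ∑ j, truncSq (a * (M.ratio (Function.update z i y j).1 *
            h (Function.update z i y j).1)) + 1 := by
        rw [← Finset.add_sum_erase _ _ (Finset.mem_univ i), ← Finset.add_sum_erase
          (f := fun j => truncSq (a * (M.ratio (Function.update z i y j).1 *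
            h (Function.update z i y j).1))) _ (Finset.mem_univ i)]
        have h1 : ∑ j ∈ Finset.univ.erase i, truncSq (a * (M.ratio (z j).1 * h (z j).1)) =
            ∑ j ∈ Finset.univ.erase i, truncSq (a * (M.ratio (Function.update z i y j).1 *
              h (Function.update z i y j).1)) :=
          Finset.sum_congr rfl fun j hj => by
            rw [Function.update_of_ne (Finset.ne_of_mem_erase hj)]
        rw [h1]
        linarith [truncSq_le_one (a * (M.ratio (z i).1 * h (z i).1)),
          truncSq_nonneg (a * (M.ratio (Function.update z i y i).1 *
            h (Function.update z i y i).1))]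
      have := mul_le_mul_of_nonneg_left key (show (0 : ℝ) ≤ 1 / m by positivity)
      rw [truncDev, truncDev]
      linarith

end TruncDev

end ObsModel

/-! ### Deterministic analysis of least squares. -/

namespace ObsModel

variable {X A : Type*} [MeasurableSpace X] [MeasurableSpace A] (M : ObsModel X A)

/-- The empirical weighted second moment of a function. -/
def empSq {m : ℕ} (z : Fin m → Obs X A) (h : X × A → ℝ) : ℝ :=
  (1 / (m : ℝ)) * ∑ i, (M.ratio (z i).1 * h (z i).1) ^ 2

/-- The empirical inner product of a function with the weighted noise. -/
def empNoise {m : ℕ} (z : Fin m → Obs X A) (h : X × A → ℝ) : ℝ :=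
  (1 / (m : ℝ)) * ∑ i, M.ratio (z i).1 ^ 2 * ((z i).2 - M.muStar (z i).1) * h (z i).1

theorem empSq_const_mul {m : ℕ} (z : Fin m → Obs X A) (c : ℝ) (h : X × A → ℝ) :
    M.empSq z (fun p => c * h p) = c ^ 2 * M.empSq z h := by
  simp only [empSq, Finset.mul_sum]
  exact Finset.sum_congr rfl fun i _ => by ring

theorem empNoise_const_mul {m : ℕ} (z : Fin m → Obs X A) (c : ℝ) (h : X × A → ℝ) :
    M.empNoise z (fun p => c * h p) = c * M.empNoise z h := by
  simp only [empNoise, Finset.mul_sum]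
  exact Finset.sum_congr rfl fun i _ => by ring

/-- The basic inequality of least squares. -/
theorem empSq_sub_le_of_empLoss_le {m : ℕ} {z : Fin m → Obs X A} {f μ : X × A → ℝ}
    (h : M.empLoss z f ≤ M.empLoss z μ) :
    M.empSq z (f - μ) ≤ 4 * M.empNoise z (f - μ) + 4 * M.empSq z (μ - M.muStar) := by
  have key : M.empSq z (f - μ) / 2 - 2 * M.empNoise z (f - μ) - 2 * M.empSq z (μ - M.muStar) ≤
      M.empLoss z f - M.empLoss z μ := by
    have e : M.empSq z (f - μ) / 2 - 2 * M.empNoise z (f - μ) - 2 * M.empSq z (μ - M.muStar) =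
        (1 / (m : ℝ)) * ∑ i, ((M.ratio (z i).1 * (f - μ) (z i).1) ^ 2 / 2 -
          2 * (M.ratio (z i).1 ^ 2 * ((z i).2 - M.muStar (z i).1) * (f - μ) (z i).1) -
          2 * (M.ratio (z i).1 * (μ - M.muStar) (z i).1) ^ 2) := by
      rw [empSq, empSq, empNoise, Finset.sum_sub_distrib, Finset.sum_sub_distrib,
        ← Finset.sum_div, ← Finset.mul_sum, ← Finset.mul_sum]
      ring
    rw [e, empLoss, empLoss, ← mul_sub, ← Finset.sum_sub_distrib]
    refine mul_le_mul_of_nonneg_left (Finset.sum_le_sum fun i _ => ?_) (by positivity)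
    simp only [Pi.sub_apply]
    -- With `u = (g/π)(f - μ)` and `v = (g/π)(μ - μ*)`, the claim is `u²/2 + 2uv + 2v² = (u + 2v)²/2
    -- ≥ 0`.
    nlinarith [sq_nonneg (M.ratio (z i).1 * (f (z i).1 - μ (z i).1) +
      2 * (M.ratio (z i).1 * (μ (z i).1 - M.muStar (z i).1)))]
  linarith

theorem wnorm_const_mul (c : ℝ) (h : X × A → ℝ) :
    M.wnorm (fun p => c * h p) = ENNReal.ofReal |c| * M.wnorm h := by
  have := eLpNorm_const_smul c h 2 M.omegaMeasure
  rwa [← ofReal_norm, Real.norm_eq_abs] at this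

section Shrink

variable {m : ℕ} {F : Set (X × A → ℝ)} {μ : X × A → ℝ} {f : (Fin m → Obs X A) → X × A → ℝ}

/-- The factor that brings `h` into the ball of radius `t`. -/
def shrinkFactor (t : ℝ) (h : X × A → ℝ) : ℝ :=
  if (M.wnorm h).toReal ≤ t then 1 else t / (M.wnorm h).toReal

/-- The deviation of a selection from `μ`, scaled into the ball of radius `t`. -/
def shrink (t : ℝ) (μ : X × A → ℝ) (f : (Fin m → Obs X A) → X × A → ℝ) (z : Fin m → Obs X A)
    (p : X × A) : ℝ := M.shrinkFactor t (f z - μ) * (f z - μ) p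

theorem shrinkFactor_mem {t : ℝ} (ht : 0 ≤ t) (h : X × A → ℝ) :
    0 ≤ M.shrinkFactor t h ∧ M.shrinkFactor t h ≤ 1 := by
  rw [shrinkFactor]
  split_ifs with hle
  · exact ⟨zero_le_one, le_rfl⟩
  · have h0 : t < (M.wnorm h).toReal := not_le.1 hle
    exact ⟨div_nonneg ht (ht.trans h0.le), div_le_one_of_le₀ h0.le (ht.trans h0.le)⟩

theorem wnorm_shrink_le {t : ℝ≥0} {h : X × A → ℝ} (hn : M.wnorm h ≠ ∞) :
    M.wnorm (fun p => M.shrinkFactor t h * h p) ≤ t := by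
  rw [wnorm_const_mul, abs_of_nonneg (M.shrinkFactor_mem t.coe_nonneg h).1, ← ENNReal.ofReal_toReal hn,
    ← ENNReal.ofReal_mul (M.shrinkFactor_mem t.coe_nonneg h).1, ← ENNReal.ofReal_coe_nnreal]
  refine ENNReal.ofReal_le_ofReal ?_
  rw [shrinkFactor]
  split_ifs with hle
  · rwa [one_mul]
  · have h0 : (t : ℝ) < (M.wnorm h).toReal := not_le.1 hle
    rw [div_mul_cancel₀ _ (t.coe_nonneg.trans_lt h0).ne']

theorem measurable_sub_selection (hμ : Measurable μ) (hf : IsSelection F f) :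
    Measurable fun q : (Fin m → Obs X A) × (X × A) => (f q.1 - μ) q.2 :=
  hf.measurable.sub (hμ.comp measurable_snd)

/-- Convexity enters here: scaling `f - μ` by a factor in `[0, 1]` moves `f` towards `μ` within `F`.
Complexities at a single radius thereby control all larger deviations. -/
theorem isSelection_shrink (hF : Convex ℝ F) (hFm : ∀ f ∈ F, Measurable f)
    (hFn : ∀ f ∈ F, M.wnorm f ≠ ∞) (hμ : μ ∈ F) (hf : IsSelection F f) (t : ℝ≥0) :
    IsSelection (M.localClass F μ t) (M.shrink t μ f) := by
  have hsub := measurable_sub_selection (hFm μ hμ) hf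
  have hN : Measurable fun z => (M.wnorm (f z - μ)).toReal := (M.measurable_wnorm hsub).ennreal_toReal
  have hc : Measurable fun z => M.shrinkFactor t (f z - μ) :=
    Measurable.ite (measurableSet_le hN measurable_const) measurable_const
      (measurable_const.div hN)
  refine ⟨(hc.comp measurable_fst).mul hsub, fun z => ⟨?_, M.wnorm_shrink_le
    (M.wnorm_sub_ne_top (hFm _ (hf.mem z)) (hFn _ (hf.mem z)) (hFm _ hμ) (hFn _ hμ))⟩⟩
  obtain ⟨h0, h1⟩ := M.shrinkFactor_mem t.coe_nonneg (f z - μ)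
  refine ⟨_, hF (hf.mem z) hμ h0 (sub_nonneg.2 h1) (by ring), funext fun p => ?_⟩
  simp only [shrink, Pi.sub_apply, Pi.add_apply, Pi.smul_apply, smul_eq_mul]
  ring

/-- Outside the deviation event, the small-ball condition bounds the empirical norm from below. -/
theorem sq_wnorm_le_empSq {α₁ α₂ : ℝ} (hα₁ : 0 < α₁) (hm : 0 < m)
    (hFm : ∀ f ∈ F, Measurable f) (hFn : ∀ f ∈ F, M.wnorm f ≠ ∞) (hsb : M.SmallBall F α₁ α₂)
    (hμ : μ ∈ F) (hf : IsSelection F f) {r : ℝ≥0} (hr : 0 < r) {z : Fin m → Obs X A}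
    (hz : M.truncDev (2 / (α₁ * r)) (M.shrink r μ f) z < α₂ / 2)
    (hN : (r : ℝ) ≤ (M.wnorm (f z - μ)).toReal) :
    α₁ ^ 2 * α₂ / 2 * (M.wnorm (f z - μ)).toReal ^ 2 ≤ M.empSq z (f z - μ) := by
  set N := (M.wnorm (f z - μ)).toReal
  have hr' : (0 : ℝ) < r := hr
  have hN0 : 0 < N := hr'.trans_le hN
  have hm' : (0 : ℝ) < m := Nat.cast_pos.2 hm
  have hfm := hFm _ (hf.mem z)
  have hμm := hFm _ hμ
  have hnt := M.wnorm_sub_ne_top hfm (hFn _ (hf.mem z)) hμm (hFn _ hμ)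
  have hfac : M.shrinkFactor r (f z - μ) = r / N := by
    rw [shrinkFactor]
    split_ifs with h
    · have : N = r := le_antisymm h hN
      rw [this, div_self hr'.ne']
    · rfl
  have hsh : ∀ p, M.shrink r μ f z p = r / N * (f z p - μ p) := fun p => by
    rw [shrink, hfac, Pi.sub_apply]
  -- The scale `2 / (α₁ r)` makes the argument at least 2 in absolute value on the small-ball set,
  -- so `truncSq` equals 1 there.
  have hlow : α₂ ≤ ∫ o, truncSq (2 / (α₁ * r) * (M.ratio o.1 * M.shrink r μ f z o.1))
      ∂M.obsLaw := by
    set s : Set (X × A) := {p | α₁ * N ≤ |M.ratio p * (f z p - μ p)|}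
    have hs : MeasurableSet s := measurableSet_le measurable_const
      (M.measurable_ratio.mul (hfm.sub hμm)).abs
    have hs1 : ENNReal.ofReal α₂ ≤ M.pairLaw s := by
      refine (hsb _ (hf.mem z) _ hμ).trans (measure_mono fun p hp => ?_)
      have h1 : ENNReal.ofReal α₁ * M.wnorm (f z - μ) ≤
        ENNReal.ofReal |M.ratio p * (f z p - μ p)| := hp
      rw [← ENNReal.ofReal_toReal hnt, ← ENNReal.ofReal_mul hα₁.le,
        ENNReal.ofReal_le_ofReal_iff (abs_nonneg _)] at h1
      exact h1
    have hs2 : α₂ ≤ M.obsLaw.real (Prod.fst ⁻¹' s) := by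
      rw [measureReal_def, M.measurePreserving_pair.measure_preimage hs.nullMeasurableSet]
      exact (ENNReal.ofReal_le_iff_le_toReal (measure_ne_top _ _)).1 hs1
    refine hs2.trans ?_
    rw [← integral_indicator_one (measurable_fst hs)]
    have hmeas : Measurable fun o : Obs X A =>
        truncSq (2 / (α₁ * r) * (M.ratio o.1 * M.shrink r μ f z o.1)) := by
      have h1 : Measurable fun p => 2 / (α₁ * r) * (M.ratio p * M.shrink r μ f z p) := by
        simp only [hsh]
        exact (M.measurable_ratio.mul ((hfm.sub hμm).const_mul _)).const_mul _
      exact measurable_truncSq.comp (h1.comp measurable_fst)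
    refine integral_mono ((integrable_const (1 : ℝ)).indicator (measurable_fst hs))
      (integrable_of_abs_le hmeas fun _ => abs_truncSq_le _) fun o => ?_
    by_cases ho : o.1 ∈ s
    · rw [Set.indicator_of_mem (show o ∈ Prod.fst ⁻¹' s from ho)]
      have h1 : 1 ≤ (2 / (α₁ * r) * (M.ratio o.1 * M.shrink r μ f z o.1) / 2) ^ 2 := by
        have h2 : 2 / (α₁ * r) * (M.ratio o.1 * M.shrink r μ f z o.1) / 2 =
            M.ratio o.1 * (f z o.1 - μ o.1) / (α₁ * N) := by
          rw [hsh]; field_simp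
        rw [h2, ← sq_abs, abs_div, abs_of_pos (mul_pos hα₁ hN0)]
        exact one_le_pow₀ ((one_le_div (mul_pos hα₁ hN0)).2 ho)
      simp only [Pi.one_apply, truncSq]
      exact le_min le_rfl h1
    · rw [Set.indicator_of_notMem (show o ∉ Prod.fst ⁻¹' s from ho)]
      exact truncSq_nonneg _
  rw [truncDev] at hz
  -- Here the other side of the truncation is used: `truncSq x ≤ (x/2)²`, which undoes the scaling.
  have hup : (1 / (m : ℝ)) * ∑ i, truncSq (2 / (α₁ * r) *
      (M.ratio (z i).1 * M.shrink r μ f z (z i).1)) ≤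
      (1 / (α₁ * N)) ^ 2 * M.empSq z (f z - μ) := by
    rw [← empSq_const_mul, empSq]
    refine mul_le_mul_of_nonneg_left (Finset.sum_le_sum fun i _ => ?_) (by positivity)
    refine (min_le_right _ _).trans (le_of_eq ?_)
    rw [hsh, Pi.sub_apply]; field_simp
  have h2 : α₂ / 2 ≤ (1 / (α₁ * N)) ^ 2 * M.empSq z (f z - μ) := by linarith
  rw [div_pow, one_pow, one_div, inv_mul_eq_div, le_div_iff₀ (by positivity)] at h2
  calc _ = α₂ / 2 * (α₁ * N) ^ 2 := by ring
    _ ≤ _ := h2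

/-- Young's inequality: half of `κ N²` absorbs the term linear in `N`. -/
theorem sq_le_of_quadratic {N κ s W E : ℝ} (hκ : 0 < κ) (hs : 0 < s)
    (h : κ * N ^ 2 ≤ 4 * (N / s * W) + 4 * E) :
    N ^ 2 ≤ 16 / κ ^ 2 / s ^ 2 * W ^ 2 + 8 / κ * E := by
  have h1 : 4 * (N / s * W) ≤ κ / 2 * N ^ 2 + 8 / κ * (W / s) ^ 2 := by
    have h2 : κ / 2 * N ^ 2 + 8 / κ * (W / s) ^ 2 - 4 * (N / s * W) =
        κ / 2 * (N - 4 / κ * (W / s)) ^ 2 := by field_simp; ring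
    have h3 : 0 ≤ κ / 2 * (N - 4 / κ * (W / s)) ^ 2 := by positivity
    linarith
  have h4 : κ / 2 * N ^ 2 ≤ κ / 2 * (16 / κ ^ 2 / s ^ 2 * W ^ 2 + 8 / κ * E) := by
    have : κ / 2 * (16 / κ ^ 2 / s ^ 2 * W ^ 2 + 8 / κ * E) = 8 / κ * (W / s) ^ 2 + 4 * E := by
      field_simp; ring
    rw [this]; linarith
  exact le_of_mul_le_mul_left h4 (by positivity)

/-- Pointwise error bound for least squares outside the deviation event. -/
theorem sq_wnorm_le {α₁ α₂ : ℝ} (hα₁ : 0 < α₁) (hα₂ : 0 < α₂) (hm : 0 < m)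
    (hFm : ∀ f ∈ F, Measurable f) (hFn : ∀ f ∈ F, M.wnorm f ≠ ∞) (hsb : M.SmallBall F α₁ α₂)
    (hμ : μ ∈ F) (hf : IsSelection F f) {r s : ℝ≥0} (hr : 0 < r) (hs : 0 < s)
    {z : Fin m → Obs X A} (hmin : M.empLoss z (f z) ≤ M.empLoss z μ)
    (hz : M.truncDev (2 / (α₁ * r)) (M.shrink r μ f) z < α₂ / 2) :
    (M.wnorm (f z - μ)).toReal ^ 2 ≤ ((r : ℝ) ^ 2 + (s : ℝ) ^ 2) +
      (16 / (α₁ ^ 2 * α₂ / 2) ^ 2 / (s : ℝ) ^ 2 * M.empNoise z (M.shrink s μ f z) ^ 2 +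
      8 / (α₁ ^ 2 * α₂ / 2) * M.empSq z (μ - M.muStar)) := by
  set N := (M.wnorm (f z - μ)).toReal
  have hr' : (0 : ℝ) < r := hr
  have hs' : (0 : ℝ) < s := hs
  have hκ : 0 < α₁ ^ 2 * α₂ / 2 := by positivity
  have hE : 0 ≤ M.empSq z (μ - M.muStar) :=
    mul_nonneg (by positivity) (Finset.sum_nonneg fun _ _ => sq_nonneg _)
  have hpos : 0 ≤ 16 / (α₁ ^ 2 * α₂ / 2) ^ 2 / (s : ℝ) ^ 2 *
      M.empNoise z (M.shrink s μ f z) ^ 2 + 8 / (α₁ ^ 2 * α₂ / 2) * M.empSq z (μ - M.muStar) := by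
    positivity
  have hN0 : 0 ≤ N := ENNReal.toReal_nonneg
  -- Errors of norm at most `r` or `s` are already covered by `r² + s²`. Beyond both radii the
  -- small-ball bound and the exact rescaling of the noise by `N / s` are available.
  rcases lt_or_ge N r with h1 | h1
  · nlinarith
  rcases le_or_gt N s with h2 | h2
  · nlinarith
  have h3 := M.sq_wnorm_le_empSq hα₁ hm hFm hFn hsb hμ hf hr hz h1
  have h4 := M.empSq_sub_le_of_empLoss_le hmin
  have hfac : M.shrinkFactor s (f z - μ) = s / N := by
    rw [shrinkFactor, if_neg (not_le.2 h2)]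
  have h5 : M.empNoise z (M.shrink s μ f z) = s / N * M.empNoise z (f z - μ) := by
    rw [← hfac]
    exact M.empNoise_const_mul z _ _
  have h6 : M.empNoise z (f z - μ) = N / s * M.empNoise z (M.shrink s μ f z) := by
    have hN1 : N ≠ 0 := (hs'.trans h2).ne'
    rw [h5]; field_simp
  have h7 := sq_le_of_quadratic (N := N) (W := M.empNoise z (M.shrink s μ f z))
    (E := M.empSq z (μ - M.muStar)) hκ hs' (by rw [← h6]; linarith)
  have : 0 ≤ (r : ℝ) ^ 2 + (s : ℝ) ^ 2 := by positivity
  linarith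

theorem lintegral_empSq_le (hm : 0 < m) {h : X × A → ℝ} (hh : Measurable h) :
    ∫⁻ z, ENNReal.ofReal (M.empSq z h) ∂M.sampleLaw m ≤ M.wnorm h ^ 2 := by
  have hm' : (0 : ℝ) < m := Nat.cast_pos.2 hm
  have hk : Measurable fun p => ENNReal.ofReal ((M.ratio p * h p) ^ 2) :=
    ((M.measurable_ratio.mul hh).pow_const 2).ennreal_ofReal
  have hev : ∀ i : Fin m, MeasurePreserving (fun z : Fin m → Obs X A => (z i).1)
      (M.sampleLaw m) M.pairLaw := fun i =>
    M.measurePreserving_pair.comp (measurePreserving_eval (fun _ : Fin m => M.obsLaw) i)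
  have e : ∀ z : Fin m → Obs X A, ENNReal.ofReal (M.empSq z h) =
      ENNReal.ofReal (1 / (m : ℝ)) * ∑ i, ENNReal.ofReal ((M.ratio (z i).1 * h (z i).1) ^ 2) :=
    fun z => by
      rw [empSq, ENNReal.ofReal_mul (by positivity),
        ENNReal.ofReal_sum_of_nonneg fun _ _ => sq_nonneg _]
  have hki : ∀ i : Fin m, Measurable fun z : Fin m → Obs X A =>
      ENNReal.ofReal ((M.ratio (z i).1 * h (z i).1) ^ 2) := fun i => hk.comp (hev i).measurable
  have hint : ∀ i : Fin m, ∫⁻ z, ENNReal.ofReal ((M.ratio (z i).1 * h (z i).1) ^ 2)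
      ∂M.sampleLaw m = ∫⁻ p, ENNReal.ofReal ((M.ratio p * h p) ^ 2) ∂M.pairLaw := fun i =>
    (hev i).lintegral_comp hk
  simp only [e]
  rw [lintegral_const_mul' _ _ ENNReal.ofReal_ne_top, lintegral_finsetSum _ fun i _ => hki i]
  simp only [hint, Finset.sum_const, Finset.card_univ, Fintype.card_fin, nsmul_eq_mul]
  rw [← mul_assoc, ← ENNReal.ofReal_natCast, ← ENNReal.ofReal_mul (by positivity),
    one_div_mul_cancel hm'.ne', ENNReal.ofReal_one, one_mul]
  exact M.lintegral_ratio_mul_sq_le hh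

end Shrink

end ObsModel

/-! ### The oracle inequality for the first stage. -/

theorem ennreal_add_sq_le (a b : ℝ≥0∞) : (a + b) ^ 2 ≤ 2 * a ^ 2 + 2 * b ^ 2 := by
  have h := ENNReal.rpow_add_le_mul_rpow_add_rpow a b (p := 2) one_le_two
  norm_num at h
  rwa [mul_add] at h

/-- Passes from admissible radii to the critical radius, which need not be admissible itself. The
condition `g ∞ = ∞` covers the case of no admissible radius. -/
theorem le_apply_iInf_coe {g : ℝ≥0∞ → ℝ≥0∞} (hc : Continuous g) (hm : Monotone g)
    (htop : g ∞ = ∞) {p : ℝ≥0 → Prop} {L : ℝ≥0∞} (h : ∀ s : ℝ≥0, 0 < s → p s → L ≤ g s) :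
    L ≤ g (⨅ (s : ℝ≥0) (_ : 0 < s) (_ : p s), (s : ℝ≥0∞)) := by
  rw [hm.map_iInf_of_continuousAt hc.continuousAt htop]
  refine le_iInf fun s => ?_
  rw [Function.comp_apply, hm.map_iInf_of_continuousAt hc.continuousAt htop]
  refine le_iInf fun hs => ?_
  rw [Function.comp_apply, hm.map_iInf_of_continuousAt hc.continuousAt htop]
  exact le_iInf fun hp => h s hs hp

namespace ObsModel

variable {X A : Type*} [MeasurableSpace X] [MeasurableSpace A] (M : ObsModel X A)

variable {m : ℕ} {F : Set (X × A → ℝ)} {μ : X × A → ℝ} {f : (Fin m → Obs X A) → X × A → ℝ}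

theorem wnorm_sub_le_wdiam {G : Set (X × A → ℝ)} {f h : X × A → ℝ} (hf : f ∈ G) (hh : h ∈ G) :
    M.wnorm (f - h) ≤ M.wdiam G :=
  (le_iSup₂ (f := fun (h : X × A → ℝ) (_ : h ∈ G) => M.wnorm (f - h)) h hh).trans
    (le_iSup₂ (f := fun (f : X × A → ℝ) (_ : f ∈ G) => ⨆ h ∈ G, M.wnorm (f - h)) f hf)

theorem noiseComplexitySq_le {H : Set (X × A → ℝ)} {s : ℝ≥0} (hs : 0 < s)
    (h : M.noiseComplexity m H / s ≤ s) : M.noiseComplexitySq m H ≤ ENNReal.ofReal ((s : ℝ) ^ 4) := by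
  have hs' : (s : ℝ≥0∞) ≠ 0 := by exact_mod_cast hs.ne'
  rw [ENNReal.div_le_iff hs' ENNReal.coe_ne_top] at h
  have h1 : M.noiseComplexitySq m H = M.noiseComplexity m H ^ 2 := by
    rw [noiseComplexity, ← ENNReal.rpow_natCast, ← ENNReal.rpow_mul]; norm_num
  rw [h1, ENNReal.ofReal_pow s.coe_nonneg, ENNReal.ofReal_coe_nnreal]
  calc _ ≤ ((s : ℝ≥0∞) * s) ^ 2 := by gcongr
    _ = _ := by ring

theorem rademacherComplexity_le {H : Set (X × A → ℝ)} {r : ℝ≥0} (hr : 0 < r) {b : ℝ}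
    (h : M.rademacherComplexity m H / r ≤ ENNReal.ofReal b) :
    M.rademacherComplexity m H ≤ ENNReal.ofReal (r * b) := by
  have hr' : (r : ℝ≥0∞) ≠ 0 := by exact_mod_cast hr.ne'
  rw [ENNReal.div_le_iff hr' ENNReal.coe_ne_top] at h
  rwa [ENNReal.ofReal_mul r.coe_nonneg, ENNReal.ofReal_coe_nnreal, mul_comm]

theorem measurable_empSq {h : X × A → ℝ} (hh : Measurable h) :
    Measurable fun z : Fin m → Obs X A => M.empSq z h := by
  refine (Finset.measurable_sum _ fun i _ => ?_).const_mul _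
  exact (((M.measurable_ratio.mul hh).comp measurable_fst).comp (measurable_pi_apply i)).pow_const 2

/-- Error bound for least squares at a reference point and admissible radii. -/
theorem lintegral_wnorm_sub_sq_le {α₁ α₂ : ℝ} (hα₁ : 0 < α₁) (hα₂ : 0 < α₂) (hm : 0 < m)
    (hF : Convex ℝ F) (hFm : ∀ f ∈ F, Measurable f) (hFn : ∀ f ∈ F, M.wnorm f ≠ ∞)
    (hsb : M.SmallBall F α₁ α₂) (hv : M.effVar ≠ ∞)
    (hμ : μ ∈ F) (hf : IsSelection F f)
    (hmin : ∀ᵐ z ∂M.sampleLaw m, M.empLoss z (f z) ≤ M.empLoss z μ)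
    {r s : ℝ≥0} (hr : 0 < r) (hs : 0 < s)
    (hR : M.rademacherComplexity m (M.localClass F μ r) / r ≤ ENNReal.ofReal (α₁ * α₂ / 32))
    (hS : M.noiseComplexity m (M.localClass F μ s) / s ≤ s) :
    ∫⁻ z, M.wnorm (f z - μ) ^ 2 ∂M.sampleLaw m ≤
      ((r : ℝ≥0∞) ^ 2 + (s : ℝ≥0∞) ^ 2) +
      (ENNReal.ofReal (64 / (α₁ ^ 2 * α₂ / 2) ^ 2) * (s : ℝ≥0∞) ^ 2 +
      ENNReal.ofReal (8 / (α₁ ^ 2 * α₂ / 2)) * M.wnorm (μ - M.muStar) ^ 2) +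
      ENNReal.ofReal (Real.exp (-(α₂ ^ 2 / 16) * ((m + m : ℕ) : ℝ))) *
        M.wdiam (insert M.muStar F) ^ 2 := by
  set κ := α₁ ^ 2 * α₂ / 2
  set D := M.wdiam (insert M.muStar F)
  have hκ : 0 < κ := by positivity
  have hr' : (0 : ℝ) < r := hr
  have hs' : (0 : ℝ) < s := hs
  have hselR := M.isSelection_shrink hF hFm hFn hμ hf r
  have hselS := M.isSelection_shrink hF hFm hFn hμ hf s
  set bad : Set (Fin m → Obs X A) :=
    {z | α₂ / 2 ≤ M.truncDev (2 / (α₁ * r)) (M.shrink r μ f) z}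
  have hbadm : MeasurableSet bad := measurableSet_le measurable_const (M.measurable_truncDev hselR _)
  have hbad : M.sampleLaw m bad ≤
      ENNReal.ofReal (Real.exp (-(α₂ ^ 2 / 16) * ((m + m : ℕ) : ℝ))) := by
    -- The threshold `1/32` gives mean deviation `2 a B = α₂/8`. Adding `t = α₂/4` stays below
    -- `α₂/2`, and `2 m t² = (α₂²/16)(m + m)` is the exponential rate.
    have h := M.measure_truncDev_ge_le hm hselR (a := 2 / (α₁ * r)) (B := r * (α₁ * α₂ / 32))
      (t := α₂ / 4) (by positivity) (by positivity) (M.rademacherComplexity_le hr hR)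
      (by positivity)
    have e1 : -(2 * (m : ℝ) * (α₂ / 4) ^ 2) = -(α₂ ^ 2 / 16) * ((m + m : ℕ) : ℝ) := by
      push_cast; ring
    rw [e1] at h
    refine (measure_mono fun z hz => ?_).trans h
    have e2 : 2 * (2 / (α₁ * r)) * (r * (α₁ * α₂ / 32)) = α₂ / 8 := by field_simp; norm_num
    have hz' : α₂ / 2 ≤ M.truncDev (2 / (α₁ * r)) (M.shrink r μ f) z := hz
    simp only [Set.mem_ofPred_eq, e2]
    linarith
  have hHn : ∀ h ∈ M.localClass F μ s, M.wnorm h ≠ ∞ := fun h hh =>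
    ne_top_of_le_ne_top ENNReal.coe_ne_top hh.2
  have hnoise : ∫⁻ z, ENNReal.ofReal (M.empNoise z (M.shrink s μ f z) ^ 2) ∂M.sampleLaw m ≤
      4 * ENNReal.ofReal ((s : ℝ) ^ 4) :=
    (M.lintegral_noise_selection_le hv hHn hselS).trans (by
      gcongr; exact M.noiseComplexitySq_le hs hS)
  have hmE : Measurable fun z : Fin m → Obs X A => ENNReal.ofReal (M.empSq z (μ - M.muStar)) :=
    (M.measurable_empSq ((hFm μ hμ).sub M.measurable_muStar)).ennreal_ofReal
  set a := ENNReal.ofReal (16 / κ ^ 2 / (s : ℝ) ^ 2)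
  set b := ENNReal.ofReal (8 / κ)
  have hpt : ∀ᵐ z ∂M.sampleLaw m, M.wnorm (f z - μ) ^ 2 ≤
      (a * ENNReal.ofReal (M.empNoise z (M.shrink s μ f z) ^ 2)) +
      ((b * ENNReal.ofReal (M.empSq z (μ - M.muStar))) +
      (((r : ℝ≥0∞) ^ 2 + (s : ℝ≥0∞) ^ 2) + bad.indicator (fun _ => D ^ 2) z)) := by
    filter_upwards [hmin] with z hz
    have hnt := M.wnorm_sub_ne_top (hFm _ (hf.mem z)) (hFn _ (hf.mem z)) (hFm _ hμ) (hFn _ hμ)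
    by_cases hzb : z ∈ bad
    · rw [Set.indicator_of_mem hzb]
      refine le_trans ?_ (le_add_left (le_add_left le_add_self))
      gcongr
      exact M.wnorm_sub_le_wdiam (Set.mem_insert_of_mem _ (hf.mem z)) (Set.mem_insert_of_mem _ hμ)
    · rw [Set.indicator_of_notMem hzb, add_zero]
      have h := M.sq_wnorm_le hα₁ hα₂ hm hFm hFn hsb hμ hf hr hs hz (not_le.1 hzb)
      have h' := ENNReal.ofReal_le_ofReal h
      have hE : 0 ≤ M.empSq z (μ - M.muStar) :=
        mul_nonneg (by positivity) (Finset.sum_nonneg fun _ _ => sq_nonneg _)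
      rw [ENNReal.ofReal_pow ENNReal.toReal_nonneg, ENNReal.ofReal_toReal hnt,
        ENNReal.ofReal_add (by positivity) (by positivity),
        ENNReal.ofReal_add (by positivity) (by positivity),
        ENNReal.ofReal_add (by positivity) (by positivity),
        ENNReal.ofReal_mul (by positivity), ENNReal.ofReal_mul (by positivity),
        ENNReal.ofReal_pow r.coe_nonneg, ENNReal.ofReal_pow s.coe_nonneg,
        ENNReal.ofReal_coe_nnreal, ENNReal.ofReal_coe_nnreal] at h'
      refine h'.trans (le_of_eq ?_)
      simp only [a, b, κ]
      ring
  refine (lintegral_mono_ae hpt).trans ?_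
  have hm2 : Measurable fun z : Fin m → Obs X A =>
      ((r : ℝ≥0∞) ^ 2 + (s : ℝ≥0∞) ^ 2) + bad.indicator (fun _ => D ^ 2) z :=
    Measurable.const_add (measurable_const.indicator hbadm) _
  have hm3 : Measurable fun z : Fin m → Obs X A =>
      (b * ENNReal.ofReal (M.empSq z (μ - M.muStar))) +
      (((r : ℝ≥0∞) ^ 2 + (s : ℝ≥0∞) ^ 2) + bad.indicator (fun _ => D ^ 2) z) :=
    (hmE.const_mul b).add hm2
  rw [lintegral_add_right _ hm3, lintegral_add_right _ hm2,
    lintegral_const_mul' _ _ ENNReal.ofReal_ne_top, lintegral_const_mul' _ _ ENNReal.ofReal_ne_top,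
    lintegral_add_left measurable_const, lintegral_const, measure_univ, mul_one,
    lintegral_indicator_const hbadm]
  -- Admissibility of `s` gives `S² ≤ s⁴`, and the rescaling contributed `1 / s²`; what remains is
  -- of order `s²`.
  have h1 : a * (4 * ENNReal.ofReal ((s : ℝ) ^ 4)) =
      ENNReal.ofReal (64 / κ ^ 2) * (s : ℝ≥0∞) ^ 2 := by
    rw [← ENNReal.ofReal_coe_nnreal, ← ENNReal.ofReal_pow s.coe_nonneg,
      ← ENNReal.ofReal_mul (by positivity), ← ENNReal.ofReal_ofNat 4,
      ← ENNReal.ofReal_mul (by positivity), ← ENNReal.ofReal_mul (by positivity)]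
    congr 1
    field_simp
    norm_num
  calc _ ≤ a * (4 * ENNReal.ofReal ((s : ℝ) ^ 4)) + (b * M.wnorm (μ - M.muStar) ^ 2 +
        (((r : ℝ≥0∞) ^ 2 + (s : ℝ≥0∞) ^ 2) + D ^ 2 *
        ENNReal.ofReal (Real.exp (-(α₂ ^ 2 / 16) * ((m + m : ℕ) : ℝ))))) := by
        gcongr
        exact M.lintegral_empSq_le hm ((hFm μ hμ).sub M.measurable_muStar)
    _ = _ := by rw [h1]; ring

/-- The constant in the error bound for least squares. -/
def errorConst (α₁ α₂ : ℝ) : ℝ :=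
  2 * (1 + 64 / (α₁ ^ 2 * α₂ / 2) ^ 2 + 8 / (α₁ ^ 2 * α₂ / 2)) + 2

theorem errorConst_pos {α₁ α₂ : ℝ} (hα₁ : 0 < α₁) (hα₂ : 0 < α₂) : 0 < errorConst α₁ α₂ := by
  unfold errorConst; positivity

/-- A least-squares estimate agrees almost surely with a selection that minimizes the loss. -/
theorem IsLeastSquares.exists_selection {M : ObsModel X A} (hf : M.IsLeastSquares F m f)
    (hFm : ∀ f ∈ F, Measurable f) (hμ : μ ∈ F) :
    ∃ g : (Fin m → Obs X A) → X × A → ℝ, IsSelection F g ∧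
      (∀ᵐ z ∂M.sampleLaw m, g z = f z) ∧
      ∀ᵐ z ∂M.sampleLaw m, M.empLoss z (g z) ≤ M.empLoss z μ := by
  classical
  obtain ⟨s, hsub, hs, hs0⟩ := exists_measurable_superset_of_null (ae_iff.1 hf.isMin)
  have hgood : ∀ z, z ∉ s → f z ∈ F ∧ IsMinOn (M.empLoss z) F (f z) := fun z hz => by
    by_contra h
    exact hz (hsub h)
  have hae : ∀ᵐ z ∂M.sampleLaw m, z ∉ s := measure_eq_zero_iff_ae_notMem.1 hs0
  -- A selection must lie in `F` at every sample, so the estimate is replaced by `μ` on a measurable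
  -- null set.
  refine ⟨fun z => if z ∈ s then μ else f z, ⟨?_, fun z => ?_⟩, ?_, ?_⟩
  · have he : (fun q : (Fin m → Obs X A) × (X × A) => (if q.1 ∈ s then μ else f q.1) q.2) =
        fun q => if q.1 ∈ s then μ q.2 else f q.1 q.2 := by
      funext q; split_ifs <;> rfl
    rw [he]
    exact Measurable.ite (measurable_fst hs) ((hFm μ hμ).comp measurable_snd) hf.measurable
  · split_ifs with h
    exacts [hμ, (hgood z h).1]
  · filter_upwards [hae] with z hz
    exact if_neg hz
  · filter_upwards [hae] with z hz
    rw [if_neg hz]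
    exact (hgood z hz).2 hμ

/-- The oracle inequality for weighted least squares. -/
theorem IsLeastSquares.lintegral_wnorm_sub_muStar_le {M : ObsModel X A}
    (hf : M.IsLeastSquares F m f) {α₁ α₂ : ℝ} (hα₁ : 0 < α₁) (hα₂ : 0 < α₂) (hm : 0 < m)
    (hF : Convex ℝ F) (hFm : ∀ f ∈ F, Measurable f) (hFn : ∀ f ∈ F, M.wnorm f ≠ ∞)
    (hsb : M.SmallBall F α₁ α₂) (hv : M.effVar ≠ ∞) (hμ : μ ∈ F) :
    ∫⁻ z, M.wnorm (f z - M.muStar) ^ 2 ∂M.sampleLaw m ≤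
      ENNReal.ofReal (errorConst α₁ α₂) *
        (M.wnorm (μ - M.muStar) ^ 2 + M.estError F α₁ α₂ (α₂ ^ 2 / 16) m μ) := by
  have hC := errorConst_pos hα₁ hα₂
  have hC0 : ENNReal.ofReal (errorConst α₁ α₂) ≠ 0 := by simpa using hC
  obtain ⟨g, hg, hgf, hmin⟩ := hf.exists_selection hFm hμ
  have hle : ∀ s : ℝ≥0, 0 < s → M.noiseComplexity m (M.localClass F μ s) / s ≤ s →
      ∀ r : ℝ≥0, 0 < r →
      M.rademacherComplexity m (M.localClass F μ r) / r ≤ ENNReal.ofReal (α₁ * α₂ / 32) →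
      ∫⁻ z, M.wnorm (f z - M.muStar) ^ 2 ∂M.sampleLaw m ≤ ENNReal.ofReal (errorConst α₁ α₂) *
        (M.wnorm (μ - M.muStar) ^ 2 + ((s : ℝ≥0∞) ^ 2 + (r : ℝ≥0∞) ^ 2 +
        ENNReal.ofReal (Real.exp (-(α₂ ^ 2 / 16) * ((m + m : ℕ) : ℝ))) *
          M.wdiam (insert M.muStar F) ^ 2)) := by
    intro s hs hS r hr hR
    have h := M.lintegral_wnorm_sub_sq_le hα₁ hα₂ hm hF hFm hFn hsb hv hμ hg hmin hr hs hR hS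
    set E := ENNReal.ofReal (Real.exp (-(α₂ ^ 2 / 16) * ((m + m : ℕ) : ℝ))) *
          M.wdiam (insert M.muStar F) ^ 2
    set P := M.wnorm (μ - M.muStar) ^ 2
    have hconst : ENNReal.ofReal (errorConst α₁ α₂) =
        2 * (1 + ENNReal.ofReal (64 / (α₁ ^ 2 * α₂ / 2) ^ 2) +
          ENNReal.ofReal (8 / (α₁ ^ 2 * α₂ / 2))) + 2 := by
      rw [errorConst, ENNReal.ofReal_add (by positivity) (by positivity),
        ENNReal.ofReal_mul (by positivity), ENNReal.ofReal_add (by positivity) (by positivity),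
        ENNReal.ofReal_add (by positivity) (by positivity), ENNReal.ofReal_one,
        ENNReal.ofReal_ofNat]
    rw [hconst]
    set a := ENNReal.ofReal (64 / (α₁ ^ 2 * α₂ / 2) ^ 2)
    set b := ENNReal.ofReal (8 / (α₁ ^ 2 * α₂ / 2))
    calc ∫⁻ z, M.wnorm (f z - M.muStar) ^ 2 ∂M.sampleLaw m
        ≤ ∫⁻ z, (2 * M.wnorm (g z - μ) ^ 2 + 2 * P) ∂M.sampleLaw m := by
          refine lintegral_mono_ae ?_
          filter_upwards [hgf] with z hz
          rw [← hz]
          refine le_trans ?_ (ennreal_add_sq_le _ _)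
          gcongr
          have e : g z - M.muStar = (g z - μ) + (μ - M.muStar) := by ring
          rw [e]
          exact eLpNorm_add_le ((hFm _ (hg.mem z)).sub (hFm _ hμ)).aestronglyMeasurable
            ((hFm _ hμ).sub M.measurable_muStar).aestronglyMeasurable one_le_two
      _ = 2 * ∫⁻ z, M.wnorm (g z - μ) ^ 2 ∂M.sampleLaw m + 2 * P := by
          rw [lintegral_add_right _ measurable_const, lintegral_const, measure_univ, mul_one,
            lintegral_const_mul' _ _ ENNReal.ofNat_ne_top]
      _ ≤ 2 * (((r : ℝ≥0∞) ^ 2 + (s : ℝ≥0∞) ^ 2) + (a * (s : ℝ≥0∞) ^ 2 + b * P) + E) + 2 * P := by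
          gcongr
      -- The added nonnegative terms complete the sum to the full product of `errorConst` with the
      -- error.
      _ ≤ (2 * (((r : ℝ≥0∞) ^ 2 + (s : ℝ≥0∞) ^ 2) + (a * (s : ℝ≥0∞) ^ 2 + b * P) + E) + 2 * P) +
          (2 * P + 2 * a * P + 2 * b * ((s : ℝ≥0∞) ^ 2 + (r : ℝ≥0∞) ^ 2 + E) +
            2 * a * ((r : ℝ≥0∞) ^ 2 + E) + 2 * ((s : ℝ≥0∞) ^ 2 + (r : ℝ≥0∞) ^ 2 + E)) := le_self_add
      _ = _ := by ring
  have hcont : ∀ u v : ℝ≥0∞, Continuous fun x : ℝ≥0∞ => ENNReal.ofReal (errorConst α₁ α₂) *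
      (u + (x ^ 2 + v)) := fun u v =>
    (ENNReal.continuous_const_mul ENNReal.ofReal_ne_top).comp
      (continuous_const.add ((ENNReal.continuous_pow 2).add continuous_const))
  have hmono : ∀ u v : ℝ≥0∞, Monotone fun x : ℝ≥0∞ => ENNReal.ofReal (errorConst α₁ α₂) *
      (u + (x ^ 2 + v)) := fun u v x y hxy => by dsimp only; gcongr
  have htop : ∀ u v : ℝ≥0∞, ENNReal.ofReal (errorConst α₁ α₂) * (u + (∞ ^ 2 + v)) = ∞ :=
    fun u v => by
      rw [ENNReal.top_pow two_ne_zero, top_add, add_top, ENNReal.mul_top hC0]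
  rw [estError, add_assoc (M.radiusS F m μ ^ 2), radiusS]
  refine le_apply_iInf_coe (hcont _ _) (hmono _ _) (htop _ _) fun s hs hS => ?_
  rw [← add_assoc ((s : ℝ≥0∞) ^ 2), add_comm ((s : ℝ≥0∞) ^ 2), add_assoc, radiusR]
  refine le_apply_iInf_coe (hcont _ _) (hmono _ _) (htop _ _) fun r hr hR => ?_
  rw [← add_assoc ((r : ℝ≥0∞) ^ 2), add_comm ((r : ℝ≥0∞) ^ 2)]
  exact hle s hs hS r hr hR

end ObsModel

/-! ### Second moments of cross-fitted sums. -/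

section CrossFit

variable {Z : Type*} [MeasurableSpace Z] {ν : Measure Z} [IsProbabilityMeasure ν] {m : ℕ}

theorem memLp_sum_eval {a : Z → ℝ} (ha : MemLp a 2 ν) :
    MemLp (fun z : Fin m → Z => ∑ i, a (z i)) 2 (Measure.pi fun _ => ν) :=
  memLp_finsetSum _ fun i _ => ha.comp_measurePreserving (measurePreserving_eval (fun _ => ν) i)

theorem integral_sum_eval {a : Z → ℝ} (ha : MemLp a 2 ν) (ha0 : ∫ y, a y ∂ν = 0) :
    ∫ z : Fin m → Z, ∑ i, a (z i) ∂(Measure.pi fun _ => ν) = 0 := by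
  have hi : ∀ i : Fin m, Integrable (fun z : Fin m → Z => a (z i)) (Measure.pi fun _ => ν) :=
    fun i => (ha.comp_measurePreserving
      (measurePreserving_eval (fun _ => ν) i)).integrable one_le_two
  rw [integral_finsetSum _ fun i _ => hi i]
  refine Finset.sum_eq_zero fun i _ => ?_
  rw [← ha0]
  exact integral_comp_eval (μ := fun _ : Fin m => ν) ha.aestronglyMeasurable

/-- Covariance of sums of centred functions of independent observations. -/
theorem integral_sum_mul_sum {a b : Z → ℝ} (ha : MemLp a 2 ν) (hb : MemLp b 2 ν)
    (ha0 : ∫ y, a y ∂ν = 0) :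
    ∫ z : Fin m → Z, (∑ i, a (z i)) * ∑ i, b (z i) ∂(Measure.pi fun _ => ν) =
      m * ∫ y, a y * b y ∂ν := by
  have hev := fun i : Fin m => measurePreserving_eval (fun _ : Fin m => ν) i
  have hi : ∀ i j : Fin m, Integrable (fun z : Fin m → Z => a (z i) * b (z j))
      (Measure.pi fun _ => ν) := fun i j =>
    (ha.comp_measurePreserving (hev i)).integrable_mul (hb.comp_measurePreserving (hev j))
  simp only [Finset.sum_mul_sum]
  rw [integral_finsetSum _ fun i _ => integrable_finsetSum _ fun j _ => hi i j]
  have hrow : ∀ i : Fin m, ∫ z : Fin m → Z, ∑ j, a (z i) * b (z j) ∂(Measure.pi fun _ => ν) =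
      ∫ y, a y * b y ∂ν := fun i => by
    rw [integral_finsetSum _ fun j _ => hi i j, Finset.sum_eq_single i]
    · exact integral_comp_eval (μ := fun _ : Fin m => ν) (f := fun y => a y * b y)
        (ha.integrable_mul hb).aestronglyMeasurable
    · intro j _ hj
      -- Off-diagonal terms factor by independence and vanish because `a` is centred; `b` need not
      -- be.
      have hind : IndepFun (fun z : Fin m → Z => a (z i)) (fun z => b (z j))
          (Measure.pi fun _ => ν) := by
        have h1 : iIndepFun (fun (i : Fin m) (z : Fin m → Z) => z i) (Measure.pi fun _ => ν) :=
          iIndepFun_pi (X := fun _ => id) fun _ => aemeasurable_id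
        obtain ⟨a', ha', haa⟩ := ha.aestronglyMeasurable.aemeasurable
        obtain ⟨b', hb', hbb⟩ := hb.aestronglyMeasurable.aemeasurable
        refine IndepFun.congr ((h1.indepFun hj.symm).comp ha' hb') ?_ ?_
        · exact ((hev i).quasiMeasurePreserving.ae haa).mono fun z hz => hz.symm
        · exact ((hev j).quasiMeasurePreserving.ae hbb).mono fun z hz => hz.symm
      have h2 := hind.integral_mul_eq_mul_integral
        (ha.comp_measurePreserving (hev i)).aestronglyMeasurable
        (hb.comp_measurePreserving (hev j)).aestronglyMeasurable
      have h3 : ∫ z : Fin m → Z, a (z i) ∂(Measure.pi fun _ => ν) = 0 := by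
        rw [← ha0]
        exact integral_comp_eval (μ := fun _ : Fin m => ν) ha.aestronglyMeasurable
      rw [h3, zero_mul] at h2
      exact h2
    · intro h; exact absurd (Finset.mem_univ i) h
  simp [hrow]

/-- A sum over one sample, of a conditionally centred function selected by the other sample. -/
theorem crossSum_facts {a : Z → ℝ} (ha : MemLp a 2 ν) (ha0 : ∫ y, a y ∂ν = 0)
    {v : (Fin m → Z) → Z → ℝ} (hv : Measurable fun q : (Fin m → Z) × Z => v q.1 q.2)
    (hv2 : ∀ᵐ w ∂(Measure.pi fun _ : Fin m => ν), MemLp (v w) 2 ν ∧ ∫ y, v w y ∂ν = 0 ∧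
      ∫ y, a y * v w y ∂ν = 0)
    (hK : ∫⁻ w, ∫⁻ y, ENNReal.ofReal (v w y ^ 2) ∂ν ∂(Measure.pi fun _ => ν) ≠ ∞) :
    MemLp (fun q : (Fin m → Z) × (Fin m → Z) => ∑ i, v q.2 (q.1 i)) 2
        ((Measure.pi fun _ => ν).prod (Measure.pi fun _ => ν)) ∧
      ∫⁻ q : (Fin m → Z) × (Fin m → Z), ENNReal.ofReal ((∑ i, v q.2 (q.1 i)) ^ 2)
        ∂((Measure.pi fun _ => ν).prod (Measure.pi fun _ => ν)) =
        m * ∫⁻ w, ∫⁻ y, ENNReal.ofReal (v w y ^ 2) ∂ν ∂(Measure.pi fun _ => ν) ∧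
      ∫ q : (Fin m → Z) × (Fin m → Z), (∑ i, a (q.1 i) + ∑ i, a (q.2 i)) * ∑ i, v q.2 (q.1 i)
        ∂((Measure.pi fun _ => ν).prod (Measure.pi fun _ => ν)) = 0 := by
  set P := Measure.pi fun _ : Fin m => ν
  have hT : Measurable fun q : (Fin m → Z) × (Fin m → Z) => ∑ i, v q.2 (q.1 i) :=
    Finset.measurable_sum _ fun i _ =>
      hv.comp (measurable_snd.prodMk ((measurable_pi_apply i).comp measurable_fst))
  have hsq : ∫⁻ q : (Fin m → Z) × (Fin m → Z), ENNReal.ofReal ((∑ i, v q.2 (q.1 i)) ^ 2)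
      ∂(P.prod P) = m * ∫⁻ w, ∫⁻ y, ENNReal.ofReal (v w y ^ 2) ∂ν ∂P := by
    rw [lintegral_prod_symm _ (hT.pow_const 2).ennreal_ofReal.aemeasurable,
      ← lintegral_const_mul' _ _ (ENNReal.natCast_ne_top m)]
    refine lintegral_congr_ae ?_
    filter_upwards [hv2] with w hw
    have e : ∀ z : Fin m → Z, (∑ i, v w (z i)) ^ 2 = (∑ i, v w (z i)) * ∑ i, v w (z i) :=
      fun z => sq _
    have e2 : ∀ y, v w y * v w y = v w y ^ 2 := fun y => (sq _).symm
    change ∫⁻ z : Fin m → Z, ENNReal.ofReal ((∑ i, v w (z i)) ^ 2) ∂P = _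
    rw [lintegral_ofReal_sq (memLp_sum_eval hw.1), lintegral_ofReal_sq hw.1]
    simp only [e]
    rw [integral_sum_mul_sum hw.1 hw.1 hw.2.1, ENNReal.ofReal_mul (Nat.cast_nonneg _),
      ENNReal.ofReal_natCast]
    simp only [e2]
  have hmem : MemLp (fun q : (Fin m → Z) × (Fin m → Z) => ∑ i, v q.2 (q.1 i)) 2 (P.prod P) :=
    memLp_two_of_lintegral_ne_top hT (by
      rw [hsq]; exact ENNReal.mul_ne_top (ENNReal.natCast_ne_top m) hK)
  refine ⟨hmem, hsq, ?_⟩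
  have hS : MemLp (fun q : (Fin m → Z) × (Fin m → Z) => ∑ i, a (q.1 i) + ∑ i, a (q.2 i)) 2
      (P.prod P) :=
    ((memLp_sum_eval ha).comp_measurePreserving measurePreserving_fst).add
      ((memLp_sum_eval ha).comp_measurePreserving measurePreserving_snd)
  have hST : Integrable (fun q : (Fin m → Z) × (Fin m → Z) =>
      (∑ i, a (q.1 i) + ∑ i, a (q.2 i)) * ∑ i, v q.2 (q.1 i)) (P.prod P) := hS.integrable_mul hmem
  rw [integral_prod_symm _ hST]
  refine integral_eq_zero_of_ae ?_
  -- With the selecting sample `w` fixed, the sum of `a` over the other sample is uncorrelated with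
  -- that of `v w`, and the sum of `a` over `w` is a constant multiplying a centred sum.
  filter_upwards [hv2] with w hw
  have hi1 : Integrable (fun z : Fin m → Z => (∑ i, a (z i)) * ∑ i, v w (z i)) P :=
    (memLp_sum_eval ha).integrable_mul (memLp_sum_eval hw.1)
  have hi2 : Integrable (fun z : Fin m → Z => (∑ i, a (w i)) * ∑ i, v w (z i)) P :=
    ((memLp_sum_eval hw.1).integrable one_le_two).const_mul _
  simp only [Pi.zero_apply, add_mul]
  rw [integral_add hi1 hi2, integral_sum_mul_sum ha hw.1 ha0, hw.2.2, integral_const_mul,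
    integral_sum_eval hw.1 hw.2.1]
  simp

/-- Second moment of a cross-fitted sum. -/
theorem lintegral_crossFit_sq_le {a : Z → ℝ} (ha : MemLp a 2 ν) (ha0 : ∫ y, a y ∂ν = 0)
    {v₁ v₂ : (Fin m → Z) → Z → ℝ} (hv₁ : Measurable fun q : (Fin m → Z) × Z => v₁ q.1 q.2)
    (hv₂ : Measurable fun q : (Fin m → Z) × Z => v₂ q.1 q.2)
    (h₁ : ∀ᵐ w ∂(Measure.pi fun _ : Fin m => ν), MemLp (v₁ w) 2 ν ∧ ∫ y, v₁ w y ∂ν = 0 ∧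
      ∫ y, a y * v₁ w y ∂ν = 0)
    (h₂ : ∀ᵐ w ∂(Measure.pi fun _ : Fin m => ν), MemLp (v₂ w) 2 ν ∧ ∫ y, v₂ w y ∂ν = 0 ∧
      ∫ y, a y * v₂ w y ∂ν = 0)
    (hK₁ : ∫⁻ w, ∫⁻ y, ENNReal.ofReal (v₁ w y ^ 2) ∂ν ∂(Measure.pi fun _ => ν) ≠ ∞)
    (hK₂ : ∫⁻ w, ∫⁻ y, ENNReal.ofReal (v₂ w y ^ 2) ∂ν ∂(Measure.pi fun _ => ν) ≠ ∞) :
    ∫⁻ q : (Fin m → Z) × (Fin m → Z), ENNReal.ofReal (((∑ i, a (q.1 i) + ∑ i, a (q.2 i)) +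
        (∑ i, v₂ q.2 (q.1 i) + ∑ i, v₁ q.1 (q.2 i))) ^ 2)
        ∂((Measure.pi fun _ => ν).prod (Measure.pi fun _ => ν)) ≤
      2 * m * ∫⁻ y, ENNReal.ofReal (a y ^ 2) ∂ν +
        (2 * m * ∫⁻ w, ∫⁻ y, ENNReal.ofReal (v₁ w y ^ 2) ∂ν ∂(Measure.pi fun _ => ν) +
        2 * m * ∫⁻ w, ∫⁻ y, ENNReal.ofReal (v₂ w y ^ 2) ∂ν ∂(Measure.pi fun _ => ν)) := by
  obtain ⟨m2, e2, o2⟩ := crossSum_facts ha ha0 hv₂ h₂ hK₂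
  obtain ⟨m1', e1', o1'⟩ := crossSum_facts ha ha0 hv₁ h₁ hK₁
  set P := Measure.pi fun _ : Fin m => ν
  have hsw : MeasurePreserving Prod.swap (P.prod P) (P.prod P) := Measure.measurePreserving_swap
  have m1 : MemLp (fun q : (Fin m → Z) × (Fin m → Z) => ∑ i, v₁ q.1 (q.2 i)) 2 (P.prod P) :=
    m1'.comp_measurePreserving hsw
  have e1 : ∫⁻ q : (Fin m → Z) × (Fin m → Z), ENNReal.ofReal ((∑ i, v₁ q.1 (q.2 i)) ^ 2)
      ∂(P.prod P) = m * ∫⁻ w, ∫⁻ y, ENNReal.ofReal (v₁ w y ^ 2) ∂ν ∂P := by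
    rw [← e1', ← lintegral_prod_swap]
    rfl
  have o1 : ∫ q : (Fin m → Z) × (Fin m → Z), (∑ i, a (q.1 i) + ∑ i, a (q.2 i)) *
      ∑ i, v₁ q.1 (q.2 i) ∂(P.prod P) = 0 := by
    rw [← o1', ← integral_prod_swap]
    refine integral_congr_ae (ae_of_all _ fun q => ?_)
    simp only [Prod.fst_swap, Prod.snd_swap]
    ring
  have hA1 : MemLp (fun q : (Fin m → Z) × (Fin m → Z) => ∑ i, a (q.1 i)) 2 (P.prod P) :=
    (memLp_sum_eval ha).comp_measurePreserving measurePreserving_fst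
  have hA2 : MemLp (fun q : (Fin m → Z) × (Fin m → Z) => ∑ i, a (q.2 i)) 2 (P.prod P) :=
    (memLp_sum_eval ha).comp_measurePreserving measurePreserving_snd
  have hS : MemLp (fun q : (Fin m → Z) × (Fin m → Z) => ∑ i, a (q.1 i) + ∑ i, a (q.2 i)) 2
      (P.prod P) := hA1.add hA2
  have hT : MemLp (fun q : (Fin m → Z) × (Fin m → Z) => ∑ i, v₂ q.2 (q.1 i) + ∑ i, v₁ q.1 (q.2 i))
      2 (P.prod P) := m2.add m1
  have hself : ∫ z : Fin m → Z, (∑ i, a (z i)) ^ 2 ∂P = m * ∫ y, a y ^ 2 ∂ν := by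
    simp only [sq]
    exact integral_sum_mul_sum ha ha ha0
  have hSS : ∫ q : (Fin m → Z) × (Fin m → Z), (∑ i, a (q.1 i) + ∑ i, a (q.2 i)) ^ 2 ∂(P.prod P) =
      2 * m * ∫ y, a y ^ 2 ∂ν := by
    have e : ∀ q : (Fin m → Z) × (Fin m → Z), (∑ i, a (q.1 i) + ∑ i, a (q.2 i)) ^ 2 =
        ((∑ i, a (q.1 i)) ^ 2 + (∑ i, a (q.2 i)) ^ 2) +
        2 * ((∑ i, a (q.1 i)) * ∑ i, a (q.2 i)) := fun q => by ring
    have i12 : Integrable (fun q : (Fin m → Z) × (Fin m → Z) =>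
      (∑ i, a (q.1 i)) ^ 2 + (∑ i, a (q.2 i)) ^ 2) (P.prod P) :=
      hA1.integrable_sq.add hA2.integrable_sq
    have i3 : Integrable (fun q : (Fin m → Z) × (Fin m → Z) =>
      (∑ i, a (q.1 i)) * ∑ i, a (q.2 i)) (P.prod P) := hA1.integrable_mul hA2
    simp only [e]
    rw [integral_add i12 (i3.const_mul 2), integral_add hA1.integrable_sq hA2.integrable_sq,
      integral_const_mul, integral_prod_mul (fun z : Fin m → Z => ∑ i, a (z i))
        (fun z : Fin m → Z => ∑ i, a (z i)), integral_sum_eval ha ha0,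
      integral_fun_fst (fun z : Fin m → Z => (∑ i, a (z i)) ^ 2),
      integral_fun_snd (fun z : Fin m → Z => (∑ i, a (z i)) ^ 2), hself]
    simp
    ring
  have iST2 : Integrable (fun q : (Fin m → Z) × (Fin m → Z) =>
      (∑ i, a (q.1 i) + ∑ i, a (q.2 i)) * ∑ i, v₂ q.2 (q.1 i)) (P.prod P) := hS.integrable_mul m2
  have iST1 : Integrable (fun q : (Fin m → Z) × (Fin m → Z) =>
      (∑ i, a (q.1 i) + ∑ i, a (q.2 i)) * ∑ i, v₁ q.1 (q.2 i)) (P.prod P) := hS.integrable_mul m1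
  -- Both error sums are orthogonal to the oracle sum. Their mutual correlation is not computed: `(x
  -- + y)² ≤ 2x² + 2y²` suffices, and it costs nothing in the leading term.
  have hle : ∫ q : (Fin m → Z) × (Fin m → Z), ((∑ i, a (q.1 i) + ∑ i, a (q.2 i)) +
        (∑ i, v₂ q.2 (q.1 i) + ∑ i, v₁ q.1 (q.2 i))) ^ 2 ∂(P.prod P) ≤
      2 * m * ∫ y, a y ^ 2 ∂ν +
        (2 * ∫ q : (Fin m → Z) × (Fin m → Z), (∑ i, v₁ q.1 (q.2 i)) ^ 2 ∂(P.prod P) +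
        2 * ∫ q : (Fin m → Z) × (Fin m → Z), (∑ i, v₂ q.2 (q.1 i)) ^ 2 ∂(P.prod P)) := by
    have i1 : Integrable (fun q : (Fin m → Z) × (Fin m → Z) =>
        2 * ((∑ i, a (q.1 i) + ∑ i, a (q.2 i)) * ∑ i, v₂ q.2 (q.1 i)) +
        2 * ((∑ i, a (q.1 i) + ∑ i, a (q.2 i)) * ∑ i, v₁ q.1 (q.2 i))) (P.prod P) :=
      (iST2.const_mul 2).add (iST1.const_mul 2)
    have i2 : Integrable (fun q : (Fin m → Z) × (Fin m → Z) =>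
        2 * (∑ i, v₁ q.1 (q.2 i)) ^ 2 + 2 * (∑ i, v₂ q.2 (q.1 i)) ^ 2) (P.prod P) :=
      (m1.integrable_sq.const_mul 2).add (m2.integrable_sq.const_mul 2)
    have i3 : Integrable (fun q : (Fin m → Z) × (Fin m → Z) =>
        (2 * (∑ i, v₁ q.1 (q.2 i)) ^ 2 + 2 * (∑ i, v₂ q.2 (q.1 i)) ^ 2) +
        (2 * ((∑ i, a (q.1 i) + ∑ i, a (q.2 i)) * ∑ i, v₂ q.2 (q.1 i)) +
        2 * ((∑ i, a (q.1 i) + ∑ i, a (q.2 i)) * ∑ i, v₁ q.1 (q.2 i)))) (P.prod P) := i2.add i1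
    calc _ ≤ ∫ q : (Fin m → Z) × (Fin m → Z), ((∑ i, a (q.1 i) + ∑ i, a (q.2 i)) ^ 2 +
          ((2 * (∑ i, v₁ q.1 (q.2 i)) ^ 2 + 2 * (∑ i, v₂ q.2 (q.1 i)) ^ 2) +
          (2 * ((∑ i, a (q.1 i) + ∑ i, a (q.2 i)) * ∑ i, v₂ q.2 (q.1 i)) +
          2 * ((∑ i, a (q.1 i) + ∑ i, a (q.2 i)) * ∑ i, v₁ q.1 (q.2 i))))) ∂(P.prod P) := by
          refine integral_mono (hS.add hT).integrable_sq (hS.integrable_sq.add i3) fun q => ?_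
          dsimp only [Pi.add_apply]
          nlinarith [sq_nonneg (∑ i, v₂ q.2 (q.1 i) - ∑ i, v₁ q.1 (q.2 i))]
      _ = _ := by
          rw [integral_add hS.integrable_sq i3, integral_add i2 i1,
            integral_add (iST2.const_mul 2) (iST1.const_mul 2),
            integral_add (m1.integrable_sq.const_mul 2) (m2.integrable_sq.const_mul 2)]
          simp only [integral_const_mul]
          rw [o1, o2, hSS]
          ring
  have hlin := lintegral_ofReal_sq (hS.add hT)
  simp only [Pi.add_apply] at hlin
  rw [hlin]
  refine (ENNReal.ofReal_le_ofReal hle).trans (le_of_eq ?_)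
  have p0 : 0 ≤ ∫ y, a y ^ 2 ∂ν := integral_nonneg fun _ => sq_nonneg _
  have p1 : 0 ≤ ∫ q : (Fin m → Z) × (Fin m → Z), (∑ i, v₁ q.1 (q.2 i)) ^ 2 ∂(P.prod P) :=
    integral_nonneg fun _ => sq_nonneg _
  have p2 : 0 ≤ ∫ q : (Fin m → Z) × (Fin m → Z), (∑ i, v₂ q.2 (q.1 i)) ^ 2 ∂(P.prod P) :=
    integral_nonneg fun _ => sq_nonneg _
  rw [ENNReal.ofReal_add (by positivity) (by positivity),
    ENNReal.ofReal_add (by positivity) (by positivity), ENNReal.ofReal_mul (by positivity),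
    ENNReal.ofReal_mul zero_le_two, ENNReal.ofReal_mul zero_le_two, ENNReal.ofReal_mul zero_le_two,
    ENNReal.ofReal_natCast, ENNReal.ofReal_ofNat, ← lintegral_ofReal_sq ha,
    ← lintegral_ofReal_sq m1, ← lintegral_ofReal_sq m2, e1, e2]
  ring

/-- Concatenation of two independent samples. -/
theorem measurePreserving_append (m : ℕ) :
    MeasurePreserving (fun q : (Fin m → Z) × (Fin m → Z) => Fin.append q.1 q.2)
      ((Measure.pi fun _ => ν).prod (Measure.pi fun _ => ν))
      (Measure.pi fun _ : Fin (m + m) => ν) := by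
  have hmeas : Measurable fun q : (Fin m → Z) × (Fin m → Z) => Fin.append q.1 q.2 := by
    refine measurable_pi_lambda _ fun i => ?_
    refine Fin.addCases (fun i => ?_) (fun i => ?_) i
    · simp only [Fin.append_left]
      exact (measurable_pi_apply i).comp measurable_fst
    · simp only [Fin.append_right]
      exact (measurable_pi_apply i).comp measurable_snd
  refine ⟨hmeas, (Measure.pi_eq fun s hs => ?_).symm⟩
  rw [Measure.map_apply hmeas (MeasurableSet.univ_pi hs)]
  have : (fun q : (Fin m → Z) × (Fin m → Z) => Fin.append q.1 q.2) ⁻¹' Set.univ.pi s =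
      (Set.univ.pi fun i => s (Fin.castAdd m i)) ×ˢ (Set.univ.pi fun i => s (Fin.natAdd m i)) := by
    ext q
    simp only [Set.mem_preimage, Set.mem_pi, Set.mem_univ, true_implies, Set.mem_prod]
    constructor
    · intro h
      exact ⟨fun i => by simpa only [Fin.append_left] using h (Fin.castAdd m i),
        fun i => by simpa only [Fin.append_right] using h (Fin.natAdd m i)⟩
    · rintro ⟨h1, h2⟩ i
      refine Fin.addCases (fun i => ?_) (fun i => ?_) i
      · simpa only [Fin.append_left] using h1 i
      · simpa only [Fin.append_right] using h2 i
  rw [this, Measure.prod_prod, Measure.pi_pi, Measure.pi_pi, Fin.prod_univ_add]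

end CrossFit

/-! ### Mean-squared error of the two-stage estimator. -/

namespace ObsModel

variable {X A : Type*} [MeasurableSpace X] [MeasurableSpace A] (M : ObsModel X A)

theorem measurable_actInner_param {α : Type*} [MeasurableSpace α] {f : α → X × A → ℝ}
    (hf : Measurable fun q : α × (X × A) => f q.1 q.2) :
    Measurable fun q : α × X => M.actInner (f q.1) q.2 := by
  have h1 : Measurable fun q : (α × X) × A => M.weight (q.1.2, q.2) * f q.1.1 (q.1.2, q.2) := by
    have h2 : Measurable fun q : (α × X) × A => (q.1.2, q.2) :=
      measurable_fst.snd.prodMk measurable_snd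
    have h3 : Measurable fun q : (α × X) × A => (q.1.1, (q.1.2, q.2)) :=
      measurable_fst.fst.prodMk h2
    exact (M.measurable_weight.comp h2).mul (hf.comp h3)
  exact h1.stronglyMeasurable.integral_prod_right'.measurable

theorem measurable_scoreError_param {α : Type*} [MeasurableSpace α] {f : α → X × A → ℝ}
    (hf : Measurable fun q : α × (X × A) => f q.1 q.2) :
    Measurable fun q : α × (X × A) => M.scoreError (f q.1) q.2 := by
  have h1 : Measurable fun q : α × (X × A) => (q.1, q.2.1) :=
    measurable_fst.prodMk measurable_snd.fst
  exact ((M.measurable_ratio.comp measurable_snd).mul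
    ((M.measurable_muStar.comp measurable_snd).sub hf)).sub
    (((M.measurable_actInner M.measurable_muStar).comp measurable_snd.fst).sub
      ((M.measurable_actInner_param hf).comp h1))

variable {m : ℕ} {F : Set (X × A → ℝ)} {f₁ f₂ f : (Fin m → Obs X A) → X × A → ℝ}

theorem measurable_scoreError_obs
    (hf : Measurable fun q : (Fin m → Obs X A) × (X × A) => f q.1 q.2) :
    Measurable fun q : (Fin m → Obs X A) × Obs X A => M.scoreError (f q.1) q.2.1 := by
  have h1 : Measurable fun q : (Fin m → Obs X A) × Obs X A => (q.1, q.2.1) :=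
    measurable_fst.prodMk measurable_snd.fst
  exact (M.measurable_scoreError_param hf).comp h1

theorem twoStage_sub_tauStar (hm : 0 < m) (z : Fin (m + m) → Obs X A) :
    M.twoStage f₁ f₂ z - M.tauStar = (1 / ((m + m : ℕ) : ℝ)) *
      ((∑ i, M.oracleScore (z (Fin.castAdd m i)) + ∑ i, M.oracleScore (z (Fin.natAdd m i))) +
      (∑ i, M.scoreError (f₂ fun j => z (Fin.natAdd m j)) (z (Fin.castAdd m i)).1 +
      ∑ i, M.scoreError (f₁ fun j => z (Fin.castAdd m j)) (z (Fin.natAdd m i)).1)) := by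
  have hm' : (m : ℝ) ≠ 0 := Nat.cast_ne_zero.2 hm.ne'
  have key : ∀ (h : X × A → ℝ) (g : Fin m → Obs X A),
      ∑ i, (M.ratio (g i).1 * (g i).2 - M.auxFun h (g i).1) = m * M.tauStar +
        (∑ i, M.oracleScore (g i) + ∑ i, M.scoreError h (g i).1) := fun h g => by
    have e : ∀ i, M.ratio (g i).1 * (g i).2 - M.auxFun h (g i).1 =
        M.tauStar + (M.oracleScore (g i) + M.scoreError h (g i).1) := fun i => by
      rw [← score_eq]; ring
    simp only [e, Finset.sum_add_distrib]
    simp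
  simp only [twoStage]
  rw [key (f₂ fun j => z (Fin.natAdd m j)) fun i => z (Fin.castAdd m i),
    key (f₁ fun j => z (Fin.castAdd m j)) fun i => z (Fin.natAdd m i)]
  push_cast
  field_simp
  ring

theorem measurable_twoStage (hm : 0 < m)
    (hf₁ : Measurable fun q : (Fin m → Obs X A) × (X × A) => f₁ q.1 q.2)
    (hf₂ : Measurable fun q : (Fin m → Obs X A) × (X × A) => f₂ q.1 q.2) :
    Measurable fun z => M.twoStage f₁ f₂ z - M.tauStar := by
  simp only [M.twoStage_sub_tauStar hm]
  have hl : ∀ i : Fin m, Measurable fun z : Fin (m + m) → Obs X A => z (Fin.castAdd m i) :=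
    fun i => measurable_pi_apply _
  have hr : ∀ i : Fin m, Measurable fun z : Fin (m + m) → Obs X A => z (Fin.natAdd m i) :=
    fun i => measurable_pi_apply _
  have hU1 : Measurable fun z : Fin (m + m) → Obs X A =>
      ∑ i, M.oracleScore (z (Fin.castAdd m i)) :=
    Finset.measurable_sum _ fun i _ => M.measurable_oracleScore.comp (hl i)
  have hU2 : Measurable fun z : Fin (m + m) → Obs X A =>
      ∑ i, M.oracleScore (z (Fin.natAdd m i)) :=
    Finset.measurable_sum _ fun i _ => M.measurable_oracleScore.comp (hr i)
  have hV2 : Measurable fun z : Fin (m + m) → Obs X A =>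
      ∑ i, M.scoreError (f₂ fun j => z (Fin.natAdd m j)) (z (Fin.castAdd m i)).1 :=
    Finset.measurable_sum _ fun i _ => by
      have h := (M.measurable_scoreError_obs hf₂).comp
        ((measurable_pi_lambda (fun (z : Fin (m + m) → Obs X A) j => z (Fin.natAdd m j)) hr).prodMk
          (hl i))
      simpa only [Function.comp_def] using h
  have hV1 : Measurable fun z : Fin (m + m) → Obs X A =>
      ∑ i, M.scoreError (f₁ fun j => z (Fin.castAdd m j)) (z (Fin.natAdd m i)).1 :=
    Finset.measurable_sum _ fun i _ => by
      have h := (M.measurable_scoreError_obs hf₁).comp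
        ((measurable_pi_lambda (fun (z : Fin (m + m) → Obs X A) j => z (Fin.castAdd m j)) hl).prodMk
          (hr i))
      simpa only [Function.comp_def] using h
  exact ((hU1.add hU2).add (hV2.add hV1)).const_mul _

/-- Mean-squared error of the cross-fitted estimator in terms of the first-stage errors. -/
theorem lintegral_twoStage_sq_le (hm : 0 < m) (hμ : M.wnorm M.muStar ≠ ∞) (hv : M.effVar ≠ ∞)
    (hf₁ : Measurable fun q : (Fin m → Obs X A) × (X × A) => f₁ q.1 q.2)
    (hf₂ : Measurable fun q : (Fin m → Obs X A) × (X × A) => f₂ q.1 q.2)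
    (hn₁ : ∀ᵐ z ∂M.sampleLaw m, M.wnorm (f₁ z) ≠ ∞)
    (hn₂ : ∀ᵐ z ∂M.sampleLaw m, M.wnorm (f₂ z) ≠ ∞)
    (hK₁ : ∫⁻ z, M.wnorm (f₁ z - M.muStar) ^ 2 ∂M.sampleLaw m ≠ ∞)
    (hK₂ : ∫⁻ z, M.wnorm (f₂ z - M.muStar) ^ 2 ∂M.sampleLaw m ≠ ∞) :
    ∫⁻ z, ENNReal.ofReal ((M.twoStage f₁ f₂ z - M.tauStar) ^ 2) ∂M.sampleLaw (m + m) ≤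
      ((m + m : ℕ) : ℝ≥0∞)⁻¹ * (M.effVar +
        (∫⁻ z, M.wnorm (f₁ z - M.muStar) ^ 2 ∂M.sampleLaw m +
        ∫⁻ z, M.wnorm (f₂ z - M.muStar) ^ 2 ∂M.sampleLaw m)) := by
  have hcond : ∀ f : (Fin m → Obs X A) → X × A → ℝ,
      (Measurable fun q : (Fin m → Obs X A) × (X × A) => f q.1 q.2) →
      (∀ᵐ z ∂M.sampleLaw m, M.wnorm (f z) ≠ ∞) →
      (∀ᵐ w ∂M.sampleLaw m, MemLp (fun o : Obs X A => M.scoreError (f w) o.1) 2 M.obsLaw ∧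
        ∫ o : Obs X A, M.scoreError (f w) o.1 ∂M.obsLaw = 0 ∧
        ∫ o, M.oracleScore o * M.scoreError (f w) o.1 ∂M.obsLaw = 0) ∧
      ∫⁻ w, ∫⁻ o : Obs X A, ENNReal.ofReal (M.scoreError (f w) o.1 ^ 2) ∂M.obsLaw ∂M.sampleLaw m ≤
        ∫⁻ z, M.wnorm (f z - M.muStar) ^ 2 ∂M.sampleLaw m := by
    intro f hf hn
    have hfm : ∀ z, Measurable (f z) := fun z => hf.comp measurable_prodMk_left
    refine ⟨?_, lintegral_mono_ae ?_⟩
    · filter_upwards [hn] with w hw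
      have h1 := memLp_scoreError hμ (hfm w) hw
      refine ⟨h1.comp_measurePreserving M.measurePreserving_pair, ?_,
        integral_oracleScore_mul_scoreError hμ hv (hfm w) hw⟩
      rw [integral_obsLaw_fst h1.aestronglyMeasurable]
      exact integral_scoreError hμ (hfm w) hw
    · filter_upwards [hn] with w hw
      refine le_of_eq_of_le ?_ (lintegral_scoreError_sq_le hμ (hfm w) hw)
      exact M.measurePreserving_pair.lintegral_comp
        ((M.measurable_scoreError (hfm w)).pow_const 2).ennreal_ofReal
  obtain ⟨c₁, k₁⟩ := hcond f₁ hf₁ hn₁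
  obtain ⟨c₂, k₂⟩ := hcond f₂ hf₂ hn₂
  have hmain := lintegral_crossFit_sq_le (memLp_oracleScore hμ hv) (integral_oracleScore hμ hv)
    (M.measurable_scoreError_obs hf₁) (M.measurable_scoreError_obs hf₂) c₁ c₂
    (ne_top_of_le_ne_top hK₁ k₁) (ne_top_of_le_ne_top hK₂ k₂)
  have hmeas : Measurable fun z => ENNReal.ofReal ((M.twoStage f₁ f₂ z - M.tauStar) ^ 2) :=
    ((M.measurable_twoStage hm hf₁ hf₂).pow_const 2).ennreal_ofReal
  rw [sampleLaw, ← (measurePreserving_append m).lintegral_comp hmeas]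
  simp only [M.twoStage_sub_tauStar hm, Fin.append_left, Fin.append_right, mul_pow]
  have hn0 : (0 : ℝ) < ((m + m : ℕ) : ℝ) := by positivity
  have hn1 : ((m + m : ℕ) : ℝ≥0∞) ≠ 0 := by
    rw [Nat.cast_ne_zero]; omega
  have hn2 : ((m + m : ℕ) : ℝ≥0∞) ≠ ∞ := ENNReal.natCast_ne_top _
  simp only [ENNReal.ofReal_mul (sq_nonneg (1 / ((m + m : ℕ) : ℝ)))]
  rw [lintegral_const_mul' _ _ ENNReal.ofReal_ne_top, one_div, ENNReal.ofReal_pow (by positivity),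
    ENNReal.ofReal_inv_of_pos hn0, ENNReal.ofReal_natCast, sq, mul_assoc]
  gcongr
  -- One of the two factors `1/n` has been set aside; the other cancels the `2 m = n` from the
  -- cross-fitted sum.
  rw [← ENNReal.mul_le_mul_iff_right hn1 hn2, ← mul_assoc, ENNReal.mul_inv_cancel hn1 hn2, one_mul]
  refine hmain.trans ?_
  have e : (2 : ℝ≥0∞) * m = ((m + m : ℕ) : ℝ≥0∞) := by push_cast; ring
  rw [e, ← mul_add, ← mul_add]
  exact mul_le_mul' le_rfl
    (add_le_add (lintegral_oracleScore_sq_le hμ hv) (add_le_add k₁ k₂))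

end ObsModel

end

theorem theorem2 (α₁ α₂ : ℝ) (hα₁ : 0 < α₁) (hα₂ : 0 < α₂) :
    ∃ c c' : ℝ, 0 < c ∧ 0 < c' ∧
      ∀ (X : Type u) (A : Type v) [MeasurableSpace X] [MeasurableSpace A] (M : ObsModel X A)
        (F : Set (X × A → ℝ)), Convex ℝ F → M.IsCompactClass F → M.SmallBall F α₁ α₂ →
      ∀ (m : ℕ), 0 < m →
      ∀ (muhat₁ muhat₂ : (Fin m → Obs X A) → X × A → ℝ),
        M.IsLeastSquares F m muhat₁ → M.IsLeastSquares F m muhat₂ →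
      ∀ (Ω : Type w) [MeasurableSpace Ω] (P : Measure Ω) [IsProbabilityMeasure P]
        (Z : Fin (m + m) → Ω → Obs X A),
        (∀ i, Measurable (Z i)) → iIndepFun Z P → (∀ i, P.map (Z i) = M.obsLaw) →
        ∫⁻ ω, ENNReal.ofReal
            ((M.twoStage muhat₁ muhat₂ (fun i => Z i ω) - M.tauStar) ^ 2) ∂P ≤
          ((m + m : ℕ) : ℝ≥0∞)⁻¹ *
            (M.effVar + ENNReal.ofReal c *
              ⨅ μ ∈ F, (M.wnorm (μ - M.muStar) ^ 2 + M.estError F α₁ α₂ c' m μ)) := by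
  have hC := ObsModel.errorConst_pos hα₁ hα₂
  -- The factor 2 accounts for the two halves, each with its own first-stage risk.
  refine ⟨2 * ObsModel.errorConst α₁ α₂, α₂ ^ 2 / 16, by positivity, by positivity, ?_⟩
  intro X A _ _ M F hF hcomp hsb m hm f₁ f₂ h₁ h₂ Ω _ P _ Z hZ hind hlaw
  set R := ⨅ μ ∈ F, (M.wnorm (μ - M.muStar) ^ 2 + M.estError F α₁ α₂ (α₂ ^ 2 / 16) m μ)
  have hninv : ((m + m : ℕ) : ℝ≥0∞)⁻¹ ≠ 0 := ENNReal.inv_ne_zero.2 (ENNReal.natCast_ne_top _)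
  -- If either term on the right is infinite there is nothing to prove. A finite infimum gives a
  -- reference point at finite distance from `μ*`, so `μ*` has finite weighted norm.
  rcases eq_or_ne M.effVar ∞ with hv | hv
  · rw [hv, top_add, ENNReal.mul_top hninv]; exact le_top
  rcases eq_or_ne R ∞ with hR | hR
  · rw [hR, ENNReal.mul_top (by simpa using hC), add_top, ENNReal.mul_top hninv]; exact le_top
  have hFm := hcomp.measurable
  have hFn : ∀ f ∈ F, M.wnorm f ≠ ∞ := fun f hf => (hcomp.memLp f hf).2.ne
  have hμ : M.wnorm M.muStar ≠ ∞ := by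
    obtain ⟨μ, hμR⟩ := iInf_lt_iff.1 (lt_top_iff_ne_top.2 hR)
    obtain ⟨hμF, hμlt⟩ := iInf_lt_iff.1 hμR
    have h1 : M.wnorm (μ - M.muStar) ≠ ∞ := fun h => by
      rw [h, ENNReal.top_pow two_ne_zero, top_add] at hμlt
      exact lt_irrefl _ hμlt
    have h2 := M.wnorm_sub_ne_top (hFm μ hμF) (hFn μ hμF) ((hFm μ hμF).sub M.measurable_muStar) h1
    rwa [sub_sub_cancel] at h2
  have hreg : ∀ f, M.IsLeastSquares F m f →
      ∫⁻ z, M.wnorm (f z - M.muStar) ^ 2 ∂M.sampleLaw m ≤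
        ENNReal.ofReal (ObsModel.errorConst α₁ α₂) * R := fun f hf => by
    have hC0 : ENNReal.ofReal (ObsModel.errorConst α₁ α₂) ≠ 0 := by simpa using hC
    -- Dividing by the constant frees the infimum over reference points, which can then be bounded
    -- pointwise.
    rw [← ENNReal.div_le_iff' hC0 ENNReal.ofReal_ne_top]
    refine le_iInf₂ fun μ hμF => ?_
    rw [ENNReal.div_le_iff' hC0 ENNReal.ofReal_ne_top]
    exact hf.lintegral_wnorm_sub_muStar_le hα₁ hα₂ hm hF hFm hFn hsb hv hμF
  have hRfin : ENNReal.ofReal (ObsModel.errorConst α₁ α₂) * R ≠ ∞ :=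
    ENNReal.mul_ne_top ENNReal.ofReal_ne_top hR
  have hmap : P.map (fun ω i => Z i ω) = M.sampleLaw (m + m) := by
    rw [(iIndepFun_iff_map_fun_eq_pi_map fun i => (hZ i).aemeasurable).1 hind, ObsModel.sampleLaw]
    simp only [hlaw]
  have hmeas : Measurable fun z => ENNReal.ofReal ((M.twoStage f₁ f₂ z - M.tauStar) ^ 2) :=
    ((M.measurable_twoStage hm h₁.measurable h₂.measurable).pow_const 2).ennreal_ofReal
  rw [← lintegral_map hmeas (measurable_pi_lambda _ hZ), hmap]
  refine (M.lintegral_twoStage_sq_le hm hμ hv h₁.measurable h₂.measurable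
    (h₁.isMin.mono fun z hz => hFn _ hz.1) (h₂.isMin.mono fun z hz => hFn _ hz.1)
    (ne_top_of_le_ne_top hRfin (hreg _ h₁)) (ne_top_of_le_ne_top hRfin (hreg _ h₂))).trans ?_
  gcongr
  refine (add_le_add (hreg _ h₁) (hreg _ h₂)).trans (le_of_eq ?_)
  rw [ENNReal.ofReal_mul zero_le_two, ENNReal.ofReal_ofNat]
  ring
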